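/- **Definitions.** Let $d\ge 2$ and $\widehat{\mathbb R^d}=\mathbb R^d\cup\{\infty\}$. A *$d$-ball* is a closed ball of radius $r$ (curvature $1/r$), the complement of an open ball of radius $r$ (curvature $-1/r$), or a closed half-space together with $\infty$ (curvature $0$). The *Möbius group* of $\widehat{\mathbb R^d}$ is the group generated by the inversions in spheres and the reflections in hyperplanes. A convex polytope $\mathcal P\subset\mathbb R^{d+1}$ with the origin in its interior is *edge-scribed* if each of its edges is tangent to the unit sphere $\mathbb S^d$. For a point $v$ with $\|v\|>1$ let $b_v$ be the $d$-ball obtained by stereographic projection of the illuminated cap $\{p\in\mathbb S^d:\langle v,p\rangle\ge 1\}$. A *polytopal $d$-ball packing* is a family $\mathcal B_{\mathcal P}=\{\mu(b_v): v \text{ a vertex of }\mathcal P\}$, where $\mathcal P$ is edge-scribed and $\mu$ is a Möbius transformation; its dual is $\mathcal B_{\mathcal P}^*=\{\mu(b_w): w\text{ a vertex of the polar polytope of }\mathcal P\}$. The *Apollonian group* $\mathsf A(\mathcal B_{\mathcal P})$ is the group generated by the inversions in the boundary spheres of the balls of $\mathcal B_{\mathcal P}^*$, and $\Omega(\mathcal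 B_{\mathcal P})=\mathsf A(\mathcal B_{\mathcal P})\cdot\mathcal B_{\mathcal P}$ is the orbit of the packing. $\Omega(\mathcal B_{\mathcal P})$ is called a *tetrahedral*, *octahedral* or *cubical Apollonian circle packing* if $d=2$ and $\mathcal P$ has the combinatorial type of the tetrahedron, the octahedron or the cube, and an *orthoplicial Apollonian sphere packing* if $d=3$ and $\mathcal P=\mathcal O^4$ has the combinatorial type of the $4$-dimensional cross polytope. It is *integral* if the curvatures of all its balls are integers. An *Apollonian section* of $\Omega(\mathcal B_{\mathcal P})$ is a set $\Gamma\cdot X$ with a subgroup $\Gamma\le\mathsf A(\mathcal B_{\mathcal P})$ and a subset $X\subseteq\mathcal B_{\mathcal P}$. Two sections $\Gamma\cdot X$ and $\Gamma'\cdot X'$ are *arithmetically equivalent* if there are a group isomorphism $\phi:\Gamma\to\Gamma'$ and a bijection $\psi:\Gamma\cdot X\to\Gamma'\cdot X'$ that preserves curvatures and satisfies $\psi(g\cdot b)=\phi(g)\cdot\psi(b)$ for all $g\in\Gamma$ and $b\in X$. **Theorem.** Let $\Omega(\mathcal B_{\mathcal P})$ be a tetrahedral, octahedral or cubical Apollonian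 circle packing. Then there is an orthoplicial Apollonian sphere packing $\Omega(\mathcal B_{\mathcal O^4})$ such that 1. $\Omega(\mathcal B_{\mathcal O^4})$ contains an Apollonian section $\Gamma\cdot X$ that is arithmetically equivalent to $\Omega(\mathcal B_{\mathcal P})=\mathsf A(\mathcal B_{\mathcal P})\cdot\mathcal B_{\mathcal P}$, and 2. $\Omega(\mathcal B_{\mathcal P})$ is integral if and only if $\Omega(\mathcal B_{\mathcal O^4})$ is integral. -/

import Mathlib

open Set

noncomputable section

namespace ApollonianSections

/-- Euclidean `n`-space. -/
abbrev Euc (n : ℕ) : Type := EuclideanSpace ℝ (Fin n)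

/-- The one-point compactification `ℝ^d ∪ {∞}`, on which Möbius transformations act. -/
abbrev Hat (d : ℕ) : Type := OnePoint (Euc d)

/-! ### Balls, curvatures and inversions -/

/-- The inversion of `ℝ^d ∪ {∞}` in the sphere with centre `c` and radius `r`; it exchanges `c`
and `∞`. -/
def sphereInversionFun {d : ℕ} (c : Euc d) (r : ℝ) (p : Hat d) : Hat d :=
  open Classical in
  p.elim (OnePoint.some c) fun x =>
    if x = c then OnePoint.infty else OnePoint.some (EuclideanGeometry.inversion c r x)

/-- The reflection of `ℝ^d ∪ {∞}` in the hyperplane `⟪n, x⟫ = δ`, for a unit vector `n`;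
it fixes `∞`. -/
def hyperplaneReflectionFun {d : ℕ} (n : Euc d) (δ : ℝ) (p : Hat d) : Hat d :=
  p.elim OnePoint.infty fun x => OnePoint.some (x - (2 * (inner ℝ n x - δ)) • n)

theorem sphereInversionFun_involutive {d : ℕ} (c : Euc d) {r : ℝ} (hr : 0 < r) :
    Function.Involutive (sphereInversionFun c r) := by
  intro p
  induction p using OnePoint.rec with
  | infty => simp [sphereInversionFun]
  | coe x =>
    by_cases h : x = c
    · simp [sphereInversionFun, h]
    · have h2 : EuclideanGeometry.inversion c r x ≠ c := by
        rw [Ne, EuclideanGeometry.inversion_eq_center hr.ne']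
        exact h
      simp [sphereInversionFun, h, h2, EuclideanGeometry.inversion_inversion c hr.ne' x]

theorem hyperplaneReflectionFun_involutive {d : ℕ} {n : Euc d} (δ : ℝ) (hn : ‖n‖ = 1) :
    Function.Involutive (hyperplaneReflectionFun n δ) := by
  intro p
  induction p using OnePoint.rec with
  | infty => rfl
  | coe x =>
    simp only [hyperplaneReflectionFun, OnePoint.elim_some]
    congr 1
    rw [inner_sub_right, inner_smul_right, real_inner_self_eq_norm_sq, hn, sub_sub, ← add_smul]
    have : 2 * (inner ℝ n x - δ) + 2 * (inner ℝ n x - 2 * (inner ℝ n x - δ) * 1 ^ 2 - δ) = 0 := by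
      ring
    rw [this, zero_smul, sub_zero]

/-- The closed `d`-balls of `ℝ^d ∪ {∞}`: ordinary closed balls, exteriors of ordinary balls,
and half-spaces. -/
inductive Ball (d : ℕ) : Type
  | inside (c : Euc d) (r : ℝ) (hr : 0 < r) : Ball d
  | outside (c : Euc d) (r : ℝ) (hr : 0 < r) : Ball d
  | halfSpace (n : Euc d) (δ : ℝ) (hn : ‖n‖ = 1) : Ball d

namespace Ball

/-- The set of points of a `d`-ball. -/
def carrier {d : ℕ} : Ball d → Set (Hat d)
  | inside c r _ => OnePoint.some '' Metric.closedBall c r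
  | outside c r _ => (OnePoint.some '' Metric.ball c r)ᶜ
  | halfSpace n δ _ => insert OnePoint.infty (OnePoint.some '' {x : Euc d | δ ≤ inner ℝ n x})

/-- The (signed) curvature of a `d`-ball. -/
def curvature {d : ℕ} : Ball d → ℝ
  | inside _ r _ => r⁻¹
  | outside _ r _ => -r⁻¹
  | halfSpace _ _ _ => 0

/-- The inversion in the boundary sphere of a `d`-ball. -/
def inversion {d : ℕ} : Ball d → Equiv.Perm (Hat d)
  | inside c _ hr => (sphereInversionFun_involutive c hr).toPerm
  | outside c _ hr => (sphereInversionFun_involutive c hr).toPerm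
  | halfSpace _ δ hn => (hyperplaneReflectionFun_involutive δ hn).toPerm

end Ball

/-- The set `s` is a `d`-ball, and its curvature is `k`. -/
def HasCurvature {d : ℕ} (s : Set (Hat d)) (k : ℝ) : Prop :=
  ∃ b : Ball d, b.carrier = s ∧ b.curvature = k

/-- The Möbius group of `ℝ^d ∪ {∞}`: the group generated by all inversions. -/
def moebiusGroup (d : ℕ) : Subgroup (Equiv.Perm (Hat d)) :=
  Subgroup.closure (range (Ball.inversion (d := d)))

/-! ### Edge-scribed polytopes

A polytope containing the origin in its interior is given by its family of vertices
`v : V → Euc n`; its faces are encoded by the sets of (indices of) vertices lying on them. -/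

/-- `{x | ⟪w, x⟫ = 1}` is a supporting hyperplane (or misses the polytope), and the vertices on it
are those in `S`. -/
def CutsFace {n : ℕ} {V : Type} (v : V → Euc n) (w : Euc n) (S : Set V) : Prop :=
  (∀ i, inner ℝ w (v i) ≤ 1) ∧ {i | inner ℝ w (v i) = 1} = S

/-- The segment joining two different vertices is an edge. -/
def IsEdge {n : ℕ} {V : Type} (v : V → Euc n) (i j : V) : Prop :=
  i ≠ j ∧ ∃ w, CutsFace v w {i, j}

/-- `S` is the vertex set of a facet and `w` is the corresponding vertex of the polar polytope
`{y | ⟪y, x⟫ ≤ 1 for all x in the polytope}`. The hyperplane `⟪w, x⟫ = 1` misses the origin, so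
the facet spans it affinely if and only if its vertices span the whole space linearly. -/
def IsFacetWithPolar {n : ℕ} {V : Type} (v : V → Euc n) (S : Set V) (w : Euc n) : Prop :=
  CutsFace v w S ∧ Submodule.span ℝ (v '' S) = ⊤

/-- The three families of regular polytopes that exist in every dimension. In dimension `3` they
are the tetrahedron, the octahedron and the cube; the `4`-dimensional cross polytope is the
orthoplex. -/
inductive Family : Type
  | simplex
  | crossPolytope
  | cube

namespace Family

/-- Labels for the vertices of the `n`-dimensional member of a family. -/
abbrev Vertex (n : ℕ) : Family → Type
  | simplex => Fin (n + 1)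
  | crossPolytope => Fin n × Bool
  | cube => Fin n → Bool

/-- The vertex sets of the facets of the `n`-dimensional member of a family: all vertices but one
for the simplex, one vertex out of each antipodal pair for the cross polytope, the vertices with
one prescribed coordinate for the cube. -/
def facets (n : ℕ) : (K : Family) → Set (Set (K.Vertex n))
  | simplex => {S : Set (Fin (n + 1)) | ∃ i, S = {i}ᶜ}
  | crossPolytope => {S : Set (Fin n × Bool) | ∃ s : Fin n → Bool, S = {x | x.2 = s x.1}}
  | cube => {S : Set (Fin n → Bool) | ∃ (i : Fin n) (b : Bool), S = {x | x i = b}}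

end Family

/-- An edge-scribed realization of the `n`-dimensional polytope of the family `K`: a convex
polytope (not necessarily regular) with the combinatorial type of that polytope, with the
origin in its interior (so that its polar is a polytope), and with every edge tangent to the unit
sphere. -/
structure EdgeScribed (n : ℕ) (K : Family) where
  vertex : K.Vertex n → Euc n
  zero_mem_interior : (0 : Euc n) ∈ interior (convexHull ℝ (range vertex))
  convexIndependent : ConvexIndependent ℝ vertex
  facets_eq : {S | ∃ w, IsFacetWithPolar vertex S w} = K.facets n
  edge_tangent : ∀ i j, IsEdge vertex i j →
    ∃ p ∈ openSegment ℝ (vertex i) (vertex j), ‖p‖ = 1 ∧ inner ℝ p (vertex j - vertex i) = 0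

/-! ### Ball-arrangement projection, polytopal packings, Apollonian clusters -/

/-- Stereographic projection from the north pole of the unit sphere of `ℝ^(d+1)` onto
`ℝ^d ∪ {∞}`, where `ℝ^d` is the equatorial hyperplane. -/
def stereo {d : ℕ} (p : Euc (d + 1)) : Hat d :=
  open Classical in
  if p (Fin.last d) = 1 then OnePoint.infty
  else OnePoint.some ((1 - p (Fin.last d))⁻¹ • WithLp.toLp 2 (fun i : Fin d => p i.castSucc))

/-- The projection of the part of the unit sphere illuminated from the outer point `v`: a point
`p` of the sphere is visible from `v` if and only if `⟪v, p⟫ ≥ 1`. -/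
def lightBall {d : ℕ} (v : Euc (d + 1)) : Set (Hat d) :=
  stereo '' {p | ‖p‖ = 1 ∧ 1 ≤ inner ℝ v p}

/-- A polytopal `d`-ball packing whose tangency polytope is of the family `K`: the image of the
ball-arrangement projection of an edge-scribed realization under a Möbius transformation. -/
structure PolytopalPacking (d : ℕ) (K : Family) where
  polytope : EdgeScribed (d + 1) K
  moebius : Equiv.Perm (Hat d)
  moebius_mem : moebius ∈ moebiusGroup d

/-- The orbit `Γ · X` of a set `X` of balls under a group `Γ` of transformations. -/
def orbit {d : ℕ} (Γ : Subgroup (Equiv.Perm (Hat d))) (X : Set (Set (Hat d))) :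
    Set (Set (Hat d)) :=
  {s | ∃ g ∈ Γ, ∃ b ∈ X, g '' b = s}

namespace PolytopalPacking

/-- The balls of the packing. -/
def balls {d : ℕ} {K : Family} (B : PolytopalPacking d K) : Set (Set (Hat d)) :=
  {s | ∃ i, B.moebius '' lightBall (B.polytope.vertex i) = s}

/-- The balls of the dual: the same construction for the polar polytope. -/
def dualBalls {d : ℕ} {K : Family} (B : PolytopalPacking d K) : Set (Set (Hat d)) :=
  {s | ∃ S w, IsFacetWithPolar B.polytope.vertex S w ∧ B.moebius '' lightBall w = s}

/-- The Apollonian group: it is generated by the inversions in the dual balls. -/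
def apollonianGroup {d : ℕ} {K : Family} (B : PolytopalPacking d K) :
    Subgroup (Equiv.Perm (Hat d)) :=
  Subgroup.closure {g | ∃ b : Ball d, b.carrier ∈ B.dualBalls ∧ b.inversion = g}

/-- The Apollonian cluster (the Apollonian packing) `Ω(B)`. -/
def cluster {d : ℕ} {K : Family} (B : PolytopalPacking d K) : Set (Set (Hat d)) :=
  orbit B.apollonianGroup B.balls

/-- `Ω(B)` is integral: all its curvatures are integers. -/
def IsIntegral {d : ℕ} {K : Family} (B : PolytopalPacking d K) : Prop :=
  ∀ s ∈ B.cluster, ∃ m : ℤ, HasCurvature s (m : ℝ)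

end PolytopalPacking

/-! ### Apollonian sections -/

/-- `Γ · X` is an Apollonian section of the cluster of `B`. -/
def IsSection {d : ℕ} {K : Family} (B : PolytopalPacking d K)
    (Γ : Subgroup (Equiv.Perm (Hat d))) (X : Set (Set (Hat d))) : Prop :=
  Γ ≤ B.apollonianGroup ∧ X ⊆ B.balls

/-- The sections `Γ · X` and `Γ' · X'` are arithmetically equivalent: there are a group isomorphism
`φ : Γ → Γ'` and a bijection `ψ : Γ · X → Γ' · X'` that preserves curvatures and satisfies
`ψ (g · b) = φ g · ψ b` for all `g ∈ Γ` and `b ∈ X`. -/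
def ArithmeticallyEquivalent {d d' : ℕ}
    (Γ : Subgroup (Equiv.Perm (Hat d))) (X : Set (Set (Hat d)))
    (Γ' : Subgroup (Equiv.Perm (Hat d'))) (X' : Set (Set (Hat d'))) : Prop :=
  ∃ (φ : Γ ≃* Γ') (ψ : orbit Γ X ≃ orbit Γ' X'),
    (∀ (g : Γ) (b gb : orbit Γ X), b.1 ∈ X → gb.1 = g.1 '' b.1 →
      (ψ gb).1 = (φ g).1 '' (ψ b).1) ∧
    (∀ b : orbit Γ X, ∃ k : ℝ, HasCurvature b.1 k ∧ HasCurvature (ψ b).1 k)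

end ApollonianSections

end

/-! Closed balls of dimension `d` are the unit space-like vectors of a Lorentz space of signature
`(d + 1, 1)`. Möbius transformations act on it by linear isometries, inversions by reflections, and
the curvature of a ball is `-2` times its product with the null vector of `∞`. Conversely, every
null vector of the future cone yields the curvature functional after a suitable Möbius
transformation (`exists_moebius_curvature`).

An edge is tangent to the sphere exactly in such a way that the unit vectors of its end points have
product `-1` (`edge_gram`). For the tetrahedron this is the whole Gram matrix; for the octahedron
the products of opposite vertices are forced by the dimension `4`; for the cube the same argument is
applied to the polar vectors of the six faces. Hence every edge-scribed realization has its vertices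
in standard position in an orthogonal frame, regular or not.

The regular orthoplex has vertices `(±e_i, 1)` and dual vectors `(±1/2, ±1/2, ±1/2, ±1/2; 1)` for
the form `2 ∑ a_i² - t²`. A linear map `π` from the four-sphere-coordinate space `Lor 3` onto `Lor
2` with kernel spanned by `u` carries some vertices of the orthoplex to those of the polyhedron: a
facet gives the tetrahedron (`u` proportional to its dual vector), the equator gives the octahedron
(`u` the fourth axis), and all eight vertices, projected along `u = (1, 1, 1, 1; 0)`, give the cube.
Each facet reflection of the polyhedron is intertwined by `π` with one orthoplicial reflection, or
with a product of two for the octahedron. The curvature functional of the circle packing composed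
with `π` is again null, so it is the curvature functional of some orthoplicial packing, and `π`
preserves curvatures. Intertwined pairs of isometries form a group with two injective projections,
which is the graph of the required isomorphism (`LinearSection.conclusion`). That no information is
lost along `u` rests, for octahedron and cube, on an invariant modulo `4` of the orthoplicial orbits
(`IsLatticeVec`).

Integrality passes from spheres to circles through the section. Conversely, orthoplicial orbits
consist of integral combinations of the eight vertices, so those eight curvatures suffice. For the
cube all eight occur among the circles; for the tetrahedron the others are integral combinations
modulo `u`; for the octahedron both poles have half the sum of two opposite curvatures, and the null
relation makes that sum even. -/

noncomputable section

namespace ApollonianSections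

/-! ### The Lorentz model of the space of balls -/

/-- Lorentz space of signature `(d + 1, 1)` in light-cone coordinates. -/
abbrev Lor (d : ℕ) : Type := Euc d × ℝ × ℝ

/-- The Lorentz form. -/
def lor {d : ℕ} : LinearMap.BilinForm ℝ (Lor d) :=
  LinearMap.mk₂ ℝ (fun x y => inner ℝ x.1 y.1 - (x.2.1 * y.2.2 + x.2.2 * y.2.1) / 2)
    (by intro x y z; simp only [Prod.fst_add, Prod.snd_add, inner_add_left]; ring)
    (by intro c x y; simp only [Prod.smul_fst, Prod.smul_snd, real_inner_smul_left, smul_eq_mul]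
        ring)
    (by intro x y z; simp only [Prod.fst_add, Prod.snd_add, inner_add_right]; ring)
    (by intro c x y; simp only [Prod.smul_fst, Prod.smul_snd, real_inner_smul_right, smul_eq_mul]
        ring)

theorem lor_apply {d : ℕ} (x y : Lor d) :
    lor x y = inner ℝ x.1 y.1 - (x.2.1 * y.2.2 + x.2.2 * y.2.1) / 2 := rfl

theorem lor_comm {d : ℕ} (x y : Lor d) : lor x y = lor y x := by
  rw [lor_apply, lor_apply, real_inner_comm]; ring

theorem lor_add_left {d : ℕ} (x y z : Lor d) : lor (x + y) z = lor x z + lor y z := by simp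
theorem lor_sub_left {d : ℕ} (x y z : Lor d) : lor (x - y) z = lor x z - lor y z := by simp
theorem lor_smul_left {d : ℕ} (c : ℝ) (x z : Lor d) : lor (c • x) z = c * lor x z := by simp
theorem lor_add_right {d : ℕ} (x y z : Lor d) : lor z (x + y) = lor z x + lor z y := by simp
theorem lor_sub_right {d : ℕ} (x y z : Lor d) : lor z (x - y) = lor z x - lor z y := by simp
theorem lor_smul_right {d : ℕ} (c : ℝ) (x z : Lor d) : lor z (c • x) = c * lor z x := by simp

/-- The light-like vector representing a point. -/
def lift {d : ℕ} (p : Hat d) : Lor d := p.elim (0, 0, 1) fun y => (y, 1, ‖y‖ ^ 2)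

theorem lift_infty {d : ℕ} : lift (OnePoint.infty : Hat d) = (0, 0, 1) := rfl
theorem lift_some {d : ℕ} (y : Euc d) : lift (OnePoint.some y : Hat d) = (y, 1, ‖y‖ ^ 2) := rfl

theorem lor_lift_infty {d : ℕ} (x : Lor d) : lor x (lift OnePoint.infty) = -x.2.1 / 2 := by
  simp [lor_apply, lift_infty]; ring

theorem lor_lift_self {d : ℕ} (p : Hat d) : lor (lift p) (lift p) = 0 := by
  induction p using OnePoint.rec with
  | infty => simp [lor_apply, lift_infty]
  | coe y => simp [lor_apply, lift_some]

/-- The points on the positive side of a vector. -/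
def cap {d : ℕ} (x : Lor d) : Set (Hat d) := {p | 0 ≤ lor x (lift p)}

theorem cap_smul {d : ℕ} {c : ℝ} (hc : 0 < c) (x : Lor d) : cap (c • x) = cap x := by
  ext p
  simp [cap, hc]

/-- The linear map underlying `refl`. -/
def reflMap {d : ℕ} (x : Lor d) : Lor d →ₗ[ℝ] Lor d where
  toFun y := y - (2 * lor x y / lor x x) • x
  map_add' y z := by
    rw [lor_add_right, mul_add, add_div]
    module
  map_smul' c y := by
    rw [lor_smul_right, RingHom.id_apply, smul_sub, smul_smul]
    congr 2
    ring

/-- The reflection in the hyperplane orthogonal to `x` (the identity if `x` is light-like). -/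
def refl {d : ℕ} (x : Lor d) : Lor d ≃ₗ[ℝ] Lor d :=
  LinearEquiv.ofInvolutive (reflMap x) <| by
    intro y
    change (y - (2 * lor x y / lor x x) • x) - (2 * lor x (y - (2 * lor x y / lor x x) • x) /
      lor x x) • x = y
    rw [lor_sub_right, lor_smul_right, sub_sub, ← add_smul]
    by_cases h : lor x x = 0
    · simp [h]
    · have : 2 * lor x y / lor x x + 2 * (lor x y - 2 * lor x y / lor x x * lor x x) / lor x x
          = 0 := by
        field_simp
        ring
      rw [this, zero_smul, sub_zero]

theorem refl_apply {d : ℕ} (x y : Lor d) : refl x y = y - (2 * lor x y / lor x x) • x := rfl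

theorem refl_refl {d : ℕ} (x y : Lor d) : refl x (refl x y) = y :=
  (refl x).left_inv y

theorem refl_inv {d : ℕ} (x : Lor d) : (refl x)⁻¹ = refl x := rfl

theorem refl_smul {d : ℕ} {c : ℝ} (hc : c ≠ 0) (x : Lor d) : refl (c • x) = refl x := by
  ext1 y
  rw [refl_apply, refl_apply, lor_smul_left, lor_smul_left, lor_smul_right, smul_smul]
  congr 2
  by_cases h : lor x x = 0
  · simp [h]
  · field_simp

theorem refl_neg {d : ℕ} (x : Lor d) : refl (-x) = refl x := by
  rw [← neg_one_smul ℝ x, refl_smul (by norm_num)]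

/-- Linear isometries of Lorentz space. -/
def IsIso {d : ℕ} (M : Lor d ≃ₗ[ℝ] Lor d) : Prop := ∀ x y, lor (M x) (M y) = lor x y

theorem IsIso.one {d : ℕ} : IsIso (1 : Lor d ≃ₗ[ℝ] Lor d) := fun _ _ => rfl

theorem IsIso.mul {d : ℕ} {M N : Lor d ≃ₗ[ℝ] Lor d} (hM : IsIso M) (hN : IsIso N) :
    IsIso (M * N) := fun x y => (hM _ _).trans (hN x y)

theorem IsIso.inv {d : ℕ} {M : Lor d ≃ₗ[ℝ] Lor d} (hM : IsIso M) : IsIso M⁻¹ := by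
  intro x y
  rw [← hM, ← LinearEquiv.mul_apply, ← LinearEquiv.mul_apply, mul_inv_cancel]
  rfl

theorem isIso_refl {d : ℕ} (x : Lor d) : IsIso (refl x) := by
  intro y z
  rw [refl_apply, refl_apply]
  simp only [lor_sub_left, lor_sub_right, lor_smul_left, lor_smul_right]
  rw [lor_comm y x]
  by_cases h : lor x x = 0
  · simp [h]
  · field_simp
    ring

theorem inv_apply_self' {d : ℕ} (M : Lor d ≃ₗ[ℝ] Lor d) (x : Lor d) : M⁻¹ (M x) = x :=
  M.symm_apply_apply x

theorem apply_inv_self' {d : ℕ} (M : Lor d ≃ₗ[ℝ] Lor d) (x : Lor d) : M (M⁻¹ x) = x :=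
  M.apply_symm_apply x

theorem IsIso.lor_apply_left {d : ℕ} {M : Lor d ≃ₗ[ℝ] Lor d} (hM : IsIso M) (x y : Lor d) :
    lor (M x) y = lor x (M⁻¹ y) := by
  rw [← hM x, apply_inv_self']

theorem IsIso.mul_refl_mul_inv {d : ℕ} {M : Lor d ≃ₗ[ℝ] Lor d} (hM : IsIso M) (x : Lor d) :
    M * refl x * M⁻¹ = refl (M x) := by
  ext1 y
  rw [LinearEquiv.mul_apply, LinearEquiv.mul_apply, refl_apply, refl_apply, map_sub,
    apply_inv_self', map_smul, hM, hM.lor_apply_left]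

/-- The linear isometry `M` induces the transformation `g`. -/
def Realizes {d : ℕ} (g : Equiv.Perm (Hat d)) (M : Lor d ≃ₗ[ℝ] Lor d) : Prop :=
  IsIso M ∧ ∀ p, ∃ c : ℝ, 0 < c ∧ lift (g p) = c • M (lift p)

theorem Realizes.one {d : ℕ} : Realizes (1 : Equiv.Perm (Hat d)) 1 :=
  ⟨IsIso.one, fun p => ⟨1, one_pos, by simp⟩⟩

theorem Realizes.mul {d : ℕ} {g h : Equiv.Perm (Hat d)} {M N : Lor d ≃ₗ[ℝ] Lor d}
    (hg : Realizes g M) (hh : Realizes h N) : Realizes (g * h) (M * N) := by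
  refine ⟨hg.1.mul hh.1, fun p => ?_⟩
  obtain ⟨c, hc, h1⟩ := hh.2 p
  obtain ⟨c', hc', h2⟩ := hg.2 (h p)
  refine ⟨c' * c, mul_pos hc' hc, ?_⟩
  rw [Equiv.Perm.mul_apply, h2, h1, map_smul, smul_smul, LinearEquiv.mul_apply]

theorem Realizes.inv {d : ℕ} {g : Equiv.Perm (Hat d)} {M : Lor d ≃ₗ[ℝ] Lor d}
    (hg : Realizes g M) : Realizes g⁻¹ M⁻¹ := by
  refine ⟨hg.1.inv, fun p => ?_⟩
  obtain ⟨c, hc, h1⟩ := hg.2 (g⁻¹ p)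
  refine ⟨c⁻¹, inv_pos.2 hc, ?_⟩
  rw [← Equiv.Perm.mul_apply, mul_inv_cancel, Equiv.Perm.one_apply] at h1
  rw [h1, map_smul, inv_apply_self', smul_smul, inv_mul_cancel₀ hc.ne', one_smul]

/-- Membership in a cap only depends on a sign, so the positive factors relating `lift (g p)` to `M
(lift p)` are harmless. This is why positivity is part of `Realizes`. -/
theorem Realizes.image_cap {d : ℕ} {g : Equiv.Perm (Hat d)} {M : Lor d ≃ₗ[ℝ] Lor d}
    (hg : Realizes g M) (x : Lor d) : g '' cap x = cap (M x) := by
  ext p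
  rw [Equiv.image_eq_preimage_symm]
  obtain ⟨c, hc, h⟩ := hg.inv.2 p
  change 0 ≤ lor x (lift (g⁻¹ p)) ↔ 0 ≤ lor (M x) (lift p)
  rw [h, lor_smul_right, hg.1.lor_apply_left, mul_nonneg_iff_of_pos_left hc]

/-! ### Balls as vectors -/

/-- The unit vector representing a ball. -/
def Ball.vec {d : ℕ} : Ball d → Lor d
  | .inside c r _ => (r⁻¹ • c, r⁻¹, r⁻¹ * (‖c‖ ^ 2 - r ^ 2))
  | .outside c r _ => -(r⁻¹ • c, r⁻¹, r⁻¹ * (‖c‖ ^ 2 - r ^ 2))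
  | .halfSpace n δ _ => (n, 0, 2 * δ)

theorem lor_vec_inside {d : ℕ} (c : Euc d) {r : ℝ} (hr : 0 < r) :
    lor ((r⁻¹ • c, r⁻¹, r⁻¹ * (‖c‖ ^ 2 - r ^ 2)) : Lor d)
      (r⁻¹ • c, r⁻¹, r⁻¹ * (‖c‖ ^ 2 - r ^ 2)) = 1 := by
  rw [lor_apply]
  dsimp only
  rw [real_inner_smul_left, real_inner_smul_right, real_inner_self_eq_norm_sq]
  field_simp
  ring

theorem Ball.lor_vec {d : ℕ} (b : Ball d) : lor b.vec b.vec = 1 := by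
  cases b with
  | inside c r hr => exact lor_vec_inside c hr
  | outside c r hr =>
    have := lor_vec_inside c hr
    rw [Ball.vec, map_neg, map_neg, LinearMap.neg_apply, neg_neg, this]
  | halfSpace n δ hn => simp [Ball.vec, lor_apply, hn]

theorem Ball.curvature_eq {d : ℕ} (b : Ball d) : b.curvature = b.vec.2.1 := by
  cases b <;> rfl

/-- The product is the power of the point with respect to the sphere, up to the factor `-1 / (2 *
r)`; its sign separates the inside from the outside. -/
theorem lor_inside_lift {d : ℕ} (c y : Euc d) {r : ℝ} (hr : 0 < r) :
    lor ((r⁻¹ • c, r⁻¹, r⁻¹ * (‖c‖ ^ 2 - r ^ 2)) : Lor d) (lift (OnePoint.some y)) =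
      (r ^ 2 - dist y c ^ 2) / (2 * r) := by
  rw [lift_some, lor_apply, dist_eq_norm, norm_sub_sq_real, real_inner_comm c y]
  simp only [real_inner_smul_left]
  field_simp
  ring

theorem Ball.carrier_eq {d : ℕ} (b : Ball d) : b.carrier = cap b.vec := by
  ext p
  cases b with
  | inside c r hr =>
    induction p using OnePoint.rec with
    | infty =>
      have : -r⁻¹ / 2 < 0 := by linarith [inv_pos.2 hr]
      simp [Ball.carrier, cap, lor_lift_infty, Ball.vec, this]
    | coe y =>
      change _ ∈ OnePoint.some '' _ ↔ 0 ≤ lor _ _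
      rw [Ball.vec, lor_inside_lift c y hr, OnePoint.coe_injective.mem_set_image,
        Metric.mem_closedBall, le_div_iff₀ (by positivity), zero_mul, sub_nonneg,
        sq_le_sq₀ dist_nonneg hr.le]
  | outside c r hr =>
    induction p using OnePoint.rec with
    | infty =>
      simp [Ball.carrier, cap, lor_lift_infty, Ball.vec]
      positivity
    | coe y =>
      change _ ∈ (OnePoint.some '' _)ᶜ ↔ 0 ≤ lor _ _
      rw [Ball.vec, map_neg, LinearMap.neg_apply, lor_inside_lift c y hr, mem_compl_iff,
        OnePoint.coe_injective.mem_set_image, neg_nonneg, div_le_iff₀ (by positivity), zero_mul,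
        sub_nonpos, Metric.mem_ball, not_lt, sq_le_sq₀ hr.le dist_nonneg]
  | halfSpace n δ hn =>
    induction p using OnePoint.rec with
    | infty => simp [Ball.carrier, cap, lor_lift_infty, Ball.vec]
    | coe y =>
      simp only [Ball.carrier, cap, Ball.vec, mem_insert_iff, OnePoint.coe_ne_infty, false_or,
        OnePoint.coe_injective.mem_set_image, mem_ofPred_eq, lor_apply, lift_some]
      constructor <;> intro h <;> linarith

/-- The sign of the curvature coordinate `k` selects the kind of ball; centre and radius are then
read off as `ξ / k` and `1 / |k|`. -/
theorem Ball.exists_vec_eq {d : ℕ} {x : Lor d} (hx : lor x x = 1) : ∃ b : Ball d, b.vec = x := by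
  obtain ⟨ξ, k, β⟩ := x
  simp only [lor_apply, real_inner_self_eq_norm_sq] at hx
  rcases lt_trichotomy k 0 with hk | rfl | hk
  · refine ⟨.outside (k⁻¹ • ξ) (-k)⁻¹ (by simpa using hk), ?_⟩
    simp only [Ball.vec, Prod.neg_mk, Prod.mk.injEq, norm_smul, smul_smul, inv_inv]
    refine ⟨?_, by ring, ?_⟩
    · rw [← neg_smul, neg_mul, neg_neg, mul_inv_cancel₀ hk.ne, one_smul]
    · rw [mul_pow, Real.norm_eq_abs, sq_abs]
      have hk' := hk.ne
      field_simp
      linear_combination hx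
  · refine ⟨.halfSpace ξ (β / 2) ?_, ?_⟩
    · rw [← sq_eq_sq₀ (norm_nonneg _) zero_le_one]; linarith
    · simp only [Ball.vec, Prod.mk.injEq, true_and]; ring
  · refine ⟨.inside (k⁻¹ • ξ) k⁻¹ (by simpa using hk), ?_⟩
    simp only [Ball.vec, Prod.mk.injEq, norm_smul, smul_smul, inv_inv]
    refine ⟨?_, trivial, ?_⟩
    · rw [mul_inv_cancel₀ hk.ne', one_smul]
    · rw [mul_pow, Real.norm_eq_abs, sq_abs]
      field_simp
      linear_combination hx

/-- In each case the factor is what restores the normalization of `lift` after the reflection: `r ^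
2` at `∞`, its inverse at the centre, `(r / dist y c) ^ 2` elsewhere. -/
theorem realizes_sphere {d : ℕ} (c : Euc d) {r : ℝ} (hr : 0 < r) :
    Realizes (sphereInversionFun_involutive c hr).toPerm
      (refl ((r⁻¹ • c, r⁻¹, r⁻¹ * (‖c‖ ^ 2 - r ^ 2)) : Lor d)) := by
  refine ⟨isIso_refl _, fun p => ?_⟩
  rw [refl_apply, lor_vec_inside c hr]
  change ∃ k, _ ∧ lift (sphereInversionFun c r p) = _
  induction p using OnePoint.rec with
  | infty =>
    refine ⟨r ^ 2, by positivity, ?_⟩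
    rw [lor_lift_infty]
    simp only [sphereInversionFun, OnePoint.elim_infty, lift_some, lift_infty]
    ext1
    · simp only [Prod.fst_sub, Prod.smul_fst, smul_smul, zero_sub, ← neg_smul]
      rw [show r ^ 2 * -(2 * (-r⁻¹ / 2) / 1 * r⁻¹) = 1 by field_simp, one_smul]
    · ext1 <;> simp <;> field_simp <;> ring
  | coe y =>
    rw [lor_inside_lift c y hr]
    by_cases h : y = c
    · subst h
      refine ⟨(r ^ 2)⁻¹, by positivity, ?_⟩
      simp only [sphereInversionFun, OnePoint.elim_some, if_true, lift_some, lift_infty, dist_self]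
      ext1
      · simp only [Prod.fst_sub, Prod.smul_fst, smul_smul]
        rw [show 2 * ((r ^ 2 - 0 ^ 2) / (2 * r)) / 1 * r⁻¹ = 1 by field_simp; ring, one_smul,
          sub_self, smul_zero]
      · ext1
        · simp [hr.ne']
          field_simp
          simp
        · simp
          field_simp
          ring
    · have hd : 0 < dist y c := dist_pos.2 h
      refine ⟨(r / dist y c) ^ 2, by positivity, ?_⟩
      simp only [sphereInversionFun, OnePoint.elim_some, if_neg h, lift_some,
        EuclideanGeometry.inversion, vsub_eq_sub, vadd_eq_add]
      have hn := norm_sub_sq_real y c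
      rw [← dist_eq_norm] at hn
      ext1
      · simp only [Prod.fst_sub, Prod.smul_fst, smul_smul, smul_sub]
        rw [show (r / dist y c) ^ 2 * (2 * ((r ^ 2 - dist y c ^ 2) / (2 * r)) / 1) * r⁻¹ =
          (r / dist y c) ^ 2 - 1 by field_simp, sub_smul, one_smul]
        abel
      · ext1
        · simp; field_simp; ring
        · rw [norm_add_sq_real, norm_smul, inner_smul_left, inner_sub_left, mul_pow, Real.norm_eq_abs,
            abs_of_nonneg (by positivity), ← dist_eq_norm]
          simp
          have : ‖y‖ ^ 2 = dist y c ^ 2 + 2 * inner ℝ y c - ‖c‖ ^ 2 := by linarith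
          rw [this]
          field_simp
          ring

theorem Ball.realizes_inversion {d : ℕ} (b : Ball d) : Realizes b.inversion (refl b.vec) := by
  cases b with
  | inside c r hr => exact realizes_sphere c hr
  | outside c r hr => rw [Ball.vec, refl_neg]; exact realizes_sphere c hr
  | halfSpace n δ hn =>
    refine ⟨isIso_refl _, fun p => ⟨1, one_pos, ?_⟩⟩
    rw [one_smul, refl_apply, Ball.lor_vec]
    change lift (hyperplaneReflectionFun n δ p) = _
    induction p using OnePoint.rec with
    | infty => simp [hyperplaneReflectionFun, lift_infty, Ball.vec, lor_apply]
    | coe y =>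
      simp only [hyperplaneReflectionFun, OnePoint.elim_some, lift_some, Ball.vec, lor_apply]
      ext1
      · simp only [Prod.fst_sub, Prod.smul_fst]
        congr 2
        ring
      · ext1
        · simp
        · simp only [norm_sub_sq_real, inner_smul_right, norm_smul, hn, real_inner_comm n y,
            Prod.snd_sub, Prod.smul_snd, smul_eq_mul, mul_pow, Real.norm_eq_abs, sq_abs]
          ring

/-! ### A ball is determined by its points -/

theorem exists_norm_eq_one {d : ℕ} [NeZero d] : ∃ u : Euc d, ‖u‖ = 1 :=
  ⟨EuclideanSpace.single 0 1, by simp⟩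

/-- Test the inclusion on the point of the first ball farthest from `c'`. When the centres agree any
direction serves, which needs positive dimension. -/
theorem add_dist_le_of_closedBall_subset {d : ℕ} [NeZero d] {c c' : Euc d} {r r' : ℝ}
    (hr : 0 < r) (h : Metric.closedBall c r ⊆ Metric.closedBall c' r') : r + dist c c' ≤ r' := by
  have key : ∃ u : Euc d, ‖u‖ = 1 ∧ c - c' = dist c c' • u := by
    by_cases hc : c = c'
    · obtain ⟨u, hu⟩ := exists_norm_eq_one (d := d)
      exact ⟨u, hu, by simp [hc]⟩
    · have h0 : dist c c' ≠ 0 := dist_ne_zero.2 hc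
      refine ⟨(dist c c')⁻¹ • (c - c'), ?_, by rw [smul_smul, mul_inv_cancel₀ h0, one_smul]⟩
      rw [norm_smul, ← dist_eq_norm, norm_inv, Real.norm_of_nonneg dist_nonneg, inv_mul_cancel₀ h0]
  obtain ⟨u, hu, hcu⟩ := key
  have h1 : c + r • u ∈ Metric.closedBall c r := by
    simp [dist_eq_norm, norm_smul, hu, abs_of_pos hr]
  have h2 := h h1
  rw [Metric.mem_closedBall, dist_eq_norm, show c + r • u - c' = (r + dist c c') • u by
    rw [add_smul, ← hcu]; abel, norm_smul, hu, mul_one,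
    Real.norm_of_nonneg (add_nonneg hr.le dist_nonneg)] at h2
  exact h2

theorem closedBall_injective {d : ℕ} [NeZero d] {c c' : Euc d} {r r' : ℝ} (hr : 0 < r)
    (hr' : 0 < r') (h : Metric.closedBall c r = Metric.closedBall c' r') : c = c' ∧ r = r' := by
  have h1 := add_dist_le_of_closedBall_subset hr h.subset
  have h2 := add_dist_le_of_closedBall_subset hr' h.superset
  rw [dist_comm] at h2
  have := dist_nonneg (x := c) (y := c')
  exact ⟨dist_le_zero.1 (by linarith), by linarith⟩

theorem halfSpace_subset {d : ℕ} {n n' : Euc d} {δ δ' : ℝ} (hn : ‖n‖ = 1) (hn' : ‖n'‖ = 1)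
    (h : {x : Euc d | δ ≤ inner ℝ n x} ⊆ {x | δ' ≤ inner ℝ n' x}) : n = n' ∧ δ' ≤ δ := by
  set a : ℝ := inner ℝ n n' with ha
  have hnn : inner ℝ n n = (1 : ℝ) := by rw [real_inner_self_eq_norm_sq, hn, one_pow]
  have hnn' : inner ℝ n' n' = (1 : ℝ) := by rw [real_inner_self_eq_norm_sq, hn', one_pow]
  -- The vector `a • n - n'` is orthogonal to `n`, so moving along it stays in the first half-space.
  -- As `t` is arbitrary this forces `a ^ 2 = 1`, and large `s` excludes `a = -1`.
  have h1 : ∀ s t : ℝ, δ ≤ s → δ' ≤ s * a + t * (a ^ 2 - 1) := by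
    intro s t hs
    have := @h (s • n + t • (a • n - n')) (by
      simp only [mem_ofPred_eq, inner_add_right, inner_sub_right, inner_smul_right, hnn, ← ha]
      linarith)
    simp only [mem_ofPred_eq, inner_add_right, inner_sub_right, inner_smul_right, hnn',
      real_inner_comm n n', ← ha] at this
    linarith
  have h2 : a ^ 2 = 1 := by
    by_contra hne
    have hne' : a ^ 2 - 1 ≠ 0 := sub_ne_zero.2 hne
    have := h1 δ ((δ' - 1 - δ * a) / (a ^ 2 - 1)) le_rfl
    rw [div_mul_cancel₀ _ hne'] at this
    linarith
  have h3 : a = 1 := by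
    rcases mul_self_eq_one_iff.1 ((sq a).symm.trans h2) with h | h
    · exact h
    · have := h1 (max δ (-δ' + 1)) 0 (le_max_left _ _)
      have h4 := le_max_right δ (-δ' + 1)
      rw [h] at this
      linarith
  refine ⟨(inner_eq_one_iff_of_norm_eq_one hn hn').1 h3, ?_⟩
  have := h1 δ 0 le_rfl
  rw [h3] at this
  linarith

theorem Ball.carrier_injective {d : ℕ} [NeZero d] : Function.Injective (Ball.carrier (d := d)) := by
  have hio : ∀ (c c' : Euc d) (r r' : ℝ) (h : OnePoint.some '' Metric.closedBall c r =
      (OnePoint.some '' Metric.ball c' r')ᶜ), False := by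
    intro c c' r r' h
    have : (OnePoint.infty : Hat d) ∈ OnePoint.some '' Metric.closedBall c r := by
      rw [h]; simp
    simp at this
  have hih : ∀ (c n : Euc d) (r δ : ℝ) (h : OnePoint.some '' Metric.closedBall c r =
      insert OnePoint.infty (OnePoint.some '' {x : Euc d | δ ≤ inner ℝ n x})), False := by
    intro c n r δ h
    have : (OnePoint.infty : Hat d) ∈ OnePoint.some '' Metric.closedBall c r := by
      rw [h]; simp
    simp at this
  have hoh : ∀ (c n : Euc d) (r δ : ℝ) (hn : ‖n‖ = 1) (h : (OnePoint.some '' Metric.ball c r)ᶜ =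
      insert OnePoint.infty (OnePoint.some '' {x : Euc d | δ ≤ inner ℝ n x})), False := by
    intro c n r δ hn h
    -- The point `t • n` is outside the half-space by the first bound, and at distance at least
    -- `|r|` from `c` by the second.
    set t := min (δ - 1) (inner ℝ n c - |r|)
    have h1 : inner ℝ n (t • n) = t := by
      rw [inner_smul_right, real_inner_self_eq_norm_sq, hn]; ring
    have h2 : OnePoint.some (t • n) ∈ OnePoint.some '' Metric.ball c r := by
      by_contra hc
      rw [← mem_compl_iff, h] at hc
      simp only [mem_insert_iff, OnePoint.coe_ne_infty, false_or,
        OnePoint.coe_injective.mem_set_image, mem_ofPred_eq, h1] at hc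
      have := min_le_left (δ - 1) (inner ℝ n c - |r|)
      linarith
    rw [OnePoint.coe_injective.mem_set_image, Metric.mem_ball, dist_eq_norm] at h2
    have h3 := abs_real_inner_le_norm n (t • n - c)
    rw [hn, one_mul, inner_sub_right, h1, abs_le] at h3
    have := min_le_right (δ - 1) (inner ℝ n c - |r|)
    have := le_abs_self r
    linarith [h3.1]
  intro b b' h
  rcases b with ⟨c, r, hr⟩ | ⟨c, r, hr⟩ | ⟨n, δ, hn⟩ <;>
  rcases b' with ⟨c', r', hr'⟩ | ⟨c', r', hr'⟩ | ⟨n', δ', hn'⟩ <;>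
  simp only [Ball.carrier] at h
  · obtain ⟨rfl, rfl⟩ := closedBall_injective hr hr' (OnePoint.coe_injective.image_injective h)
    rfl
  · exact (hio _ _ _ _ h).elim
  · exact (hih _ _ _ _ h).elim
  · exact (hio _ _ _ _ h.symm).elim
  · have h1 := OnePoint.coe_injective.image_injective (compl_injective h)
    obtain ⟨rfl, rfl⟩ := closedBall_injective hr hr' (by
      rw [← closure_ball c hr.ne', ← closure_ball c' hr'.ne', h1])
    rfl
  · exact (hoh _ _ _ _ hn' h).elim
  · exact (hih _ _ _ _ h.symm).elim
  · exact (hoh _ _ _ _ hn h.symm).elim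
  · have h1 : {x : Euc d | δ ≤ inner ℝ n x} = {x : Euc d | δ' ≤ inner ℝ n' x} := by
      ext x
      have := Set.ext_iff.1 h (OnePoint.some x)
      simpa using this
    obtain ⟨rfl, h2⟩ := halfSpace_subset hn hn' h1.subset
    obtain ⟨-, h3⟩ := halfSpace_subset hn' hn' h1.superset
    obtain rfl := le_antisymm h3 h2
    rfl

theorem cap_injective {d : ℕ} [NeZero d] {x y : Lor d} (hx : lor x x = 1) (hy : lor y y = 1)
    (h : cap x = cap y) : x = y := by
  obtain ⟨b, rfl⟩ := Ball.exists_vec_eq hx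
  obtain ⟨b', rfl⟩ := Ball.exists_vec_eq hy
  rw [← Ball.carrier_eq, ← Ball.carrier_eq] at h
  rw [Ball.carrier_injective h]

theorem hasCurvature_cap {d : ℕ} [NeZero d] {x : Lor d} (hx : lor x x = 1) (k : ℝ) :
    HasCurvature (cap x) k ↔ x.2.1 = k := by
  constructor
  · rintro ⟨b, hb, rfl⟩
    rw [Ball.carrier_eq] at hb
    rw [← cap_injective b.lor_vec hx hb, Ball.curvature_eq]
  · rintro rfl
    obtain ⟨b, rfl⟩ := Ball.exists_vec_eq hx
    exact ⟨b, b.carrier_eq, b.curvature_eq⟩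

theorem cap_eq_normalized {d : ℕ} {x : Lor d} (hx : 0 < lor x x) :
    ∃ c : ℝ, 0 < c ∧ lor (c • x) (c • x) = 1 ∧ cap (c • x) = cap x := by
  refine ⟨(√(lor x x))⁻¹, by positivity, ?_, cap_smul (by positivity) x⟩
  rw [lor_smul_left, lor_smul_right, ← mul_assoc, ← mul_inv, Real.mul_self_sqrt hx.le,
    inv_mul_cancel₀ hx.ne']

theorem exists_ball_of_pos {d : ℕ} {x : Lor d} (hx : 0 < lor x x) :
    ∃ b : Ball d, b.carrier = cap x := by
  obtain ⟨c, -, h1, h2⟩ := cap_eq_normalized hx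
  obtain ⟨b, hb⟩ := Ball.exists_vec_eq h1
  exact ⟨b, by rw [Ball.carrier_eq, hb, h2]⟩

theorem realizes_inversion_of_carrier_eq {d : ℕ} [NeZero d] {x : Lor d} (hx : 0 < lor x x)
    {b : Ball d} (hb : b.carrier = cap x) : Realizes b.inversion (refl x) := by
  obtain ⟨c, hc, h1, h2⟩ := cap_eq_normalized hx
  have := cap_injective b.lor_vec h1 (by rw [← Ball.carrier_eq, hb, h2])
  have h3 := b.realizes_inversion
  rwa [this, refl_smul hc.ne'] at h3

/-! ### Uniqueness of realizations -/

theorem lift_injective_of_smul {d : ℕ} {p q : Hat d} {c : ℝ} (h : lift p = c • lift q) :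
    p = q := by
  induction p using OnePoint.rec with
  | infty =>
    induction q using OnePoint.rec with
    | infty => rfl
    | coe y =>
      simp only [lift_infty, lift_some, Prod.smul_mk, Prod.mk.injEq, smul_eq_mul, mul_one] at h
      rw [← h.2.1] at h
      simp at h
  | coe x =>
    induction q using OnePoint.rec with
    | infty => simp [lift_infty, lift_some] at h
    | coe y =>
      simp only [lift_some, Prod.smul_mk, Prod.mk.injEq, smul_eq_mul, mul_one] at h
      rw [← h.2.1, one_smul] at h
      rw [h.1]

theorem Realizes.eq_one {d : ℕ} {g : Equiv.Perm (Hat d)} (h : Realizes g 1) : g = 1 := by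
  ext1 p
  obtain ⟨c, -, hc⟩ := h.2 p
  exact lift_injective_of_smul hc

theorem lor_lift_ne_zero {d : ℕ} {p q : Hat d} (h : p ≠ q) : lor (lift p) (lift q) ≠ 0 := by
  induction p using OnePoint.rec with
  | infty =>
    induction q using OnePoint.rec with
    | infty => exact (h rfl).elim
    | coe y => simp [lift_infty, lift_some, lor_apply]
  | coe x =>
    induction q using OnePoint.rec with
    | infty => simp [lift_infty, lift_some, lor_apply]
    | coe y =>
      have hxy : x ≠ y := fun e => h (by rw [e])
      simp only [lift_some, lor_apply]
      have := norm_sub_sq_real x y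
      have h2 : 0 < ‖x - y‖ := norm_pos_iff.2 (sub_ne_zero.2 hxy)
      nlinarith

/-- An isometry preserving every null line scales it by a factor, and the factors of two distinct
points are mutually inverse because their null vectors have nonzero product. Three points (`∞`, `0`
and a unit vector, whence `NeZero d`) force all factors to be `1`, and null vectors span. -/
theorem Realizes.map_eq_one {d : ℕ} [NeZero d] {M : Lor d ≃ₗ[ℝ] Lor d}
    (h : Realizes (1 : Equiv.Perm (Hat d)) M) : M = 1 := by
  choose c hc h2 using h.2
  simp only [Equiv.Perm.one_apply] at h2
  have h3 : ∀ p q, p ≠ q → c p * c q = 1 := by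
    intro p q hpq
    have h4 := h.1 (lift p) (lift q)
    have h5 := lor_lift_ne_zero hpq
    conv_rhs at h4 => rw [h2 p, h2 q, lor_smul_left, lor_smul_right]
    have h6 : lor (M (lift p)) (M (lift q)) ≠ 0 := by rwa [h.1]
    refine mul_right_cancel₀ h6 ?_
    linarith
  obtain ⟨u, hu⟩ := exists_norm_eq_one (d := d)
  have hu0 : u ≠ 0 := by rintro rfl; simp at hu
  have h01 : c .infty * c (.some (0 : Euc d)) = 1 := h3 _ _ (OnePoint.infty_ne_coe _)
  have h02 : c .infty * c (.some u) = 1 := h3 _ _ (OnePoint.infty_ne_coe _)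
  have h12 : c (.some (0 : Euc d)) * c (.some u) = 1 :=
    h3 _ _ fun e => hu0 (OnePoint.coe_injective e).symm
  have hinf : c .infty = 1 := by
    have h7 : c (.some (0 : Euc d)) = c (.some u) :=
      mul_left_cancel₀ (hc .infty).ne' (h01.trans h02.symm)
    have h8 : c .infty = c (.some u) :=
      mul_right_cancel₀ (hc (.some u)).ne' (by rw [h02, ← h7] ; rw [← h7] at h12; exact h12.symm)
    rw [← h8] at h02
    have := hc .infty
    nlinarith
  have hone : ∀ p, c p = 1 := by
    intro p
    by_cases hp : p = .infty
    · rw [hp, hinf]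
    · have := h3 _ _ hp
      rwa [hinf, mul_one] at this
  ext1 x
  obtain ⟨ξ, k, β⟩ := x
  have hx : ((ξ, k, β) : Lor d) = lift (.some ξ) + (k - 1) • lift (.some (0 : Euc d)) +
      (β - ‖ξ‖ ^ 2) • lift .infty := by
    simp [lift_some, lift_infty]
  have h9 : ∀ p, M (lift p) = lift p := fun p => by
    conv_rhs => rw [h2 p, hone, one_smul]
  rw [hx]
  simp only [map_add, map_smul, h9]
  rfl

theorem Realizes.eq_one_iff {d : ℕ} [NeZero d] {g : Equiv.Perm (Hat d)} {M : Lor d ≃ₗ[ℝ] Lor d}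
    (h : Realizes g M) : g = 1 ↔ M = 1 := by
  constructor
  · rintro rfl; exact h.map_eq_one
  · rintro rfl; exact h.eq_one

/-! ### The Möbius group -/

theorem exists_realizes_of_mem {d : ℕ} {g : Equiv.Perm (Hat d)} (hg : g ∈ moebiusGroup d) :
    ∃ M, Realizes g M := by
  induction hg using Subgroup.closure_induction with
  | mem g hg =>
    obtain ⟨b, rfl⟩ := hg
    exact ⟨_, b.realizes_inversion⟩
  | one => exact ⟨1, Realizes.one⟩
  | mul g h _ _ hg hh =>
    obtain ⟨M, hM⟩ := hg
    obtain ⟨N, hN⟩ := hh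
    exact ⟨_, hM.mul hN⟩
  | inv g _ hg =>
    obtain ⟨M, hM⟩ := hg
    exact ⟨_, hM.inv⟩

theorem curvature_coord {d : ℕ} (x : Lor d) : x.2.1 = -2 * lor x (lift OnePoint.infty) := by
  rw [lor_lift_infty]; ring

/-- The inversion takes the centre to `∞`, so the new curvature is a product with the null vector of
the centre, and the radius is free to adjust the scale. -/
theorem refl_inside_curvature {d : ℕ} (c : Euc d) {r : ℝ} (hr : 0 < r) (x : Lor d) :
    (refl (Ball.inside c r hr).vec x).2.1 = -2 / r ^ 2 * lor x (lift (OnePoint.some c)) := by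
  rw [refl_apply, Ball.lor_vec, lor_apply, lor_apply, lift_some]
  simp only [Ball.vec, Prod.snd_sub, Prod.fst_sub, Prod.smul_fst, Prod.smul_snd, smul_eq_mul,
    real_inner_smul_left, real_inner_comm c]
  field_simp
  ring

/-- Every light-like vector of the future cone is the curvature functional after some Möbius
transformation. -/
theorem exists_moebius_curvature {d : ℕ} {N : Lor d} (hN : lor N N = 0) (h1 : 0 ≤ N.2.1)
    (h2 : 0 ≤ N.2.2) (h0 : 0 < N.2.1 + N.2.2) :
    ∃ g ∈ moebiusGroup d, ∃ M, Realizes g M ∧ ∀ x, (M x).2.1 = -2 * lor x N := by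
  obtain ⟨n, a, b⟩ := N
  simp only [lor_apply, real_inner_self_eq_norm_sq] at hN h1 h2 h0
  rcases h1.eq_or_lt with ha | ha
  · subst ha
    have hb : 0 < b := by linarith
    have hn : n = 0 := by
      have : ‖n‖ ^ 2 = 0 := by linarith
      simpa using this
    subst hn
    -- Here `N` is `b` times the null vector of `∞`. Two concentric inversions compose to the
    -- dilation by `1 / b`, which multiplies curvatures by `b`.
    set B0 : Ball d := .inside 0 (√b) (Real.sqrt_pos.2 hb)
    set B1 : Ball d := .inside 0 1 one_pos
    refine ⟨B1.inversion * B0.inversion, mul_mem (Subgroup.subset_closure ⟨_, rfl⟩)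
      (Subgroup.subset_closure ⟨_, rfl⟩), _, B1.realizes_inversion.mul B0.realizes_inversion, ?_⟩
    intro x
    rw [LinearEquiv.mul_apply, refl_inside_curvature, (isIso_refl _).lor_apply_left, refl_inv,
      refl_apply, Ball.lor_vec]
    simp only [B0, Ball.vec, lor_apply, lift_some, smul_zero, norm_zero, inner_zero_right,
      Prod.snd_sub, Prod.fst_sub, Prod.smul_fst, Prod.smul_snd, smul_eq_mul]
    have := Real.sq_sqrt hb.le
    have h3 := Real.sqrt_pos.2 hb
    simp
    field_simp
    rw [this]
    ring
  -- Now `N` is `a` times the null vector of the finite point `a⁻¹ • n`; the radius turns the factor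
  -- `1 / r ^ 2` into `a`.
  · set B0 : Ball d := .inside (a⁻¹ • n) ((√a)⁻¹) (by positivity)
    refine ⟨B0.inversion, Subgroup.subset_closure ⟨_, rfl⟩, _, B0.realizes_inversion, ?_⟩
    intro x
    rw [refl_inside_curvature, inv_pow, Real.sq_sqrt ha.le, lor_apply, lor_apply, lift_some]
    simp only [inner_smul_right, norm_smul, mul_pow, Real.norm_eq_abs, sq_abs]
    field_simp
    linear_combination x.2.1 * hN

/-! ### The ball-arrangement projection -/

/-- The point `(v, t)` of Minkowski space in light-cone coordinates. -/
def embed {d : ℕ} (v : Euc (d + 1)) (t : ℝ) : Lor d :=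
  (WithLp.toLp 2 fun i : Fin d => v i.castSucc, t - v (Fin.last d), t + v (Fin.last d))

theorem lor_embed {d : ℕ} (v w : Euc (d + 1)) (s t : ℝ) :
    lor (embed v s) (embed w t) = inner ℝ v w - s * t := by
  simp only [lor_apply, embed, PiLp.inner_apply, Fin.sum_univ_castSucc]
  simp
  ring

theorem embed_add {d : ℕ} (v w : Euc (d + 1)) (s t : ℝ) :
    embed v s + embed w t = embed (v + w) (s + t) := by
  simp only [embed, Prod.mk_add_mk, Prod.mk.injEq, PiLp.add_apply]
  exact ⟨rfl, by ring, by ring⟩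

theorem smul_embed {d : ℕ} (c : ℝ) (v : Euc (d + 1)) (t : ℝ) :
    c • embed v t = embed (c • v) (c * t) := by
  simp only [embed, Prod.smul_mk, Prod.mk.injEq, PiLp.smul_apply, smul_eq_mul]
  exact ⟨rfl, by ring, by ring⟩

theorem exists_eq_embed {d : ℕ} (x : Lor d) : ∃ v t, x = embed v t := by
  obtain ⟨ξ, k, β⟩ := x
  refine ⟨WithLp.toLp 2 (Fin.snoc (fun i => ξ i) ((β - k) / 2)), (k + β) / 2, ?_⟩
  simp only [embed, Fin.snoc_castSucc, Fin.snoc_last, Prod.mk.injEq]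
  exact ⟨trivial, by ring, by ring⟩

theorem embed_injective {d : ℕ} {v w : Euc (d + 1)} {s t : ℝ} (h : embed v s = embed w t) :
    v = w ∧ s = t := by
  simp only [embed, Prod.mk.injEq] at h
  obtain ⟨h1, h2, h3⟩ := h
  refine ⟨?_, by linarith⟩
  ext i
  refine Fin.lastCases ?_ (fun i => ?_) i
  · linarith
  · exact congrFun (congrArg WithLp.ofLp h1) i

/-- Points of the sphere and points of `ℝ^d ∪ {∞}` are two normalizations of the same null lines:
time coordinate `1`, or first light-cone coordinate `1` where it does not vanish. Stereographic
projection only rescales. -/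
theorem lift_stereo {d : ℕ} {p : Euc (d + 1)} (hp : ‖p‖ = 1) :
    ∃ c : ℝ, 0 < c ∧ lift (stereo p) = c • embed p 1 := by
  have hn : ∑ i : Fin d, p i.castSucc ^ 2 + p (Fin.last d) ^ 2 = 1 := by
    have := EuclideanSpace.real_norm_sq_eq p
    rw [hp, Fin.sum_univ_castSucc] at this
    linarith
  have hnn : 0 ≤ ∑ i : Fin d, p i.castSucc ^ 2 := Finset.sum_nonneg fun i _ => sq_nonneg _
  by_cases h : p (Fin.last d) = 1
  · refine ⟨1 / 2, by norm_num, ?_⟩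
    rw [h] at hn
    have h0 : ∀ i : Fin d, p i.castSucc = 0 := by
      intro i
      have := (Finset.sum_eq_zero_iff_of_nonneg (fun i _ => sq_nonneg (p i.castSucc))).1
        (by linarith) i (Finset.mem_univ i)
      simpa using this
    simp only [stereo, h, if_true, lift_infty, embed, h0, Prod.smul_mk, Prod.mk.injEq]
    refine ⟨?_, by norm_num, by norm_num⟩
    ext i
    simp
  · have hlt : p (Fin.last d) < 1 := by
      refine lt_of_le_of_ne ?_ h
      nlinarith
    have hpos : 0 < 1 - p (Fin.last d) := by linarith
    refine ⟨(1 - p (Fin.last d))⁻¹, inv_pos.2 hpos, ?_⟩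
    simp only [stereo, if_neg h, lift_some, embed, Prod.smul_mk, Prod.mk.injEq, smul_eq_mul,
      norm_smul, mul_pow, EuclideanSpace.real_norm_sq_eq, true_and]
    refine ⟨by field_simp, ?_⟩
    rw [Real.norm_eq_abs, sq_abs, show ∑ i : Fin d, p i.castSucc ^ 2 = 1 - p (Fin.last d) ^ 2 by
      linarith]
    field_simp
    ring

theorem exists_stereo_eq {d : ℕ} (q : Hat d) : ∃ p : Euc (d + 1), ‖p‖ = 1 ∧ stereo p = q := by
  obtain ⟨v, t, hvt⟩ := exists_eq_embed (lift q)
  have ht : 0 < t := by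
    have h1 : 2 * t = (lift q).2.1 + (lift q).2.2 := by rw [hvt]; simp [embed]; ring
    have h2 : 0 < (lift q).2.1 + (lift q).2.2 := by
      induction q using OnePoint.rec with
      | infty => simp [lift_infty]
      | coe y => rw [lift_some]; positivity
    linarith
  have hv : ‖v‖ = t := by
    have := lor_lift_self q
    rw [hvt, lor_embed, real_inner_self_eq_norm_sq] at this
    rw [← sq_eq_sq₀ (norm_nonneg _) ht.le]
    linarith
  have h1 : ‖t⁻¹ • v‖ = 1 := by
    rw [norm_smul, hv, norm_inv, Real.norm_of_nonneg ht.le, inv_mul_cancel₀ ht.ne']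
  refine ⟨t⁻¹ • v, h1, ?_⟩
  obtain ⟨c, -, hc⟩ := lift_stereo h1
  refine lift_injective_of_smul (c := c * t⁻¹) ?_
  rw [hc, hvt, mul_smul, smul_embed t⁻¹, inv_mul_cancel₀ ht.ne']

theorem lightBall_eq {d : ℕ} (v : Euc (d + 1)) : lightBall v = cap (embed v 1) := by
  have key : ∀ p : Euc (d + 1), ‖p‖ = 1 → (stereo p ∈ cap (embed v 1) ↔ 1 ≤ inner ℝ v p) := by
    intro p hp
    obtain ⟨c, hc, h⟩ := lift_stereo hp
    change 0 ≤ lor _ _ ↔ _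
    rw [h, lor_smul_right, mul_nonneg_iff_of_pos_left hc, lor_embed]
    constructor <;> intro h <;> linarith
  ext q
  constructor
  · rintro ⟨p, ⟨hp, h⟩, rfl⟩
    exact (key p hp).2 h
  · intro hq
    obtain ⟨p, hp, rfl⟩ := exists_stereo_eq q
    exact ⟨p, ⟨hp, (key p hp).1 hq⟩, rfl⟩

theorem coord_pos_of_timelike {d : ℕ} {x : Lor d} (ht : 0 < x.2.1 + x.2.2) (h : lor x x < 0) :
    0 < x.2.1 := by
  rw [lor_apply, real_inner_self_eq_norm_sq] at h
  have := sq_nonneg ‖x.1‖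
  by_contra! hc
  nlinarith

theorem lor_lift_neg_of_timelike {d : ℕ} {x : Lor d} (hx : lor x x < 0) (h1 : 0 < x.2.1)
    (p : Hat d) : lor x (lift p) < 0 := by
  induction p using OnePoint.rec with
  | infty => rw [lor_lift_infty]; linarith
  | coe y =>
    obtain ⟨ξ, k, β⟩ := x
    simp only [lor_apply, real_inner_self_eq_norm_sq, lift_some] at hx h1 ⊢
    have h2 : 0 ≤ ‖ξ - k • y‖ ^ 2 := sq_nonneg _
    rw [norm_sub_sq_real, norm_smul, inner_smul_right, mul_pow, Real.norm_eq_abs, sq_abs] at h2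
    have h3 : k * (inner ℝ ξ y - (k * ‖y‖ ^ 2 + β * 1) / 2) < 0 := by nlinarith
    exact neg_of_mul_neg_right h3 h1.le

/-- A time-like vector of the future cone is mapped to a vector of positive curvature. -/
theorem Realizes.coord_pos {d : ℕ} {g : Equiv.Perm (Hat d)} {M : Lor d ≃ₗ[ℝ] Lor d}
    (hg : Realizes g M) {x : Lor d} (hx : lor x x < 0) (h1 : 0 < x.2.1) : 0 < (M x).2.1 := by
  rw [curvature_coord, hg.1.lor_apply_left]
  obtain ⟨c, hc, h⟩ := hg.inv.2 .infty
  have h2 : M⁻¹ (lift .infty) = c⁻¹ • lift (g⁻¹ .infty) := by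
    rw [h, smul_smul, inv_mul_cancel₀ hc.ne', one_smul]
  rw [h2, lor_smul_right]
  have := mul_pos (inv_pos.2 hc) (neg_pos.2 (lor_lift_neg_of_timelike hx h1 (g⁻¹ .infty)))
  linarith

/-! ### The Apollonian group as a group of linear isometries -/

namespace PolytopalPacking

variable {d : ℕ} {K : Family} (P : PolytopalPacking d K) {M : Lor d ≃ₗ[ℝ] Lor d}

theorem mem_balls_iff (hM : Realizes P.moebius M) (s : Set (Hat d)) :
    s ∈ P.balls ↔ ∃ i, s = cap (M (embed (P.polytope.vertex i) 1)) := by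
  simp only [balls, mem_ofPred_eq, lightBall_eq, hM.image_cap]
  exact exists_congr fun i => eq_comm

theorem mem_dualBalls_iff (hM : Realizes P.moebius M) (s : Set (Hat d)) :
    s ∈ P.dualBalls ↔
      ∃ S w, IsFacetWithPolar P.polytope.vertex S w ∧ s = cap (M (embed w 1)) := by
  simp only [dualBalls, mem_ofPred_eq, lightBall_eq, hM.image_cap]
  exact exists_congr fun S => exists_congr fun w => and_congr_right fun _ => eq_comm

/-- `H` is left free: it will be `orthoGroup` for the sphere packing and, for the circle packing,
the second projection of a group of intertwined pairs. -/
theorem exists_realizes_of_mem_apollonianGroup [NeZero d] (hM : Realizes P.moebius M)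
    (hpos : ∀ S w, IsFacetWithPolar P.polytope.vertex S w → 0 < lor (embed w 1) (embed w 1))
    (H : Subgroup (Lor d ≃ₗ[ℝ] Lor d))
    (hH : ∀ S w, IsFacetWithPolar P.polytope.vertex S w → refl (embed w 1) ∈ H)
    {a : Equiv.Perm (Hat d)} (ha : a ∈ P.apollonianGroup) :
    ∃ R ∈ H, Realizes a (M * R * M⁻¹) := by
  induction ha using Subgroup.closure_induction with
  | mem a ha =>
    obtain ⟨b, hb, rfl⟩ := ha
    obtain ⟨S, w, hw, hbw⟩ := (P.mem_dualBalls_iff hM _).1 hb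
    refine ⟨_, hH S w hw, ?_⟩
    rw [hM.1.mul_refl_mul_inv]
    exact realizes_inversion_of_carrier_eq (by rw [hM.1]; exact hpos S w hw) hbw
  | one => exact ⟨1, one_mem _, by simpa using Realizes.one⟩
  | mul g h _ _ hg hh =>
    obtain ⟨R, hR, h1⟩ := hg
    obtain ⟨R', hR', h2⟩ := hh
    refine ⟨R * R', mul_mem hR hR', ?_⟩
    have := h1.mul h2
    rwa [show M * R * M⁻¹ * (M * R' * M⁻¹) = M * (R * R') * M⁻¹ by group] at this
  | inv g _ hg =>
    obtain ⟨R, hR, h1⟩ := hg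
    refine ⟨R⁻¹, inv_mem hR, ?_⟩
    have := h1.inv
    rwa [show (M * R * M⁻¹)⁻¹ = M * R⁻¹ * M⁻¹ by group] at this

theorem exists_mem_apollonianGroup_realizes [NeZero d] (hM : Realizes P.moebius M)
    (hpos : ∀ S w, IsFacetWithPolar P.polytope.vertex S w → 0 < lor (embed w 1) (embed w 1))
    {R : Lor d ≃ₗ[ℝ] Lor d}
    (hR : R ∈ Subgroup.closure {R | ∃ S w, IsFacetWithPolar P.polytope.vertex S w ∧
      R = refl (embed w 1)}) :
    ∃ a ∈ P.apollonianGroup, Realizes a (M * R * M⁻¹) := by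
  induction hR using Subgroup.closure_induction with
  | mem R hR =>
    obtain ⟨S, w, hw, rfl⟩ := hR
    have h0 : 0 < lor (M (embed w 1)) (M (embed w 1)) := by rw [hM.1]; exact hpos S w hw
    obtain ⟨b, hb⟩ := exists_ball_of_pos h0
    refine ⟨b.inversion, Subgroup.subset_closure ⟨b, ?_, rfl⟩, ?_⟩
    · exact (P.mem_dualBalls_iff hM _).2 ⟨S, w, hw, hb⟩
    · rw [hM.1.mul_refl_mul_inv]
      exact realizes_inversion_of_carrier_eq h0 hb
  | one => exact ⟨1, one_mem _, by simpa using Realizes.one⟩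
  | mul R R' _ _ hg hh =>
    obtain ⟨g, hg, h1⟩ := hg
    obtain ⟨h, hh, h2⟩ := hh
    refine ⟨g * h, mul_mem hg hh, ?_⟩
    have := h1.mul h2
    rwa [show M * R * M⁻¹ * (M * R' * M⁻¹) = M * (R * R') * M⁻¹ by group] at this
  | inv R _ hg =>
    obtain ⟨g, hg, h1⟩ := hg
    refine ⟨g⁻¹, inv_mem hg, ?_⟩
    have := h1.inv
    rwa [show (M * R * M⁻¹)⁻¹ = M * R⁻¹ * M⁻¹ by group] at this

end PolytopalPacking

/-! ### The regular edge-scribed orthoplex -/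

/-- The sign encoded by a Boolean. -/
def sgn (b : Bool) : ℤ := if b then 1 else -1

@[simp] theorem sgn_true : sgn true = 1 := rfl
@[simp] theorem sgn_false : sgn false = -1 := rfl
@[simp] theorem sgn_not (b : Bool) : sgn (!b) = -sgn b := by cases b <;> rfl

theorem sgn_sq (b : Bool) : ((sgn b : ℤ) : ℝ) ^ 2 = 1 := by cases b <;> simp

/-- The vertices of the regular edge-scribed orthoplex. -/
def orthoVertex (x : Fin 4 × Bool) : Euc 4 := EuclideanSpace.single x.1 (√2 * sgn x.2)

theorem inner_orthoVertex (w : Euc 4) (x : Fin 4 × Bool) :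
    inner ℝ w (orthoVertex x) = √2 * sgn x.2 * w x.1 := by
  rw [orthoVertex, EuclideanSpace.inner_single_right]
  simp

theorem orthoVertex_apply (x : Fin 4 × Bool) (i : Fin 4) :
    orthoVertex x i = if i = x.1 then √2 * sgn x.2 else 0 := by
  simp [orthoVertex]

/-- The vertices of the polar of the regular edge-scribed orthoplex. -/
def orthoDual (s : Fin 4 → Bool) : Euc 4 := WithLp.toLp 2 fun i => √2 * (sgn (s i) / 2)

theorem inner_orthoDual_orthoVertex (s : Fin 4 → Bool) (x : Fin 4 × Bool) :
    inner ℝ (orthoDual s) (orthoVertex x) = sgn x.2 * sgn (s x.1) := by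
  rw [inner_orthoVertex, orthoDual]
  have := Real.mul_self_sqrt (show (0 : ℝ) ≤ 2 by norm_num)
  simp only
  linear_combination (sgn x.2 * sgn (s x.1) / 2 : ℝ) * this

theorem isFacetWithPolar_orthoDual (s : Fin 4 → Bool) :
    IsFacetWithPolar orthoVertex {x | x.2 = s x.1} (orthoDual s) := by
  refine ⟨⟨fun x => ?_, ?_⟩, ?_⟩
  · rw [inner_orthoDual_orthoVertex]
    cases x.2 <;> cases s x.1 <;> norm_num
  · ext x
    simp only [mem_ofPred_eq, inner_orthoDual_orthoVertex]
    cases x.2 <;> cases s x.1 <;> norm_num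
  · rw [eq_top_iff, ← (EuclideanSpace.basisFun (Fin 4) ℝ).toBasis.span_eq, Submodule.span_le]
    rintro _ ⟨i, rfl⟩
    have h1 : orthoVertex (i, s i) ∈ orthoVertex '' {x | x.2 = s x.1} := ⟨_, rfl, rfl⟩
    have h2 := Submodule.smul_mem _ ((√2 * sgn (s i) : ℝ)⁻¹) (Submodule.subset_span (R := ℝ) h1)
    have h3 : (√2 * sgn (s i) : ℝ) ≠ 0 := by cases s i <;> simp
    rw [SetLike.mem_coe, show (EuclideanSpace.basisFun (Fin 4) ℝ).toBasis i =
      (√2 * sgn (s i) : ℝ)⁻¹ • orthoVertex (i, s i) from ?_]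
    · exact h2
    ext j
    simp only [OrthonormalBasis.coe_toBasis, EuclideanSpace.basisFun_apply, PiLp.smul_apply,
      orthoVertex_apply, smul_eq_mul, PiLp.single_apply]
    split_ifs
    · rw [inv_mul_cancel₀ h3]
    · simp

/-- If neither vertex on the `i`-th axis were on the facet, all its vertices would be orthogonal to
that axis and could not span. So each coordinate of `w` is determined by a sign. -/
theorem isFacetWithPolar_orthoVertex {S : Set (Fin 4 × Bool)} {w : Euc 4}
    (h : IsFacetWithPolar orthoVertex S w) :
    ∃ s : Fin 4 → Bool, S = {x | x.2 = s x.1} ∧ w = orthoDual s := by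
  obtain ⟨⟨h1, rfl⟩, h2⟩ := h
  have h3 : ∀ i, ∃ b : Bool, √2 * sgn b * w i = 1 := by
    intro i
    by_contra! hc
    have : Submodule.span ℝ (orthoVertex '' {x | inner ℝ w (orthoVertex x) = 1}) ≤
        LinearMap.ker (innerSL ℝ (EuclideanSpace.single i 1 : Euc 4)).toLinearMap := by
      rw [Submodule.span_le]
      rintro _ ⟨x, hx, rfl⟩
      rw [mem_ofPred_eq, inner_orthoVertex] at hx
      have hi : i ≠ x.1 := by rintro rfl; exact hc _ hx
      simp [inner_orthoVertex, hi.symm]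
    rw [h2] at this
    have h4 := this (Submodule.mem_top (x := EuclideanSpace.single i 1))
    simp at h4
  choose s hs using h3
  have hw : w = orthoDual s := by
    ext i
    have h4 := hs i
    have h5 := Real.mul_self_sqrt (show (0 : ℝ) ≤ 2 by norm_num)
    have h6 := sgn_sq (s i)
    simp only [orthoDual]
    linear_combination (√2 * sgn (s i) / 2) * h4 - (sgn (s i) ^ 2 * w i / 2 : ℝ) * h5 - w i * h6
  refine ⟨s, ?_, hw⟩
  rw [hw]
  exact (isFacetWithPolar_orthoDual s).1.2

/-- The regular edge-scribed orthoplex. -/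
def orthoplex : EdgeScribed 4 .crossPolytope where
  vertex := orthoVertex
  zero_mem_interior := by
    have hspan : affineSpan ℝ (range orthoVertex) = ⊤ := by
      rw [AffineSubspace.affineSpan_eq_top_iff_vectorSpan_eq_top_of_nonempty ℝ (Euc 4) (Euc 4) (range_nonempty _),
        eq_top_iff, ← (isFacetWithPolar_orthoDual fun _ => true).2, Submodule.span_le]
      rintro _ ⟨⟨i, b⟩, -, rfl⟩
      have h1 := vsub_mem_vectorSpan ℝ (mem_range_self (f := orthoVertex) (i, b))
        (mem_range_self (f := orthoVertex) (i, !b))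
      have h2 := Submodule.smul_mem _ (1 / 2 : ℝ) h1
      rw [SetLike.mem_coe, show orthoVertex (i, b) =
        (1 / 2 : ℝ) • (orthoVertex (i, b) -ᵥ orthoVertex (i, !b)) from ?_]
      · exact h2
      ext j
      simp only [PiLp.smul_apply, vsub_eq_sub, PiLp.sub_apply, orthoVertex_apply, smul_eq_mul, sgn_not]
      split_ifs
      · push_cast; ring
      · ring
    have hne : (interior (convexHull ℝ (range orthoVertex))).Nonempty :=
      interior_convexHull_nonempty_iff_affineSpan_eq_top.2 hspan
    obtain ⟨x, hx⟩ := hne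
    -- The hull is centrally symmetric and has nonempty convex interior, which therefore contains
    -- the midpoint of `x` and `-x`.
    have hneg : -(range orthoVertex) = range orthoVertex := by
      have : ∀ x, -orthoVertex x = orthoVertex (x.1, !x.2) := by
        intro x
        ext i
        simp only [PiLp.neg_apply, orthoVertex_apply, sgn_not]
        split_ifs <;> simp
      ext v
      constructor
      · rintro ⟨y, hy⟩
        exact ⟨(y.1, !y.2), by rw [← this, hy, neg_neg]⟩
      · rintro ⟨y, rfl⟩
        exact ⟨(y.1, !y.2), (this y).symm⟩
    have hx' : -x ∈ interior (convexHull ℝ (range orthoVertex)) := by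
      have h1 := (Homeomorph.neg (Euc 4)).preimage_interior (convexHull ℝ (range orthoVertex))
      have h2 : Homeomorph.neg (Euc 4) ⁻¹' convexHull ℝ (range orthoVertex) =
          convexHull ℝ (range orthoVertex) := by
        conv_rhs => rw [← hneg, convexHull_neg]
        rfl
      rw [h2] at h1
      rw [← h1] at hx
      exact hx
    have := (convex_convexHull ℝ (range orthoVertex)).interior.midpoint_mem hx hx'
    simpa using this
  convexIndependent := by
    intro s x hx
    by_contra hxs
    -- This open half-space contains every vertex but `x`, whose squared norm is `2`.
    have hconv : Convex ℝ {y : Euc 4 | inner ℝ (orthoVertex x) y < 2} :=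
      convex_halfSpace_lt (innerSL ℝ (orthoVertex x)).toLinearMap.isLinear 2
    have h5 := Real.mul_self_sqrt (show (0 : ℝ) ≤ 2 by norm_num)
    have hsub : orthoVertex '' s ⊆ {y : Euc 4 | inner ℝ (orthoVertex x) y < 2} := by
      rintro _ ⟨y, hy, rfl⟩
      have hne : y ≠ x := by rintro rfl; exact hxs hy
      rw [mem_ofPred_eq, inner_orthoVertex, orthoVertex_apply]
      obtain ⟨i, b⟩ := x
      obtain ⟨j, c⟩ := y
      split_ifs with hij
      · simp only at hij
        subst hij
        have : c ≠ b := fun e => hne (by rw [e])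
        cases b <;> cases c <;> simp at this ⊢
      · simp
    have := convexHull_min hsub hconv hx
    rw [mem_ofPred_eq, inner_orthoVertex, orthoVertex_apply, if_pos rfl] at this
    have h6 := sgn_sq x.2
    nlinarith
  facets_eq := by
    ext S
    constructor
    · rintro ⟨w, hw⟩
      obtain ⟨s, hs, -⟩ := isFacetWithPolar_orthoVertex hw
      exact ⟨s, hs⟩
    · rintro ⟨s, rfl⟩
      exact ⟨_, isFacetWithPolar_orthoDual s⟩
  edge_tangent := by
    rintro ⟨i, b⟩ ⟨j, c⟩ ⟨hne, w, hw1, hw2⟩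
    have hi : inner ℝ w (orthoVertex (i, b)) = 1 := by
      have : ((i, b) : Fin 4 × Bool) ∈ ({(i, b), (j, c)} : Set _) := by simp
      rw [← hw2] at this
      exact this
    have hj : inner ℝ w (orthoVertex (j, c)) = 1 := by
      have : ((j, c) : Fin 4 × Bool) ∈ ({(i, b), (j, c)} : Set _) := by simp
      rw [← hw2] at this
      exact this
    rw [inner_orthoVertex] at hi hj
    have hij : i ≠ j := by
      rintro rfl
      have : b ≠ c := fun e => hne (by rw [e])
      cases b <;> cases c <;> simp at this hi hj <;> linarith
    have h5 := Real.mul_self_sqrt (show (0 : ℝ) ≤ 2 by norm_num)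
    have hbb : inner ℝ (orthoVertex (i, b)) (orthoVertex (i, b)) = (2 : ℝ) := by
      rw [inner_orthoVertex, orthoVertex_apply]
      have := sgn_sq b
      simp only [if_true]
      nlinarith
    have hcc : inner ℝ (orthoVertex (j, c)) (orthoVertex (j, c)) = (2 : ℝ) := by
      rw [inner_orthoVertex, orthoVertex_apply]
      have := sgn_sq c
      simp only [if_true]
      nlinarith
    have hbc : inner ℝ (orthoVertex (i, b)) (orthoVertex (j, c)) = (0 : ℝ) := by
      rw [inner_orthoVertex, orthoVertex_apply, if_neg hij.symm, mul_zero]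
    refine ⟨(1 / 2 : ℝ) • orthoVertex (i, b) + (1 / 2 : ℝ) • orthoVertex (j, c),
      ⟨1 / 2, 1 / 2, by norm_num, by norm_num, by norm_num, rfl⟩, ?_, ?_⟩
    · rw [← sq_eq_sq₀ (norm_nonneg _) zero_le_one, ← real_inner_self_eq_norm_sq]
      simp only [inner_add_left, inner_add_right, real_inner_smul_left, real_inner_smul_right,
        hbb, hcc, hbc, real_inner_comm (orthoVertex (i, b)) (orthoVertex (j, c))]
      norm_num
    · simp only [inner_add_left, inner_sub_right, real_inner_smul_left,
        hbb, hcc, hbc, real_inner_comm (orthoVertex (i, b)) (orthoVertex (j, c))]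
      norm_num

/-! ### The orthoplicial reflection group -/

/-- The coordinates of `Lor 3` in which the vertices of the orthoplex are `(± e_i, 1)`. -/
def ortho (a : Fin 4 → ℝ) (t : ℝ) : Lor 3 := embed (WithLp.toLp 2 fun i => √2 * a i) t

theorem lor_ortho (a b : Fin 4 → ℝ) (s t : ℝ) :
    lor (ortho a s) (ortho b t) = 2 * ∑ i, a i * b i - s * t := by
  have h5 := Real.mul_self_sqrt (show (0 : ℝ) ≤ 2 by norm_num)
  rw [ortho, ortho, lor_embed, PiLp.inner_apply, Finset.mul_sum]
  congr 1
  refine Finset.sum_congr rfl fun i _ => ?_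
  simp
  linear_combination (a i * b i) * h5

theorem ortho_add (a b : Fin 4 → ℝ) (s t : ℝ) :
    ortho a s + ortho b t = ortho (fun i => a i + b i) (s + t) := by
  rw [ortho, ortho, embed_add, ortho]
  congr 1
  ext i
  simp [mul_add]

theorem smul_ortho (c : ℝ) (a : Fin 4 → ℝ) (t : ℝ) :
    c • ortho a t = ortho (fun i => c * a i) (c * t) := by
  rw [ortho, smul_embed, ortho]
  congr 1
  ext i
  simp [mul_left_comm]

theorem ortho_sub (a b : Fin 4 → ℝ) (s t : ℝ) :
    ortho a s - ortho b t = ortho (fun i => a i - b i) (s - t) := by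
  rw [sub_eq_add_neg, ← neg_one_smul ℝ, smul_ortho, ortho_add]
  congr 1
  · funext i; ring
  · ring

theorem exists_eq_ortho (x : Lor 3) : ∃ a t, x = ortho a t := by
  obtain ⟨v, t, rfl⟩ := exists_eq_embed x
  refine ⟨fun i => (√2)⁻¹ * v i, t, ?_⟩
  rw [ortho]
  congr 1
  ext i
  simp

theorem ortho_injective {a b : Fin 4 → ℝ} {s t : ℝ} (h : ortho a s = ortho b t) :
    a = b ∧ s = t := by
  obtain ⟨h1, h2⟩ := embed_injective h
  refine ⟨?_, h2⟩
  funext i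
  have := congrFun (congrArg WithLp.ofLp h1) i
  simpa using this

/-- The vector of a ball of the orthoplicial packing. -/
def orthoVec (x : Fin 4 × Bool) : Lor 3 := embed (orthoVertex x) 1

theorem orthoVec_eq (x : Fin 4 × Bool) :
    orthoVec x = ortho (fun i => if i = x.1 then sgn x.2 else 0) 1 := by
  rw [orthoVec, ortho]
  congr 1
  ext i
  simp [orthoVertex_apply]

theorem lor_orthoVec_self (x : Fin 4 × Bool) : lor (orthoVec x) (orthoVec x) = 1 := by
  rw [orthoVec_eq, lor_ortho]
  have := sgn_sq x.2
  simp
  nlinarith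

/-- The vector of a dual ball of the orthoplicial packing. -/
def dualVec (s : Fin 4 → Bool) : Lor 3 := embed (orthoDual s) 1

theorem dualVec_eq (s : Fin 4 → Bool) : dualVec s = ortho (fun i => sgn (s i) / 2) 1 := rfl

theorem lor_dualVec (s : Fin 4 → Bool) (a : Fin 4 → ℝ) (t : ℝ) :
    lor (dualVec s) (ortho a t) = ∑ i, sgn (s i) * a i - t := by
  rw [dualVec_eq, lor_ortho, Finset.mul_sum, one_mul]
  congr 1
  exact Finset.sum_congr rfl fun i _ => by ring

theorem lor_dualVec_self (s : Fin 4 → Bool) : lor (dualVec s) (dualVec s) = 1 := by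
  rw [show lor (dualVec s) (dualVec s) =
    lor (dualVec s) (ortho (fun i => sgn (s i) / 2) 1) from rfl, lor_dualVec]
  have : ∀ i, (sgn (s i) : ℝ) * (sgn (s i) / 2) = 1 / 2 := fun i => by
    rw [← mul_div_assoc, ← sq, sgn_sq]
  simp only [this]
  norm_num

theorem refl_dualVec (s : Fin 4 → Bool) (a : Fin 4 → ℝ) (t : ℝ) :
    refl (dualVec s) (ortho a t) = ortho (fun i => a i - (∑ j, sgn (s j) * a j - t) * sgn (s i))
      (t - 2 * (∑ j, sgn (s j) * a j - t)) := by
  rw [refl_apply, lor_dualVec_self, lor_dualVec, dualVec_eq, smul_ortho, ortho_sub]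
  congr 1
  · funext i; ring
  · ring

/-- The group generated by the reflections in the dual balls of the orthoplicial packing. -/
def orthoGroup : Subgroup (Lor 3 ≃ₗ[ℝ] Lor 3) :=
  Subgroup.closure (range fun s => refl (dualVec s))

theorem refl_mem_orthoGroup (s : Fin 4 → Bool) : refl (dualVec s) ∈ orthoGroup :=
  Subgroup.subset_closure ⟨s, rfl⟩

theorem isIso_of_mem_orthoGroup {G : Lor 3 ≃ₗ[ℝ] Lor 3} (hG : G ∈ orthoGroup) : IsIso G := by
  induction hG using Subgroup.closure_induction with
  | mem G hG => obtain ⟨s, rfl⟩ := hG; exact isIso_refl _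
  | one => exact IsIso.one
  | mul _ _ _ _ h1 h2 => exact h1.mul h2
  | inv _ _ h => exact h.inv

/-- The invariant of the orbit of a vector with integral coordinates. -/
def IsLatticeVec (c : Fin 4 → ℤ) (x : Lor 3) : Prop :=
  ∃ (a : Fin 4 → ℤ) (b : ℤ), x = ortho (fun i => a i) b ∧ (2 : ℤ) ∣ ∑ i, a i - b ∧
    ∀ k l, (4 : ℤ) ∣ (a k - a l) - (c k - c l)

/-- The reflection subtracts `k` times a vector of signs, and the parity condition makes `k` even.
Differences of signs are even too, so coordinate differences change by multiples of `4`. -/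
theorem IsLatticeVec.refl_dualVec {c : Fin 4 → ℤ} {x : Lor 3} (h : IsLatticeVec c x)
    (s : Fin 4 → Bool) : IsLatticeVec c (refl (dualVec s) x) := by
  obtain ⟨a, b, rfl, h1, h2⟩ := h
  set k : ℤ := ∑ j, sgn (s j) * a j - b with hk
  have hsgn : ∀ i, ∃ m : ℤ, sgn (s i) = 2 * m + 1 := fun i => by
    cases s i
    · exact ⟨-1, rfl⟩
    · exact ⟨0, rfl⟩
  choose m hm using hsgn
  have hk2 : (2 : ℤ) ∣ k := by
    have : k = (∑ i, a i - b) + 2 * ∑ i, m i * a i := by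
      rw [hk, Finset.mul_sum]
      have : ∑ j, sgn (s j) * a j = ∑ j, a j + ∑ j, 2 * (m j * a j) := by
        rw [← Finset.sum_add_distrib]
        exact Finset.sum_congr rfl fun i _ => by rw [hm]; ring
      rw [this]; ring
    rw [this]
    exact dvd_add h1 (dvd_mul_right _ _)
  obtain ⟨n, hn⟩ := hk2
  refine ⟨fun i => a i - k * sgn (s i), b - 2 * k, ?_, ?_, ?_⟩
  · rw [ApollonianSections.refl_dualVec, hk]
    push_cast
    rfl
  · rw [Finset.sum_sub_distrib, ← Finset.mul_sum, hn]
    obtain ⟨e, he⟩ := h1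
    refine ⟨e - n * (∑ i, sgn (s i)) + 2 * n, ?_⟩
    linear_combination he
  · intro i j
    obtain ⟨e, he⟩ := h2 i j
    refine ⟨e - n * (m i - m j), ?_⟩
    simp only [hn, hm]
    linear_combination he

theorem isLatticeVec_apply_iff {G : Lor 3 ≃ₗ[ℝ] Lor 3} (hG : G ∈ orthoGroup) (c : Fin 4 → ℤ) :
    ∀ x, IsLatticeVec c (G x) ↔ IsLatticeVec c x := by
  induction hG using Subgroup.closure_induction with
  | mem G hG =>
    obtain ⟨s, rfl⟩ := hG
    intro x
    refine ⟨fun h => ?_, fun h => h.refl_dualVec s⟩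
    have := h.refl_dualVec s
    rwa [refl_refl] at this
  | one => exact fun x => Iff.rfl
  | mul _ _ _ _ h1 h2 => exact fun x => (h1 _).trans (h2 x)
  | inv G _ h =>
    intro x
    rw [← h, apply_inv_self']

theorem isLatticeVec_orthoVec (x : Fin 4 × Bool) :
    IsLatticeVec (fun i => if i = x.1 then sgn x.2 else 0) (orthoVec x) := by
  refine ⟨fun i => if i = x.1 then sgn x.2 else 0, 1, ?_, ?_, ?_⟩
  · rw [orthoVec_eq]
    push_cast
    rfl
  · simp only [Finset.sum_ite_eq', Finset.mem_univ, if_true]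
    cases x.2 <;> simp
  · simp

theorem isLatticeVec_apply_orthoVec {G : Lor 3 ≃ₗ[ℝ] Lor 3} (hG : G ∈ orthoGroup)
    (x : Fin 4 × Bool) :
    IsLatticeVec (fun i => if i = x.1 then sgn x.2 else 0) (G (orthoVec x)) :=
  (isLatticeVec_apply_iff hG _ _).2 (isLatticeVec_orthoVec x)

/-- Different vertices of the orthoplex lie in different orbits. -/
theorem eq_of_apply_orthoVec_eq {G : Lor 3 ≃ₗ[ℝ] Lor 3} (hG : G ∈ orthoGroup)
    {x y : Fin 4 × Bool} (h : G (orthoVec x) = orthoVec y) : x = y := by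
  obtain ⟨a, b, h1, -, h2⟩ := isLatticeVec_apply_orthoVec hG x
  rw [h, orthoVec_eq] at h1
  have h3 := (ortho_injective h1).1
  have h4 : ∀ i, a i = if i = y.1 then sgn y.2 else 0 := by
    intro i
    have := congrFun h3 i
    rw [← Int.cast_inj (α := ℝ), ← this]
    split_ifs <;> simp
  simp only [h4] at h2
  clear h h1 h3 h4
  revert x y
  -- What is left is finite: the eight vectors `±e_i` are told apart by their coordinate differences
  -- modulo `4`.
  simp only [Prod.forall]
  decide

/-- A linear functional that is integral on the vertices of the orthoplex is integral on their
orbit. -/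
theorem exists_int_of_apply_orthoVec (f : Lor 3 →ₗ[ℝ] ℝ)
    (hf : ∀ x, ∃ m : ℤ, f (orthoVec x) = m) {G : Lor 3 ≃ₗ[ℝ] Lor 3} (hG : G ∈ orthoGroup)
    (x : Fin 4 × Bool) : ∃ m : ℤ, f (G (orthoVec x)) = m := by
  obtain ⟨a, b, h1, ⟨e, he⟩, -⟩ := isLatticeVec_apply_orthoVec hG x
  choose m hm using hf
  -- The positive vertices produce the right space part with time `∑ a_i`. The excess over `b` is `2
  -- * e` by the parity condition, and two antipodal vertices add up to pure time `2`.
  have h2 : ortho (fun i => a i) b = ∑ i, (a i : ℝ) • orthoVec (i, true) -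
      (e : ℝ) • (orthoVec (0, true) + orthoVec (0, false)) := by
    simp only [Fin.sum_univ_four, orthoVec_eq, smul_ortho, ortho_add, ortho_sub]
    have he' : (∑ i, (a i : ℝ)) - b = 2 * e := by exact_mod_cast he
    rw [Fin.sum_univ_four] at he'
    congr 1
    · funext i
      fin_cases i <;> simp
    · linarith
  refine ⟨∑ i, a i * m (i, true) - e * (m (0, true) + m (0, false)), ?_⟩
  rw [h1, h2, map_sub, map_sum, map_smul, map_add]
  simp only [map_smul, smul_eq_mul, hm]
  push_cast
  rfl

/-! ### Arithmetic equivalence from a correspondence -/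

theorem exists_equiv_range {T A B : Type*} (F : T → A) (H : T → B)
    (h : ∀ t t', F t = F t' ↔ H t = H t') :
    ∃ ψ : range F ≃ range H, ∀ t, ψ ⟨F t, t, rfl⟩ = ⟨H t, t, rfl⟩ := by
  have key : ∀ s : range F, H s.2.choose ∈ range H := fun s => ⟨_, rfl⟩
  have hval : ∀ t (ht : F t ∈ range F), H ht.choose = H t := fun t ht =>
    (h _ _).1 ht.choose_spec
  refine ⟨Equiv.ofBijective (fun s => ⟨H s.2.choose, key s⟩) ⟨?_, ?_⟩, ?_⟩
  · rintro ⟨_, t, rfl⟩ ⟨_, t', rfl⟩ he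
    have h1 : H t = H t' := by
      have h2 := Subtype.ext_iff.1 he
      dsimp only at h2
      rwa [hval, hval] at h2
    exact Subtype.ext ((h _ _).2 h1)
  · rintro ⟨_, t, rfl⟩
    exact ⟨⟨F t, t, rfl⟩, Subtype.ext (hval t _)⟩
  · exact fun t => Subtype.ext (hval t _)

/-- `D` is the graph of the isomorphism: `hone` makes both projections injective, and `Γ` is the
image of the first. Since equality of two translates can be tested after moving one group element
across, `heq` says that matching `g '' x i` with `a '' y i` is well defined and injective. -/
theorem exists_section_of_correspondence {K : Family} {B : PolytopalPacking 2 K}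
    {O : PolytopalPacking 3 .crossPolytope} {ι : Type}
    (D : Subgroup (Equiv.Perm (Hat 3) × Equiv.Perm (Hat 2)))
    (x : ι → Set (Hat 3)) (y : ι → Set (Hat 2))
    (hx : ∀ i, x i ∈ O.balls) (hy : B.balls = range y)
    (hO : ∀ p ∈ D, p.1 ∈ O.apollonianGroup)
    (hB : ∀ a, a ∈ B.apollonianGroup ↔ ∃ g, (g, a) ∈ D)
    (hone : ∀ p ∈ D, p.1 = 1 ↔ p.2 = 1)
    (heq : ∀ p ∈ D, ∀ i j, p.1 '' x i = x j ↔ p.2 '' y i = y j)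
    (hcurv : ∀ p ∈ D, ∀ i, ∃ k, HasCurvature (p.1 '' x i) k ∧ HasCurvature (p.2 '' y i) k) :
    ∃ (Γ : Subgroup (Equiv.Perm (Hat 3))) (X : Set (Set (Hat 3))),
      IsSection O Γ X ∧ ArithmeticallyEquivalent Γ X B.apollonianGroup B.balls := by
  set f : D →* Equiv.Perm (Hat 3) := (MonoidHom.fst _ _).comp D.subtype with hf
  set h : D →* Equiv.Perm (Hat 2) := (MonoidHom.snd _ _).comp D.subtype with hh
  have hfi : Function.Injective f := by
    rw [injective_iff_map_eq_one]
    rintro ⟨⟨g, a⟩, hp⟩ h1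
    have h2 : g = 1 := h1
    have h3 : a = 1 := (hone _ hp).1 h2
    subst h2 h3
    rfl
  have hhi : Function.Injective h := by
    rw [injective_iff_map_eq_one]
    rintro ⟨⟨g, a⟩, hp⟩ h1
    have h2 : a = 1 := h1
    have h3 : g = 1 := (hone _ hp).2 h2
    subst h2 h3
    rfl
  have hrange : h.range = B.apollonianGroup := by
    ext a
    rw [hB]
    constructor
    · rintro ⟨⟨⟨g, a⟩, hp⟩, rfl⟩
      exact ⟨g, hp⟩
    · rintro ⟨g, hp⟩
      exact ⟨⟨(g, a), hp⟩, rfl⟩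
  set F : D × ι → Set (Hat 3) := fun t => f t.1 '' x t.2 with hF
  set H : D × ι → Set (Hat 2) := fun t => h t.1 '' y t.2 with hH
  have horbF : orbit f.range (range x) = range F := by
    ext s
    constructor
    · rintro ⟨_, ⟨p, rfl⟩, _, ⟨i, rfl⟩, rfl⟩
      exact ⟨(p, i), rfl⟩
    · rintro ⟨⟨p, i⟩, rfl⟩
      exact ⟨_, ⟨p, rfl⟩, _, ⟨i, rfl⟩, rfl⟩
  have horbH : orbit B.apollonianGroup B.balls = range H := by
    rw [hy, ← hrange]
    ext s
    constructor
    · rintro ⟨_, ⟨p, rfl⟩, _, ⟨i, rfl⟩, rfl⟩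
      exact ⟨(p, i), rfl⟩
    · rintro ⟨⟨p, i⟩, rfl⟩
      exact ⟨_, ⟨p, rfl⟩, _, ⟨i, rfl⟩, rfl⟩
  have hcancel : ∀ {d : ℕ} (g k : Equiv.Perm (Hat d)) (s t : Set (Hat d)),
      g '' s = k '' t ↔ (k⁻¹ * g) '' s = t := by
    intro d g k s t
    rw [Equiv.Perm.coe_mul, image_comp]
    constructor
    · intro e
      rw [e, ← image_comp, ← Equiv.Perm.coe_mul, inv_mul_cancel, Equiv.Perm.coe_one, image_id]
    · intro e
      rw [← e, ← image_comp k, ← Equiv.Perm.coe_mul, mul_inv_cancel, Equiv.Perm.coe_one, image_id]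
  have hFH : ∀ t t', F t = F t' ↔ H t = H t' := by
    rintro ⟨p, i⟩ ⟨q, j⟩
    simp only [hF, hH]
    rw [hcancel, hcancel, ← map_inv, ← map_inv, ← map_mul, ← map_mul]
    exact heq _ (q⁻¹ * p).2 i j
  obtain ⟨ψ, hψ⟩ := exists_equiv_range F H hFH
  refine ⟨f.range, range x, ⟨?_, ?_⟩, ?_⟩
  · rintro _ ⟨p, rfl⟩
    exact hO _ p.2
  · rintro _ ⟨i, rfl⟩
    exact hx i
  · refine ⟨(MonoidHom.ofInjective hfi).symm.trans
      ((MonoidHom.ofInjective hhi).trans (MulEquiv.subgroupCongr hrange)),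
      (Equiv.setCongr horbF).trans (ψ.trans (Equiv.setCongr horbH.symm)), ?_, ?_⟩
    · rintro ⟨_, p, rfl⟩ ⟨b, hb⟩ ⟨gb, hgb⟩ ⟨i, rfl⟩ h1
      dsimp only at h1
      subst h1
      have e1 : (MonoidHom.ofInjective hfi).symm ⟨f p, p, rfl⟩ = p := by
        rw [MulEquiv.symm_apply_eq]
        rfl
      have e2 : ∀ (q : D) (s : Set (Hat 3)) (hs : s ∈ orbit f.range (range x)), s = F (q, i) →
          (((Equiv.setCongr horbF).trans (ψ.trans (Equiv.setCongr horbH.symm))) ⟨s, hs⟩).1 =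
            H (q, i) := by
        rintro q s hs rfl
        have := congrArg Subtype.val (hψ (q, i))
        exact this
      rw [e2 p _ hgb rfl, e2 1 _ hb (by simp [hF]), MulEquiv.trans_apply, e1]
      simp [hH]
      rfl
    · rintro ⟨b, hb⟩
      have hb' := hb
      rw [horbF] at hb'
      obtain ⟨⟨p, i⟩, rfl⟩ := hb'
      obtain ⟨k, h1, h2⟩ := hcurv p.1 p.2 i
      refine ⟨k, h1, ?_⟩
      have := congrArg Subtype.val (hψ (p, i))
      have h3 : HasCurvature (ψ ⟨F (p, i), (p, i), rfl⟩).1 k := by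
        rw [this]; exact h2
      exact h3

theorem HasCurvature.unique {d : ℕ} [NeZero d] {s : Set (Hat d)} {k k' : ℝ}
    (h : HasCurvature s k) (h' : HasCurvature s k') : k = k' := by
  obtain ⟨b, rfl, rfl⟩ := h
  rw [Ball.carrier_eq, hasCurvature_cap b.lor_vec] at h'
  rw [Ball.curvature_eq, h']

theorem isIntegral_of_section {K : Family} {B : PolytopalPacking 2 K}
    {O : PolytopalPacking 3 .crossPolytope} {Γ : Subgroup (Equiv.Perm (Hat 3))}
    {X : Set (Set (Hat 3))} (hs : IsSection O Γ X)
    (he : ArithmeticallyEquivalent Γ X B.apollonianGroup B.balls) (hO : O.IsIntegral) :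
    B.IsIntegral := by
  obtain ⟨φ, ψ, -, h⟩ := he
  intro s hsB
  obtain ⟨b, hb⟩ := ψ.surjective ⟨s, hsB⟩
  obtain ⟨k, h1, h2⟩ := h b
  rw [hb] at h2
  obtain ⟨g, hg, t, ht, hgt⟩ := b.2
  obtain ⟨m, hm⟩ := hO b.1 ⟨g, hs.1 hg, t, hs.2 ht, hgt⟩
  exact ⟨m, by rwa [h1.unique hm] at h2⟩

/-! ### Linear sections -/

/-- A linear correspondence between the orthoplex and a three-dimensional edge-scribed polytope:
a linear map of Lorentz spaces sending some of the vertices of the orthoplex to those of the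
polytope, and a group of pairs of isometries that it intertwines. -/
structure LinearSection {K : Family} (Q : EdgeScribed 3 K) where
  proj : Lor 3 →ₗ[ℝ] Lor 2
  index : K.Vertex 3 → Fin 4 × Bool
  scale : K.Vertex 3 → ℝ
  scale_pos : ∀ i, 0 < scale i
  proj_index : ∀ i, proj (orthoVec (index i)) = scale i • embed (Q.vertex i) 1
  lor_proj_index : ∀ i, lor (proj (orthoVec (index i))) (proj (orthoVec (index i))) = 1
  group : Subgroup ((Lor 3 ≃ₗ[ℝ] Lor 3) × (Lor 2 ≃ₗ[ℝ] Lor 2))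
  mem_orthoGroup : ∀ p ∈ group, p.1 ∈ orthoGroup
  isIso : ∀ p ∈ group, IsIso p.2
  intertwine : ∀ p ∈ group, ∀ x, proj (p.1 x) = p.2 (proj x)
  surjective : Function.Surjective proj
  facet_pos : ∀ S w, IsFacetWithPolar Q.vertex S w → 0 < lor (embed w 1) (embed w 1)
  facet_mem : ∀ S w, IsFacetWithPolar Q.vertex S w → ∃ G, (G, refl (embed w 1)) ∈ group
  eq_one : ∀ p ∈ group, p.2 = 1 → p.1 = 1
  vertex_eq : ∀ p ∈ group, ∀ i j,
    p.2 (proj (orthoVec (index i))) = proj (orthoVec (index j)) →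
      p.1 (orthoVec (index i)) = orthoVec (index j)
  -- This says that the vector of `Lor 3` representing `lor N ∘ proj` is null as well, so that the
  -- pulled-back functional is again a curvature functional.
  null : ∀ N, lor N N = 0 →
    ∑ i, lor N (proj (ortho (Pi.single i 1) 0)) ^ 2 = 2 * lor N (proj (ortho 0 1)) ^ 2
  timelike : lor (proj (ortho 0 1)) (proj (ortho 0 1)) < 0
  future : 0 < (proj (ortho 0 1)).2.1
  integral : ∀ N, lor N N = 0 →
    (∀ i, ∃ m : ℤ, -2 * lor N (proj (orthoVec (index i))) = m) →
      ∀ x, ∃ m : ℤ, -2 * lor N (proj (orthoVec x)) = m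

theorem exists_moebius_curvature_embed {d : ℕ} {v : Euc (d + 1)} {t : ℝ} (ht : 0 < t)
    (h : lor (embed v t) (embed v t) = 0) :
    ∃ g ∈ moebiusGroup d, ∃ M, Realizes g M ∧ ∀ x, (M x).2.1 = -2 * lor x (embed v t) := by
  have h1 := h
  rw [lor_embed, real_inner_self_eq_norm_sq] at h1
  have h2 : ‖v‖ = t := by
    rw [← sq_eq_sq₀ (norm_nonneg _) ht.le]; linarith
  have h3 : |v (Fin.last d)| ≤ ‖v‖ := PiLp.norm_apply_le v (Fin.last d)
  rw [h2, abs_le] at h3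
  refine exists_moebius_curvature h ?_ ?_ ?_ <;> simp only [embed] <;> linarith

/-- The Möbius transformation of the sphere packing is chosen so that its curvature functional is
that of the circle packing composed with `L.proj`. Balls and groups then correspond through the
pairs in `L.group`. -/
theorem LinearSection.conclusion {K : Family} {B : PolytopalPacking 2 K}
    (L : LinearSection B.polytope) :
    ∃ O : PolytopalPacking 3 .crossPolytope,
      (∃ (Γ : Subgroup (Equiv.Perm (Hat 3))) (X : Set (Set (Hat 3))),
        IsSection O Γ X ∧ ArithmeticallyEquivalent Γ X B.apollonianGroup B.balls) ∧
      (B.IsIntegral ↔ O.IsIntegral) := by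
  obtain ⟨M₂, hM₂⟩ := exists_realizes_of_mem B.moebius_mem
  set N : Lor 2 := M₂⁻¹ (lift .infty) with hN
  have hNN : lor N N = 0 := by rw [hN, hM₂.1.inv, lor_lift_self]
  have hκ : ∀ y, (M₂ y).2.1 = -2 * lor N y := fun y => by
    rw [curvature_coord, hM₂.1.lor_apply_left, lor_comm]
  set θ : ℝ := -2 * lor N (L.proj (ortho 0 1)) with hθ
  set α : Fin 4 → ℝ := fun i => -2 * lor N (L.proj (ortho (Pi.single i 1) 0)) with hα
  have hθpos : 0 < θ := by rw [hθ, ← hκ]; exact hM₂.coord_pos L.timelike L.future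
  have hnull := L.null N hNN
  -- The space axes have square `2` and the time axis `-1`, so the functional with coefficients `α
  -- i` and `θ` is `-2` times the product with this vector. It is null precisely when `∑ α i ^ 2 = 2
  -- * θ ^ 2`.
  obtain ⟨μ, hμ, M₃, hM₃, hκ₃⟩ : ∃ g ∈ moebiusGroup 3, ∃ M, Realizes g M ∧
      ∀ x, (M x).2.1 = -2 * lor x (ortho (fun i => -α i / 4) (θ / 2)) := by
    refine exists_moebius_curvature_embed (by linarith) ?_
    change lor (ortho (fun i => -α i / 4) (θ / 2)) (ortho (fun i => -α i / 4) (θ / 2)) = 0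
    rw [lor_ortho]
    simp only [hα, hθ, Fin.sum_univ_four] at hnull ⊢
    linarith
  have hκeq : ∀ x, (M₃ x).2.1 = (M₂ (L.proj x)).2.1 := by
    intro x
    obtain ⟨a, t, rfl⟩ := exists_eq_ortho x
    have h1 : ortho a t = ∑ i, a i • ortho (Pi.single i 1) 0 + t • ortho 0 1 := by
      simp only [Fin.sum_univ_four, smul_ortho, ortho_add]
      congr 1
      · funext i
        fin_cases i <;> simp
      · ring
    rw [hκ₃, hκ, lor_ortho, h1]
    simp only [map_add, map_smul, smul_eq_mul, hα, hθ, Fin.sum_univ_four]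
    ring
  set O : PolytopalPacking 3 .crossPolytope := ⟨orthoplex, μ, hμ⟩ with hO
  have hOM : Realizes O.moebius M₃ := hM₃
  have hOfacet : ∀ S w, IsFacetWithPolar O.polytope.vertex S w → ∃ s, embed w 1 = dualVec s := by
    intro S w hw
    obtain ⟨s, -, rfl⟩ := isFacetWithPolar_orthoVertex hw
    exact ⟨s, rfl⟩
  have hOpos : ∀ S w, IsFacetWithPolar O.polytope.vertex S w →
      0 < lor (embed w 1) (embed w 1) := by
    intro S w hw
    obtain ⟨s, hs⟩ := hOfacet S w hw
    rw [hs, lor_dualVec_self]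
    exact one_pos
  have hOgroup : ∀ G ∈ orthoGroup, ∃ g ∈ O.apollonianGroup, Realizes g (M₃ * G * M₃⁻¹) := by
    intro G hG
    refine O.exists_mem_apollonianGroup_realizes hOM hOpos (Subgroup.closure_mono ?_ hG)
    rintro _ ⟨s, rfl⟩
    exact ⟨_, _, isFacetWithPolar_orthoDual s, rfl⟩
  have hOgroup' : ∀ g ∈ O.apollonianGroup, ∃ G ∈ orthoGroup, Realizes g (M₃ * G * M₃⁻¹) := by
    intro g hg
    refine O.exists_realizes_of_mem_apollonianGroup hOM hOpos _ ?_ hg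
    intro S w hw
    obtain ⟨s, hs⟩ := hOfacet S w hw
    rw [hs]
    exact refl_mem_orthoGroup s
  have hBgroup : ∀ a ∈ B.apollonianGroup, ∃ p ∈ L.group, Realizes a (M₂ * p.2 * M₂⁻¹) := by
    intro a ha
    obtain ⟨_, ⟨p, hp, rfl⟩, h2⟩ := B.exists_realizes_of_mem_apollonianGroup hM₂ L.facet_pos
      (L.group.map (MonoidHom.snd _ _)) (fun S w hw => by
        obtain ⟨G, hG⟩ := L.facet_mem S w hw
        exact ⟨_, hG, rfl⟩) ha
    exact ⟨p, hp, h2⟩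
  have hconjmul : ∀ {d : ℕ} (M R R' : Lor d ≃ₗ[ℝ] Lor d),
      M * R * M⁻¹ * (M * R' * M⁻¹) = M * (R * R') * M⁻¹ := fun M R R' => by group
  have hconjinv : ∀ {d : ℕ} (M R : Lor d ≃ₗ[ℝ] Lor d),
      (M * R * M⁻¹)⁻¹ = M * R⁻¹ * M⁻¹ := fun M R => by group
  let D : Subgroup (Equiv.Perm (Hat 3) × Equiv.Perm (Hat 2)) :=
    { carrier := {q | q.1 ∈ O.apollonianGroup ∧ q.2 ∈ B.apollonianGroup ∧ ∃ p ∈ L.group,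
        Realizes q.1 (M₃ * p.1 * M₃⁻¹) ∧ Realizes q.2 (M₂ * p.2 * M₂⁻¹)}
      one_mem' := ⟨one_mem _, one_mem _, 1, one_mem _, by simpa using Realizes.one,
        by simpa using Realizes.one⟩
      mul_mem' := by
        rintro q q' ⟨h1, h2, p, hp, h3, h4⟩ ⟨h1', h2', p', hp', h3', h4'⟩
        refine ⟨mul_mem h1 h1', mul_mem h2 h2', p * p', mul_mem hp hp', ?_, ?_⟩
        · rw [Prod.fst_mul, Prod.fst_mul, ← hconjmul]
          exact h3.mul h3'
        · rw [Prod.snd_mul, Prod.snd_mul, ← hconjmul]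
          exact h4.mul h4'
      inv_mem' := by
        rintro q ⟨h1, h2, p, hp, h3, h4⟩
        refine ⟨inv_mem h1, inv_mem h2, p⁻¹, inv_mem hp, ?_, ?_⟩
        · rw [Prod.fst_inv, Prod.fst_inv, ← hconjinv]
          exact h3.inv
        · rw [Prod.snd_inv, Prod.snd_inv, ← hconjinv]
          exact h4.inv }
  set x : K.Vertex 3 → Set (Hat 3) := fun i => cap (M₃ (orthoVec (L.index i))) with hx
  set y : K.Vertex 3 → Set (Hat 2) := fun i => cap (M₂ (L.proj (orthoVec (L.index i)))) with hy
  have hyB : B.balls = range y := by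
    ext s
    rw [B.mem_balls_iff hM₂]
    refine exists_congr fun i => ?_
    simp only [hy]
    rw [L.proj_index, map_smul, cap_smul (L.scale_pos i)]
    exact eq_comm
  have hximg : ∀ (g : Equiv.Perm (Hat 3)) (G : Lor 3 ≃ₗ[ℝ] Lor 3),
      Realizes g (M₃ * G * M₃⁻¹) → ∀ v, g '' cap (M₃ v) = cap (M₃ (G v)) := by
    intro g G h v
    rw [h.image_cap, LinearEquiv.mul_apply, LinearEquiv.mul_apply, inv_apply_self']
  have hyimg : ∀ (g : Equiv.Perm (Hat 2)) (G : Lor 2 ≃ₗ[ℝ] Lor 2),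
      Realizes g (M₂ * G * M₂⁻¹) → ∀ v, g '' cap (M₂ v) = cap (M₂ (G v)) := by
    intro g G h v
    rw [h.image_cap, LinearEquiv.mul_apply, LinearEquiv.mul_apply, inv_apply_self']
  have hxunit : ∀ G ∈ orthoGroup, ∀ v, lor (M₃ (G (orthoVec v))) (M₃ (G (orthoVec v))) = 1 := by
    intro G hG v
    rw [hM₃.1, isIso_of_mem_orthoGroup hG, lor_orthoVec_self]
  have hyunit : ∀ p ∈ L.group, ∀ i, lor (M₂ (p.2 (L.proj (orthoVec (L.index i)))))
      (M₂ (p.2 (L.proj (orthoVec (L.index i))))) = 1 := by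
    intro p hp i
    rw [hM₂.1, L.isIso p hp, L.lor_proj_index]
  have hconj1 : ∀ {d : ℕ} (M R : Lor d ≃ₗ[ℝ] Lor d), M * R * M⁻¹ = 1 ↔ R = 1 := fun M R => by
    rw [mul_inv_eq_one, mul_eq_left]
  have hsec : ∃ (Γ : Subgroup (Equiv.Perm (Hat 3))) (X : Set (Set (Hat 3))),
      IsSection O Γ X ∧ ArithmeticallyEquivalent Γ X B.apollonianGroup B.balls := by
    refine exists_section_of_correspondence D x y ?_ hyB ?_ ?_ ?_ ?_ ?_
    · intro i
      exact (O.mem_balls_iff hOM _).2 ⟨L.index i, rfl⟩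
    · exact fun q hq => hq.1
    · intro a
      constructor
      · intro ha
        obtain ⟨p, hp, h1⟩ := hBgroup a ha
        obtain ⟨g, hg, h2⟩ := hOgroup p.1 (L.mem_orthoGroup p hp)
        exact ⟨g, hg, ha, p, hp, h2, h1⟩
      · rintro ⟨g, -, ha, -⟩
        exact ha
    · rintro q ⟨-, -, p, hp, h3, h4⟩
      rw [h3.eq_one_iff, h4.eq_one_iff, hconj1, hconj1]
      refine ⟨fun h => ?_, L.eq_one p hp⟩
      ext1 v
      obtain ⟨u, rfl⟩ := L.surjective v
      rw [← L.intertwine p hp, h]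
      rfl
    · rintro q ⟨-, -, p, hp, h3, h4⟩ i j
      simp only [hx, hy]
      rw [hximg _ _ h3, hyimg _ _ h4]
      constructor
      · intro h
        have h5 := M₃.injective (cap_injective (hxunit _ (L.mem_orthoGroup p hp) _)
          (hxunit 1 (one_mem _) _) h)
        rw [← L.intertwine p hp, h5]
        rfl
      · intro h
        have h5 := M₂.injective (cap_injective (hyunit p hp i) (hyunit 1 (one_mem _) j) h)
        rw [L.vertex_eq p hp i j h5]
    · rintro q ⟨-, -, p, hp, h3, h4⟩ i
      simp only [hx, hy]
      rw [hximg _ _ h3, hyimg _ _ h4]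
      refine ⟨_, (hasCurvature_cap (hxunit _ (L.mem_orthoGroup p hp) _) _).2 rfl,
        (hasCurvature_cap (hyunit p hp i) _).2 ?_⟩
      rw [hκeq, L.intertwine p hp]
  refine ⟨O, hsec, ?_, ?_⟩
  · intro hint
    have h1 : ∀ i, ∃ m : ℤ, -2 * lor N (L.proj (orthoVec (L.index i))) = m := by
      intro i
      obtain ⟨m, hm⟩ := hint (y i) ⟨1, one_mem _, y i, by rw [hyB]; exact ⟨i, rfl⟩, by simp⟩
      refine ⟨m, ?_⟩
      rw [← hκ]
      exact (hasCurvature_cap (hyunit 1 (one_mem _) i) _).1 hm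
    have h2 := L.integral N hNN h1
    rintro _ ⟨g, hg, b, hb, rfl⟩
    obtain ⟨G, hG, hgG⟩ := hOgroup' g hg
    obtain ⟨v, rfl⟩ := (O.mem_balls_iff hOM _).1 hb
    obtain ⟨m, hm⟩ := exists_int_of_apply_orthoVec ((-2 : ℝ) • (lor N ∘ₗ L.proj)) h2 hG v
    refine ⟨m, ?_⟩
    rw [hximg g G hgG]
    refine (hasCurvature_cap (hxunit G hG v) _).2 ?_
    rw [hκeq, hκ, ← hm]
    rfl
  · intro hint
    obtain ⟨Γ, X, hs, he⟩ := hsec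
    exact isIntegral_of_section hs he hint

/-! ### Orthogonal frames of the Lorentz space of circles -/

/-- An orthogonal frame with three space-like vectors of square `δ` and a time-like vector of
square `-η`. -/
structure IsFrame (D : Fin 3 → Lor 2) (τ : Lor 2) (δ η : ℝ) : Prop where
  lor_space : ∀ i j, lor (D i) (D j) = if i = j then δ else 0
  lor_space_time : ∀ i, lor (D i) τ = 0
  lor_time : lor τ τ = -η
  space_pos : 0 < δ
  time_pos : 0 < η

/-- The vector with given coordinates in a frame. -/
def frameVec (D : Fin 3 → Lor 2) (τ : Lor 2) (c : Fin 3 → ℝ) (t : ℝ) : Lor 2 :=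
  ∑ i, c i • D i + t • τ

theorem frameVec_add (D : Fin 3 → Lor 2) (τ : Lor 2) (c c' : Fin 3 → ℝ) (t t' : ℝ) :
    frameVec D τ c t + frameVec D τ c' t' = frameVec D τ (fun i => c i + c' i) (t + t') := by
  simp only [frameVec, add_smul, Finset.sum_add_distrib]
  abel

theorem smul_frameVec (D : Fin 3 → Lor 2) (τ : Lor 2) (a : ℝ) (c : Fin 3 → ℝ) (t : ℝ) :
    a • frameVec D τ c t = frameVec D τ (fun i => a * c i) (a * t) := by
  simp only [frameVec, smul_add, Finset.smul_sum, smul_smul]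

theorem finrank_lor_two : Module.finrank ℝ (Lor 2) = 4 := by
  simp [Lor]

namespace IsFrame

variable {D : Fin 3 → Lor 2} {τ : Lor 2} {δ η : ℝ} (h : IsFrame D τ δ η)
include h

theorem lor_frameVec (c c' : Fin 3 → ℝ) (t t' : ℝ) :
    lor (frameVec D τ c t) (frameVec D τ c' t') = δ * ∑ i, c i * c' i - η * (t * t') := by
  have h1 : ∀ i, lor τ (D i) = 0 := fun i => by rw [lor_comm, h.lor_space_time]
  simp only [frameVec, Fin.sum_univ_three, lor_add_left, lor_add_right, lor_smul_left,
    lor_smul_right, h.lor_space, h.lor_space_time, h1, h.lor_time]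
  simp
  ring

theorem injective {c c' : Fin 3 → ℝ} {t t' : ℝ}
    (he : frameVec D τ c t = frameVec D τ c' t') : c = c' ∧ t = t' := by
  constructor
  · funext i
    have h1 := congrArg (fun x => lor x (frameVec D τ (Pi.single i 1) 0)) he
    simp only [h.lor_frameVec, Pi.single_apply, mul_ite, mul_one, mul_zero, Finset.sum_ite_eq',
      Finset.mem_univ, if_true, sub_zero] at h1
    exact mul_left_cancel₀ h.space_pos.ne' h1
  · have h1 := congrArg (fun x => lor x (frameVec D τ 0 1)) he
    simp only [h.lor_frameVec, Pi.zero_apply, mul_zero, mul_one, Finset.sum_const_zero,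
      zero_sub, neg_inj] at h1
    exact mul_left_cancel₀ h.time_pos.ne' h1

theorem exists_eq_frameVec (x : Lor 2) : ∃ c t, x = frameVec D τ c t := by
  set v : Fin 4 → Lor 2 := Fin.snoc D τ with hv
  have hsum : ∀ g : Fin 4 → ℝ, ∑ i, g i • v i =
      frameVec D τ (fun i => g i.castSucc) (g (Fin.last 3)) := by
    intro g
    rw [Fin.sum_univ_castSucc, hv, frameVec]
    simp only [Fin.snoc_castSucc, Fin.snoc_last]
  have hli : LinearIndependent ℝ v := by
    rw [Fintype.linearIndependent_iff]
    intro g hg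
    rw [hsum] at hg
    obtain ⟨h1, h2⟩ := h.injective (c' := 0) (t' := 0) (by rw [hg]; simp [frameVec])
    intro i
    refine Fin.lastCases h2 (fun i => congrFun h1 i) i
  have htop := hli.span_eq_top_of_card_eq_finrank (by rw [finrank_lor_two]; rfl)
  have hx : x ∈ Submodule.span ℝ (range v) := by rw [htop]; trivial
  obtain ⟨g, rfl⟩ := (Submodule.mem_span_range_iff_exists_fun ℝ).1 hx
  exact ⟨_, _, hsum g⟩

end IsFrame

/-! ### Linear maps out of the Lorentz space of spheres -/

/-- The linear map with prescribed values on the coordinate vectors of the orthoplex. -/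
def orthoLift (b : Fin 4 → Lor 2) (σ : Lor 2) : Lor 3 →ₗ[ℝ] Lor 2 :=
  ∑ i, ((1 / 2 : ℝ) • lor (ortho (Pi.single i 1) 0)).smulRight (b i) +
    (-lor (ortho 0 1)).smulRight σ

theorem orthoLift_ortho (b : Fin 4 → Lor 2) (σ : Lor 2) (a : Fin 4 → ℝ) (t : ℝ) :
    orthoLift b σ (ortho a t) = ∑ i, a i • b i + t • σ := by
  simp [orthoLift, lor_ortho, Pi.single_apply, LinearMap.sum_apply]

/-- Pairs of isometries of the Lorentz spaces of spheres and circles that are intertwined by `π`,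
the first of which belongs to the orthoplicial group and fixes `u` up to sign (and fixes `u` unless
`flip` holds). -/
def pairGroup (π : Lor 3 →ₗ[ℝ] Lor 2) (u : Lor 3) (flip : Prop) :
    Subgroup ((Lor 3 ≃ₗ[ℝ] Lor 3) × (Lor 2 ≃ₗ[ℝ] Lor 2)) where
  carrier := {p | p.1 ∈ orthoGroup ∧ IsIso p.2 ∧ (∀ x, π (p.1 x) = p.2 (π x)) ∧
    (p.1 u = u ∨ flip ∧ p.1 u = -u)}
  one_mem' := ⟨one_mem _, IsIso.one, fun _ => rfl, Or.inl rfl⟩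
  mul_mem' := by
    rintro p q ⟨h1, h2, h3, h4⟩ ⟨h1', h2', h3', h4'⟩
    refine ⟨mul_mem h1 h1', h2.mul h2', fun x => ?_, ?_⟩
    · change π (p.1 (q.1 x)) = p.2 (q.2 (π x))
      rw [h3, h3']
    · change p.1 (q.1 u) = u ∨ flip ∧ p.1 (q.1 u) = -u
      rcases h4 with h4 | ⟨hf, h4⟩ <;> rcases h4' with h4' | ⟨hf', h4'⟩ <;>
        simp [*]
  inv_mem' := by
    rintro p ⟨h1, h2, h3, h4⟩
    refine ⟨inv_mem h1, h2.inv, fun x => ?_, ?_⟩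
    · change π (p.1⁻¹ x) = p.2⁻¹ (π x)
      rw [← inv_apply_self' p.2 (π (p.1⁻¹ x)), ← h3, apply_inv_self']
    · change p.1⁻¹ u = u ∨ flip ∧ p.1⁻¹ u = -u
      rcases h4 with h4 | ⟨hf, h4⟩
      · left
        conv_lhs => rw [← h4, inv_apply_self']
      · right
        refine ⟨hf, ?_⟩
        have h5 := inv_apply_self' p.1 u
        rw [h4, map_neg] at h5
        rw [← h5, neg_neg, h5]

section pairGroup

variable {π : Lor 3 →ₗ[ℝ] Lor 2} {u : Lor 3} {flip : Prop}

theorem exists_eq_add_smul_of_mem_pairGroup (hker : ∀ x, π x = 0 → ∃ f : ℝ, x = f • u)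
    {p : (Lor 3 ≃ₗ[ℝ] Lor 3) × (Lor 2 ≃ₗ[ℝ] Lor 2)} (hp : p ∈ pairGroup π u flip) {x y : Lor 3}
    (hxy : p.2 (π x) = π y) : ∃ f : ℝ, p.1 x = y + f • u := by
  obtain ⟨f, hf⟩ := hker (p.1 x - y) (by rw [map_sub, hp.2.2.1, hxy, sub_self])
  exact ⟨f, by rw [← hf]; abel⟩

/-- Both isometries of the pair preserve enough: `p.1` fixes the line of `u`, hence its orthogonal
complement, on which `π` is injective. -/
theorem apply_eq_of_orthogonal (hker : ∀ x, π x = 0 → ∃ f : ℝ, x = f • u) (hu : lor u u ≠ 0)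
    {p : (Lor 3 ≃ₗ[ℝ] Lor 3) × (Lor 2 ≃ₗ[ℝ] Lor 2)} (hp : p ∈ pairGroup π u flip) {x y : Lor 3}
    (hx : lor x u = 0) (hy : lor y u = 0) (hxy : p.2 (π x) = π y) : p.1 x = y := by
  obtain ⟨f, hf⟩ := exists_eq_add_smul_of_mem_pairGroup hker hp hxy
  have h1 := isIso_of_mem_orthoGroup hp.1 x u
  have h2 : lor (p.1 x) u = 0 := by
    rw [hx] at h1
    rcases hp.2.2.2 with h3 | ⟨-, h3⟩
    · rwa [h3] at h1
    · rwa [h3, map_neg, neg_eq_zero] at h1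
  rw [hf, lor_add_left, hy, lor_smul_left, zero_add, mul_eq_zero, or_iff_left hu] at h2
  rw [hf, h2, zero_smul, add_zero]

theorem eq_one_of_mem_pairGroup (hker : ∀ x, π x = 0 → ∃ f : ℝ, x = f • u) (hu : lor u u ≠ 0)
    {p : (Lor 3 ≃ₗ[ℝ] Lor 3) × (Lor 2 ≃ₗ[ℝ] Lor 2)} (hp : p ∈ pairGroup π u False)
    (h : p.2 = 1) : p.1 = 1 := by
  ext1 x
  obtain ⟨f, hf⟩ := exists_eq_add_smul_of_mem_pairGroup hker hp (x := x) (y := x) (by rw [h]; rfl)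
  have h1 := isIso_of_mem_orthoGroup hp.1 x u
  have h2 : p.1 u = u := by simpa using hp.2.2.2
  rw [hf, h2, lor_add_left, lor_smul_left, add_eq_left, mul_eq_zero, or_iff_left hu] at h1
  rw [hf, h1, zero_smul, add_zero]
  rfl

/-- `h2` makes `q`, up to scale, represent the functional of `dualVec s` through `π`, so the two
reflection formulas agree. The factor `lor q q` is kept because `π` is an isometry on the complement
of its kernel only up to scale. -/
theorem refl_intertwine {s : Fin 4 → Bool} {q : Lor 2} (h1 : π (dualVec s) = q)
    (h2 : ∀ x, lor q q * lor (dualVec s) x = lor q (π x)) (h3 : lor q q ≠ 0) (x : Lor 3) :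
    π (refl (dualVec s) x) = refl q (π x) := by
  rw [refl_apply, refl_apply, map_sub, map_smul, h1, lor_dualVec_self, ← h2]
  congr 2
  field_simp

theorem refl_mem_pairGroup {s : Fin 4 → Bool} {q : Lor 2} (h1 : π (dualVec s) = q)
    (h2 : ∀ x, lor q q * lor (dualVec s) x = lor q (π x)) (h3 : lor q q ≠ 0)
    (hu : lor (dualVec s) u = 0) : (refl (dualVec s), refl q) ∈ pairGroup π u flip := by
  refine ⟨refl_mem_orthoGroup s, isIso_refl q, refl_intertwine h1 h2 h3, Or.inl ?_⟩
  rw [refl_apply, hu]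
  simp

end pairGroup

/-- The signs of the vertices of the tetrahedron inscribed in the cube. -/
def tetSign : Fin 4 → Fin 3 → ℤ := ![![1, 1, 1], ![1, -1, -1], ![-1, 1, -1], ![-1, -1, 1]]

theorem embed_one_ne_zero {d : ℕ} (w : Euc (d + 1)) : embed w 1 ≠ 0 := by
  intro h
  have h1 : (embed w 1).2.1 + (embed w 1).2.2 = 0 := by simp [h]
  simp only [embed] at h1
  linarith

theorem ne_zero_of_embed_eq_smul {d : ℕ} {w : Euc (d + 1)} {c : ℝ} {q : Lor d}
    (hq : embed w 1 = c • q) : c ≠ 0 := by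
  rintro rfl
  exact embed_one_ne_zero w (by rw [hq, zero_smul])

theorem lor_pos_of_embed_eq_smul {d : ℕ} {w : Euc (d + 1)} {c : ℝ} {q : Lor d}
    (hq : embed w 1 = c • q) (h : 0 < lor q q) : 0 < lor (embed w 1) (embed w 1) := by
  have hc := ne_zero_of_embed_eq_smul hq
  rw [hq, lor_smul_left, lor_smul_right, ← mul_assoc]
  exact mul_pos (mul_self_pos.2 hc) h

theorem refl_eq_of_embed_eq_smul {d : ℕ} {w : Euc (d + 1)} {c : ℝ} {q : Lor d}
    (hq : embed w 1 = c • q) : refl (embed w 1) = refl q := by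
  rw [hq, refl_smul (ne_zero_of_embed_eq_smul hq)]

/-! ### Sections of the orthoplicial packing -/

variable {D : Fin 3 → Lor 2} {τ : Lor 2}

/-- A tetrahedral frame provides a linear section. -/
def tetrahedralSection (h : IsFrame D τ (1 / 2) (1 / 2)) (hτ : 0 < τ.2.1)
    (Q : EdgeScribed 3 .simplex) (scale : Fin 4 → ℝ) (hscale : ∀ i, 0 < scale i)
    (hvertex : ∀ i : Fin 4, frameVec D τ (fun k => tetSign i k) 1 =
      scale i • embed (Q.vertex i) 1)
    (hfacet : ∀ S w, IsFacetWithPolar Q.vertex S w → ∃ (j : Fin 4) (c : ℝ),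
      embed w 1 = c • frameVec D τ (fun k => -tetSign j k) 1) :
    LinearSection Q := by
  -- The values are chosen so that the vertices `e_j + time` of one facet go to the tetrahedron and
  -- the vector `(1, 1, 1, 1; 2)`, twice the dual vector of that facet, goes to `0`. All four
  -- vertices are orthogonal to it.
  set π : Lor 3 →ₗ[ℝ] Lor 2 := orthoLift (fun j => frameVec D τ (fun k => tetSign j k) (-1))
    (frameVec D τ 0 2) with hπ
  have hval : ∀ a t, π (ortho a t) =
      frameVec D τ (fun k => ∑ j, a j * tetSign j k) (2 * t - ∑ j, a j) := by
    intro a t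
    rw [hπ, orthoLift_ortho]
    simp only [Fin.sum_univ_four, smul_frameVec, frameVec_add]
    congr 1
    · funext k; simp
    · ring
  have hvec : ∀ i, π (orthoVec (i, true)) = frameVec D τ (fun k => tetSign i k) 1 := by
    intro i
    rw [orthoVec_eq, hval]
    congr 1
    · funext k; simp
    · simp; norm_num
  have hker : ∀ x, π x = 0 → ∃ f : ℝ, x = f • ortho (fun _ => 1) 2 := by
    intro x hx
    obtain ⟨a, t, rfl⟩ := exists_eq_ortho x
    rw [hval] at hx
    obtain ⟨h1, h2⟩ := h.injective (c' := 0) (t' := 0) (by rw [hx]; simp [frameVec])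
    have e0 := congrFun h1 0
    have e1 := congrFun h1 1
    have e2 := congrFun h1 2
    simp [Fin.sum_univ_four, tetSign] at e0 e1 e2 h2
    refine ⟨a 0, ?_⟩
    rw [smul_ortho]
    congr 1
    · funext i
      fin_cases i <;> simp <;> linarith
    · linarith
  have hu : lor (ortho (fun _ => 1) 2) (ortho (fun _ => 1) 2) ≠ 0 := by
    rw [lor_ortho]; simp; norm_num
  have hqq : ∀ j : Fin 4, lor (frameVec D τ (fun k => -tetSign j k) 1)
      (frameVec D τ (fun k => -tetSign j k) 1) = 1 := by
    intro j
    rw [h.lor_frameVec, Fin.sum_univ_three]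
    fin_cases j <;> simp [tetSign] <;> norm_num
  refine
    { proj := π
      index := fun i => (i, true)
      scale := scale
      scale_pos := hscale
      proj_index := fun i => (hvec i).trans (hvertex i)
      lor_proj_index := ?_
      group := pairGroup π (ortho (fun _ => 1) 2) False
      mem_orthoGroup := fun p hp => hp.1
      isIso := fun p hp => hp.2.1
      intertwine := fun p hp => hp.2.2.1
      surjective := ?_
      facet_pos := ?_
      facet_mem := ?_
      eq_one := fun p hp => eq_one_of_mem_pairGroup hker hu hp
      vertex_eq := ?_
      null := ?_
      timelike := ?_
      future := ?_
      integral := ?_ }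
  · intro i
    rw [hvec, h.lor_frameVec, Fin.sum_univ_three]
    revert i
    simp only [Family.Vertex]
    intro i
    fin_cases i <;> simp [tetSign] <;> norm_num
  · intro y
    obtain ⟨c, t, rfl⟩ := h.exists_eq_frameVec y
    refine ⟨ortho ![(c 0 + c 1 + c 2) / 4, (c 0 - c 1 - c 2) / 4, (-c 0 + c 1 - c 2) / 4,
      (-c 0 - c 1 + c 2) / 4] (t / 2), ?_⟩
    rw [hval]
    congr 1
    · funext k
      rw [Fin.sum_univ_four]
      fin_cases k <;> simp [tetSign] <;> ring
    · rw [Fin.sum_univ_four]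
      simp
      ring
  · intro S w hw
    obtain ⟨j, c, hq⟩ := hfacet S w hw
    exact lor_pos_of_embed_eq_smul hq (by rw [hqq]; exact one_pos)
  · intro S w hw
    obtain ⟨j, c, hq⟩ := hfacet S w hw
    -- The face opposite to vertex `j` lifts to the neighbouring orthoplex facet with only the
    -- `j`-th sign reversed; its dual vector is orthogonal to the kernel.
    refine ⟨refl (dualVec fun i => decide (i ≠ j)), ?_⟩
    rw [refl_eq_of_embed_eq_smul hq]
    refine refl_mem_pairGroup ?_ ?_ (by rw [hqq]; exact one_ne_zero) ?_
    · rw [dualVec_eq, hval]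
      congr 1
      · funext k
        rw [Fin.sum_univ_four]
        fin_cases j <;> fin_cases k <;> simp [tetSign] <;> norm_num
      · rw [Fin.sum_univ_four]
        fin_cases j <;> simp <;> norm_num
    · intro x
      obtain ⟨a, t, rfl⟩ := exists_eq_ortho x
      rw [hqq, lor_dualVec, hval, h.lor_frameVec]
      simp only [Fin.sum_univ_four, Fin.sum_univ_three]
      fin_cases j <;> simp [tetSign] <;> ring
    · rw [lor_dualVec, Fin.sum_univ_four]
      fin_cases j <;> simp <;> norm_num
  · intro p hp i j hij
    have h0 : ∀ k : Fin 4, lor (orthoVec (k, true)) (ortho (fun _ => 1) 2) = 0 := by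
      intro k
      rw [orthoVec_eq, lor_ortho]
      simp
    exact apply_eq_of_orthogonal hker hu hp (h0 i) (h0 j) hij
  · intro N hN
    obtain ⟨c, t, rfl⟩ := h.exists_eq_frameVec N
    rw [h.lor_frameVec, Fin.sum_univ_three] at hN
    simp only [hval, h.lor_frameVec, Fin.sum_univ_four, Fin.sum_univ_three]
    simp [tetSign]
    linear_combination 2 * hN
  · rw [hval, h.lor_frameVec]
    simp
  · rw [hval]
    simpa [frameVec] using hτ
  · rintro N - hN ⟨i, b⟩
    choose m hm using hN
    -- The difference of the two sides before applying `π` is the kernel vector `(1, 1, 1, 1; 2)`.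
    -- The negative vertices thus have integral curvature too.
    have h1 : π (orthoVec (i, false)) = ∑ j, π (orthoVec (j, true)) - π (orthoVec (i, true)) := by
      rw [← map_sum, ← map_sub]
      rw [Fin.sum_univ_four]
      simp only [orthoVec_eq, ortho_add, ortho_sub, hval]
      congr 1
      · funext k
        rw [Fin.sum_univ_four, Fin.sum_univ_four]
        fin_cases i <;> fin_cases k <;> simp [tetSign]
      · rw [Fin.sum_univ_four, Fin.sum_univ_four]
        fin_cases i <;> simp <;> norm_num
    cases b
    · refine ⟨∑ j, m j - m i, ?_⟩
      rw [h1, map_sub, map_sum, mul_sub, Finset.mul_sum]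
      push_cast
      rw [← hm i]
      congr 1
      exact Finset.sum_congr rfl fun j _ => hm j
    · exact ⟨m i, hm i⟩

/-- The vertex of the orthoplex corresponding to a vertex of the cube. -/
def cubeIndex (x : Fin 3 → Bool) : Fin 4 × Bool :=
  if x 0 = x 1 then (if x 1 = x 2 then (0, x 0) else (3, x 2))
  else if x 1 = x 2 then (1, x 0) else (2, x 1)

/-- The rows of `tetSign` are one of the two tetrahedra inscribed in the cube, and their negatives
are the other. -/
theorem sgn_cubeIndex : ∀ (x : Fin 3 → Bool) (k : Fin 3),
    sgn (cubeIndex x).2 * tetSign (cubeIndex x).1 k = sgn (x k) := by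
  decide

theorem cubeIndex_surjective : Function.Surjective cubeIndex := by
  decide

/-- A cubical frame provides a linear section. -/
def cubicalSection (h : IsFrame D τ 1 2) (hτ : 0 < τ.2.1)
    (Q : EdgeScribed 3 .cube) (scale : (Fin 3 → Bool) → ℝ) (hscale : ∀ i, 0 < scale i)
    (hvertex : ∀ x : Fin 3 → Bool, frameVec D τ (fun k => sgn (x k)) 1 =
      scale x • embed (Q.vertex x) 1)
    (hfacet : ∀ S w, IsFacetWithPolar Q.vertex S w → ∃ (i : Fin 3) (b : Bool) (c : ℝ),
      embed w 1 = c • frameVec D τ (Pi.single i (2 * sgn b)) 1) :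
    LinearSection Q := by
  -- The projection along the diagonal `(1, 1, 1, 1; 0)`. It doubles the form on the complement of
  -- the diagonal, and the vertices are not orthogonal to the diagonal, so their Gram matrix is not
  -- preserved; only curvatures and the group action are.
  set π : Lor 3 →ₗ[ℝ] Lor 2 := orthoLift (fun j => frameVec D τ (fun k => tetSign j k) 0)
    (frameVec D τ 0 1) with hπ
  have hval : ∀ a t, π (ortho a t) = frameVec D τ (fun k => ∑ j, a j * tetSign j k) t := by
    intro a t
    rw [hπ, orthoLift_ortho]
    simp only [Fin.sum_univ_four, smul_frameVec, frameVec_add]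
    congr 1
    · funext k; simp
    · ring
  have hvec : ∀ x, π (orthoVec (cubeIndex x)) = frameVec D τ (fun k => sgn (x k)) 1 := by
    intro x
    rw [orthoVec_eq, hval]
    congr 1
    funext k
    rw [← sgn_cubeIndex]
    simp
  have hker : ∀ x, π x = 0 → ∃ f : ℝ, x = f • ortho (fun _ => 1) 0 := by
    intro x hx
    obtain ⟨a, t, rfl⟩ := exists_eq_ortho x
    rw [hval] at hx
    obtain ⟨h1, h2⟩ := h.injective (c' := 0) (t' := 0) (by rw [hx]; simp [frameVec])
    have e0 := congrFun h1 0
    have e1 := congrFun h1 1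
    have e2 := congrFun h1 2
    simp [Fin.sum_univ_four, tetSign] at e0 e1 e2 h2
    refine ⟨a 0, ?_⟩
    rw [smul_ortho]
    congr 1
    · funext i
      fin_cases i <;> simp <;> linarith
    · linarith
  have hu : lor (ortho (fun _ => 1) 0) (ortho (fun _ => 1) 0) ≠ 0 := by
    rw [lor_ortho]; simp
  have hqq : ∀ (i : Fin 3) (b : Bool), lor (frameVec D τ (Pi.single i (2 * sgn b)) 1)
      (frameVec D τ (Pi.single i (2 * sgn b)) 1) = 2 := by
    intro i b
    have := sgn_sq b
    rw [h.lor_frameVec]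
    simp [Pi.single_apply]
    linarith
  refine
    { proj := π
      index := cubeIndex
      scale := scale
      scale_pos := hscale
      proj_index := fun i => (hvec i).trans (hvertex i)
      lor_proj_index := ?_
      group := pairGroup π (ortho (fun _ => 1) 0) False
      mem_orthoGroup := fun p hp => hp.1
      isIso := fun p hp => hp.2.1
      intertwine := fun p hp => hp.2.2.1
      surjective := ?_
      facet_pos := ?_
      facet_mem := ?_
      eq_one := fun p hp => eq_one_of_mem_pairGroup hker hu hp
      vertex_eq := ?_
      null := ?_
      timelike := ?_
      future := ?_
      integral := ?_ }
  · intro x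
    rw [hvec, h.lor_frameVec, Fin.sum_univ_three]
    simp only [← sq, sgn_sq]
    norm_num
  · intro y
    obtain ⟨c, t, rfl⟩ := h.exists_eq_frameVec y
    refine ⟨ortho ![(c 0 + c 1 + c 2) / 4, (c 0 - c 1 - c 2) / 4, (-c 0 + c 1 - c 2) / 4,
      (-c 0 - c 1 + c 2) / 4] t, ?_⟩
    rw [hval]
    congr 1
    funext k
    rw [Fin.sum_univ_four]
    fin_cases k <;> simp [tetSign] <;> ring
  · intro S w hw
    obtain ⟨j, b, c, hq⟩ := hfacet S w hw
    exact lor_pos_of_embed_eq_smul hq (by rw [hqq]; exact two_pos)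
  · intro S w hw
    obtain ⟨j, b, c, hq⟩ := hfacet S w hw
    -- The six faces correspond to the six sign vectors with two signs of each kind, the ones
    -- orthogonal to the diagonal.
    refine ⟨refl (dualVec fun i => if i = 0 ∨ i = j.succ then b else !b), ?_⟩
    rw [refl_eq_of_embed_eq_smul hq]
    refine refl_mem_pairGroup ?_ ?_ (by rw [hqq]; exact two_ne_zero) ?_
    · rw [dualVec_eq, hval]
      congr 1
      funext k
      rw [Fin.sum_univ_four]
      fin_cases j <;> fin_cases k <;> cases b <;> simp [tetSign] <;> norm_num
    · intro x
      obtain ⟨a, t, rfl⟩ := exists_eq_ortho x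
      rw [hqq, lor_dualVec, hval, h.lor_frameVec]
      simp only [Fin.sum_univ_four, Fin.sum_univ_three]
      fin_cases j <;> cases b <;> simp [tetSign] <;> ring
    · rw [lor_dualVec, Fin.sum_univ_four]
      fin_cases j <;> cases b <;> simp
  · intro p hp x y hxy
    -- The image is determined up to `f` times the diagonal. The product with the diagonal is
    -- invariant and equals `±2` on vertices, while the diagonal has square `8`, leaving `f = 0` or
    -- `±1/2`; integrality of the orbit excludes the latter.
    obtain ⟨f, hf⟩ := exists_eq_add_smul_of_mem_pairGroup hker hp hxy
    obtain ⟨a, b, h1, -⟩ := isLatticeVec_apply_orthoVec hp.1 (cubeIndex x)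
    have h2 : p.1 (ortho (fun _ => 1) 0) = ortho (fun _ => 1) 0 := by simpa using hp.2.2.2
    have h3 := isIso_of_mem_orthoGroup hp.1 (orthoVec (cubeIndex x)) (ortho (fun _ => 1) 0)
    rw [hf, h2, lor_add_left, lor_smul_left, orthoVec_eq, orthoVec_eq, lor_ortho, lor_ortho,
      lor_ortho] at h3
    rw [hf, orthoVec_eq, smul_ortho, ortho_add] at h1
    have h4 := congrFun (ortho_injective h1).1 0
    simp at h3 h4
    have hfz : ∃ n : ℤ, f = n := by
      refine ⟨a 0 - if 0 = (cubeIndex y).1 then sgn (cubeIndex y).2 else 0, ?_⟩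
      push_cast
      rw [← h4]
      simp
    obtain ⟨n, rfl⟩ := hfz
    have h5 : 2 * sgn (cubeIndex y).2 + n * 8 = 2 * sgn (cubeIndex x).2 := by
      have : (2 * sgn (cubeIndex y).2 + n * 8 : ℝ) = 2 * sgn (cubeIndex x).2 := by linarith
      exact_mod_cast this
    have h6 : n = 0 := by
      rcases Bool.eq_false_or_eq_true (cubeIndex y).2 with e | e <;>
      rcases Bool.eq_false_or_eq_true (cubeIndex x).2 with e' | e' <;>
      rw [e, e'] at h5 <;> simp at h5 <;> omega
    rw [hf, h6]
    simp
  · intro N hN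
    obtain ⟨c, t, rfl⟩ := h.exists_eq_frameVec N
    rw [h.lor_frameVec, Fin.sum_univ_three] at hN
    simp only [hval, h.lor_frameVec, Fin.sum_univ_four, Fin.sum_univ_three]
    simp [tetSign]
    linear_combination 4 * hN
  · rw [hval, h.lor_frameVec]
    simp
  · rw [hval]
    simpa [frameVec] using hτ
  · rintro N - hN x
    obtain ⟨y, rfl⟩ := cubeIndex_surjective x
    exact hN y

/-- An octahedral frame provides a linear section. -/
def octahedralSection (h : IsFrame D τ 2 1) (hτ : 0 < τ.2.1)
    (Q : EdgeScribed 3 .crossPolytope) (scale : Fin 3 × Bool → ℝ) (hscale : ∀ i, 0 < scale i)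
    (hvertex : ∀ x : Fin 3 × Bool, frameVec D τ (Pi.single x.1 (sgn x.2)) 1 =
      scale x • embed (Q.vertex x) 1)
    (hfacet : ∀ S w, IsFacetWithPolar Q.vertex S w → ∃ (s : Fin 3 → Bool) (c : ℝ),
      embed w 1 = c • frameVec D τ (fun k => sgn (s k)) 2) :
    LinearSection Q := by
  -- The orthogonal projection along the fourth axis, under which the equatorial vertices keep their
  -- products.
  set π : Lor 3 →ₗ[ℝ] Lor 2 := orthoLift (Fin.snoc D 0) τ with hπ
  have hval : ∀ a t, π (ortho a t) = frameVec D τ (fun k => a k.castSucc) t := by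
    intro a t
    rw [hπ, orthoLift_ortho, Fin.sum_univ_castSucc]
    simp only [Fin.snoc_castSucc, Fin.snoc_last, smul_zero, add_zero, frameVec]
  have hvec : ∀ x : Fin 3 × Bool, π (orthoVec (x.1.castSucc, x.2)) =
      frameVec D τ (Pi.single x.1 (sgn x.2)) 1 := by
    intro x
    rw [orthoVec_eq, hval]
    congr 1
    funext k
    simp [Pi.single_apply]
  set u : Lor 3 := ortho (Pi.single 3 1) 0 with hu0
  have hker : ∀ x, π x = 0 → ∃ f : ℝ, x = f • u := by
    intro x hx
    obtain ⟨a, t, rfl⟩ := exists_eq_ortho x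
    rw [hval] at hx
    obtain ⟨h1, h2⟩ := h.injective (c' := 0) (t' := 0) (by rw [hx]; simp [frameVec])
    refine ⟨a 3, ?_⟩
    rw [smul_ortho, h2]
    congr 1
    · funext i
      refine Fin.lastCases ?_ (fun k => ?_) i
      · simp [show Fin.last 3 = 3 from rfl]
      · have := congrFun h1 k
        have h3 : k.castSucc ≠ (3 : Fin 4) := (Fin.castSucc_lt_last k).ne
        simpa [h3] using this
    · simp
  have hu : lor u u ≠ 0 := by
    rw [lor_ortho]; simp [Fin.sum_univ_four]
  have hqq : ∀ s : Fin 3 → Bool, lor (frameVec D τ (fun k => sgn (s k)) 2)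
      (frameVec D τ (fun k => sgn (s k)) 2) = 2 := by
    intro s
    rw [h.lor_frameVec]
    simp only [← sq, sgn_sq]
    norm_num
  have hverteq : ∀ p ∈ pairGroup π u True, ∀ x y : Fin 3 × Bool,
      p.2 (π (orthoVec (x.1.castSucc, x.2))) = π (orthoVec (y.1.castSucc, y.2)) →
        p.1 (orthoVec (x.1.castSucc, x.2)) = orthoVec (y.1.castSucc, y.2) := by
    intro p hp x y hxy
    have h0 : ∀ x : Fin 3 × Bool, lor (orthoVec (x.1.castSucc, x.2)) u = 0 := by
      intro x
      have h3 : (3 : Fin 4) ≠ x.1.castSucc := (Fin.castSucc_lt_last x.1).ne'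
      rw [orthoVec_eq, lor_ortho]
      simp [Pi.single_apply, h3]
    exact apply_eq_of_orthogonal hker hu hp (h0 x) (h0 y) hxy
  refine
    { proj := π
      index := fun x => (x.1.castSucc, x.2)
      scale := scale
      scale_pos := hscale
      proj_index := fun i => (hvec i).trans (hvertex i)
      lor_proj_index := ?_
      group := pairGroup π u True
      mem_orthoGroup := fun p hp => hp.1
      isIso := fun p hp => hp.2.1
      intertwine := fun p hp => hp.2.2.1
      surjective := ?_
      facet_pos := ?_
      facet_mem := ?_
      eq_one := ?_
      vertex_eq := hverteq
      null := ?_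
      timelike := ?_
      future := ?_
      integral := ?_ }
  · intro x
    have := sgn_sq x.2
    rw [hvec, h.lor_frameVec]
    simp [Pi.single_apply]
    linarith
  · intro y
    obtain ⟨c, t, rfl⟩ := h.exists_eq_frameVec y
    refine ⟨ortho (Fin.snoc c 0) t, ?_⟩
    rw [hval]
    simp only [Fin.snoc_castSucc]
  · intro S w hw
    obtain ⟨s, c, hq⟩ := hfacet S w hw
    exact lor_pos_of_embed_eq_smul hq (by rw [hqq]; exact two_pos)
  · intro S w hw
    obtain ⟨s, c, hq⟩ := hfacet S w hw
    set e : Bool → Fin 4 → Bool := fun b => Fin.snoc s b with he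
    -- An equatorial triangle lies in two facets of the orthoplex. Neither dual vector is orthogonal
    -- to `u`, but they are orthogonal to each other and have the same image, proportional to the
    -- polar vector of the triangle. The product of their reflections sends `u` to `-u`, hence the
    -- flip.
    refine ⟨refl (dualVec (e true)) * refl (dualVec (e false)), ?_⟩
    rw [refl_eq_of_embed_eq_smul hq]
    have hd : ∀ b a t, lor (dualVec (e b)) (ortho a t) =
        ∑ k, sgn (s k) * a k.castSucc + sgn b * a 3 - t := by
      intro b a t
      rw [lor_dualVec, Fin.sum_univ_castSucc]
      simp only [he, Fin.snoc_castSucc, Fin.snoc_last]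
      rfl
    have hee : ∀ b a, lor (dualVec (e b)) (dualVec (e a)) = (1 + sgn b * sgn a) / 2 := by
      intro b a
      rw [dualVec_eq (e a), hd]
      have : ∀ k, (sgn (s k) : ℝ) * (sgn (s k) / 2) = 1 / 2 := fun k => by
        rw [← mul_div_assoc, ← sq, sgn_sq]
      have h3 : e a 3 = a := Fin.snoc_last (α := fun _ => Bool) a s
      simp only [he, Fin.snoc_castSucc, this] at h3 ⊢
      rw [h3]
      simp
      ring
    have hG : ∀ x, refl (dualVec (e true)) (refl (dualVec (e false)) x) =
        x - (2 * lor (dualVec (e true)) x) • dualVec (e true) -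
          (2 * lor (dualVec (e false)) x) • dualVec (e false) := by
      intro x
      rw [refl_apply, refl_apply]
      simp only [lor_sub_right, lor_smul_right, hee]
      simp
      abel
    have hπe : ∀ b, π (dualVec (e b)) = (1 / 2 : ℝ) • frameVec D τ (fun k => sgn (s k)) 2 := by
      intro b
      rw [dualVec_eq, hval, smul_frameVec]
      simp only [he, Fin.snoc_castSucc]
      congr 1
      · funext k; ring
      · norm_num
    refine ⟨mul_mem (refl_mem_orthoGroup _) (refl_mem_orthoGroup _), isIso_refl _, ?_, ?_⟩
    · intro x
      change π (refl (dualVec (e true)) (refl (dualVec (e false)) x)) = refl _ (π x)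
      obtain ⟨a, t, rfl⟩ := exists_eq_ortho x
      rw [hG, refl_apply, hqq]
      simp only [map_sub, map_smul, hπe, hd, hval, h.lor_frameVec, smul_smul]
      rw [sub_sub, ← add_smul]
      congr 2
      simp
      ring
    · right
      refine ⟨trivial, ?_⟩
      change refl (dualVec (e true)) (refl (dualVec (e false)) u) = -u
      have hcs : ∀ k : Fin 3, (Pi.single 3 1 : Fin 4 → ℝ) k.castSucc = 0 := by
        intro k
        have h3 : k.castSucc ≠ (3 : Fin 4) := (Fin.castSucc_lt_last k).ne
        simp [h3]
      rw [hG, hd, hd]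
      simp only [hcs]
      rw [dualVec_eq, dualVec_eq, smul_ortho, smul_ortho, hu0, ortho_sub, ortho_sub,
        ← neg_one_smul ℝ, smul_ortho]
      congr 1
      · funext i
        refine Fin.lastCases ?_ (fun k => ?_) i
        · have hs3 : ∀ b, (Fin.snoc s b : Fin 4 → Bool) 3 = b :=
            fun b => Fin.snoc_last (α := fun _ => Bool) b s
          simp [he, hs3]
          norm_num
        · simp [he, hcs]
      · simp
  · intro p hp h1
    have hfix : ∀ x : Fin 3 × Bool, p.1 (orthoVec (x.1.castSucc, x.2)) =
        orthoVec (x.1.castSucc, x.2) := fun x => hverteq p hp x x (by rw [h1]; rfl)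
    have hpole : ∀ b, orthoVec (3, b) =
        (1 / 2 : ℝ) • (orthoVec (0, true) + orthoVec (0, false)) + (sgn b : ℝ) • u := by
      intro b
      rw [hu0]
      simp only [orthoVec_eq, ortho_add, smul_ortho]
      congr 1
      · funext i
        fin_cases i <;> simp
      · simp; norm_num
    have h00 : ∀ b, p.1 (orthoVec (0, b)) = orthoVec (0, b) := fun b => hfix (0, b)
    -- If `u` were reversed while the equator is fixed, one pole would be moved to the other; but
    -- different vertices lie in different orbits.
    have hpu : p.1 u = u := by
      rcases hp.2.2.2 with h3 | ⟨-, h3⟩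
      · exact h3
      · have h4 : p.1 (orthoVec (3, true)) = orthoVec (3, false) := by
          rw [hpole, hpole, map_add, map_smul, map_smul, map_add, h00, h00, h3]
          simp
        exact absurd (eq_of_apply_orthoVec_eq hp.1 h4) (by simp)
    have h3 : ∀ b, p.1 (orthoVec (3, b)) = orthoVec (3, b) := by
      intro b
      rw [hpole, map_add, map_smul, map_smul, map_add, h00, h00, hpu]
    have hall : ∀ x, p.1 (orthoVec x) = orthoVec x := by
      rintro ⟨i, b⟩
      refine Fin.lastCases (h3 b) (fun k => ?_) i
      exact hfix (k, b)
    ext1 x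
    obtain ⟨a, t, rfl⟩ := exists_eq_ortho x
    have hx : ortho a t = ∑ i, (a i / 2) • (orthoVec (i, true) - orthoVec (i, false)) +
        (t / 2) • (orthoVec (0, true) + orthoVec (0, false)) := by
      simp only [Fin.sum_univ_four, orthoVec_eq, smul_ortho, ortho_add, ortho_sub]
      congr 1
      · funext i
        fin_cases i <;> simp <;> ring
      · ring
    rw [hx]
    simp only [map_add, map_sum, map_smul, map_sub, hall]
    rfl
  · intro N hN
    obtain ⟨c, t, rfl⟩ := h.exists_eq_frameVec N
    rw [h.lor_frameVec, Fin.sum_univ_three] at hN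
    simp only [hval, h.lor_frameVec, Fin.sum_univ_four, Fin.sum_univ_three]
    simp
    linear_combination 2 * hN
  · rw [hval, h.lor_frameVec]
    simp
  · rw [hval]
    simpa [frameVec] using hτ
  · rintro N hN hint ⟨i, b⟩
    revert b
    refine Fin.lastCases ?_ (fun k b => hint (k, b)) i
    intro b
    choose m hm using hint
    obtain ⟨c, t, rfl⟩ := h.exists_eq_frameVec N
    rw [h.lor_frameVec, Fin.sum_univ_three] at hN
    have hm' : ∀ x : Fin 3 × Bool, (m x : ℝ) = -4 * sgn x.2 * c x.1 + 2 * t := by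
      intro x
      rw [← hm, hvec, h.lor_frameVec]
      simp [Pi.single_apply]
      ring
    set σ : ℤ := m (0, true) + m (0, false) with hσ
    have hσt : (σ : ℝ) = 4 * t := by
      rw [hσ]; push_cast; rw [hm', hm']; simp; ring
    -- Both poles project to `τ` and have curvature `2 * t = σ / 2`, so `σ` must be shown even. This
    -- quadratic relation is the nullity of `N` in terms of the curvatures.
    have hsq : σ ^ 2 = 4 * (σ * (m (0, true) + m (1, true) + m (2, true)) -
        (m (0, true) ^ 2 + m (1, true) ^ 2 + m (2, true) ^ 2)) := by
      have : (σ : ℝ) ^ 2 = 4 * (σ * (m (0, true) + m (1, true) + m (2, true)) -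
          (m (0, true) ^ 2 + m (1, true) ^ 2 + m (2, true) ^ 2)) := by
        rw [hσt, hm', hm', hm']
        simp
        linear_combination 32 * hN
      exact_mod_cast this
    have heven : Even σ := by
      have : Even (σ ^ 2) := by
        rw [hsq]
        exact Even.mul_right (by decide) _
      exact (Int.even_pow.1 this).1
    obtain ⟨n, hn⟩ := heven
    refine ⟨n, ?_⟩
    have hnt : (n : ℝ) = 2 * t := by
      have : (σ : ℝ) = n + n := by exact_mod_cast hn
      linarith
    rw [orthoVec_eq, hval, h.lor_frameVec, hnt]
    have : ∀ k : Fin 3, k.castSucc ≠ (3 : Fin 4) := fun k => (Fin.castSucc_lt_last k).ne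
    simp [this]

/-! ### Edges and facets of edge-scribed polytopes -/

/-- The unit vector of the ball illuminated from `v`. -/
def unitVec {d : ℕ} (v : Euc (d + 1)) : Lor d :=
  (√(lor (embed v 1) (embed v 1)))⁻¹ • embed v 1

theorem lor_unitVec_self {d : ℕ} {v : Euc (d + 1)} (hv : 0 < lor (embed v 1) (embed v 1)) :
    lor (unitVec v) (unitVec v) = 1 := by
  rw [unitVec, lor_smul_left, lor_smul_right, ← mul_assoc, ← mul_inv, Real.mul_self_sqrt hv.le,
    inv_mul_cancel₀ hv.ne']

theorem scale_unitVec_pos {d : ℕ} {v : Euc (d + 1)} (hv : 0 < lor (embed v 1) (embed v 1)) :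
    0 < (√(lor (embed v 1) (embed v 1)))⁻¹ := by positivity

theorem time_unitVec_pos {d : ℕ} {v : Euc (d + 1)} (hv : 0 < lor (embed v 1) (embed v 1)) :
    0 < (unitVec v).2.1 + (unitVec v).2.2 := by
  have h : (unitVec v).2.1 + (unitVec v).2.2 = (√(lor (embed v 1) (embed v 1)))⁻¹ * 2 := by
    simp only [unitVec, embed, Prod.smul_snd, Prod.smul_fst, smul_eq_mul]
    ring
  rw [h]
  exact mul_pos (scale_unitVec_pos hv) two_pos

theorem lor_unitVec_right_eq_zero {d : ℕ} {v : Euc (d + 1)} {x : Lor d}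
    (h : lor x (embed v 1) = 0) : lor x (unitVec v) = 0 := by
  rw [unitVec, lor_smul_right, h, mul_zero]

theorem lor_unitVec_right_neg {d : ℕ} {v : Euc (d + 1)} {x : Lor d}
    (hv : 0 < lor (embed v 1) (embed v 1)) (h : lor x (embed v 1) < 0) :
    lor x (unitVec v) < 0 := by
  rw [unitVec, lor_smul_right]
  exact mul_neg_of_pos_of_neg (scale_unitVec_pos hv) h

/-- The average of two polar vectors supports the polytope exactly along the common part of the two
facets. -/
theorem IsFacetWithPolar.isEdge {n : ℕ} {V : Type} {v : V → Euc n} {S S' : Set V} {w w' : Euc n}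
    (h : IsFacetWithPolar v S w) (h' : IsFacetWithPolar v S' w') {i j : V} (hij : i ≠ j)
    (hS : ∀ k, k ∈ S ∧ k ∈ S' ↔ k = i ∨ k = j) : IsEdge v i j := by
  refine ⟨hij, (1 / 2 : ℝ) • (w + w'), ?_, ?_⟩
  · intro k
    rw [real_inner_smul_left, inner_add_left]
    linarith [h.1.1 k, h'.1.1 k]
  · ext k
    have h1 := h.1.1 k
    have h2 := h'.1.1 k
    have h3 : k ∈ S ↔ inner ℝ w (v k) = 1 := by rw [← h.1.2]; rfl
    have h4 : k ∈ S' ↔ inner ℝ w' (v k) = 1 := by rw [← h'.1.2]; rfl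
    change inner ℝ ((1 / 2 : ℝ) • (w + w')) (v k) = 1 ↔ k = i ∨ k = j
    rw [← hS, h3, h4, real_inner_smul_left, inner_add_left]
    constructor
    · intro h; constructor <;> linarith
    · rintro ⟨h, h'⟩; linarith

theorem IsFacetWithPolar.lor_eq_zero {d : ℕ} {V : Type} {v : V → Euc (d + 1)} {S : Set V}
    {w : Euc (d + 1)} (h : IsFacetWithPolar v S w) {i : V} (hi : i ∈ S) :
    lor (embed w 1) (embed (v i) 1) = 0 := by
  rw [← h.1.2] at hi
  rw [lor_embed, show inner ℝ w (v i) = 1 from hi]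
  norm_num

theorem IsFacetWithPolar.lor_neg {d : ℕ} {V : Type} {v : V → Euc (d + 1)} {S : Set V}
    {w : Euc (d + 1)} (h : IsFacetWithPolar v S w) {i : V} (hi : i ∉ S) :
    lor (embed w 1) (embed (v i) 1) < 0 := by
  rw [← h.1.2] at hi
  have := lt_of_le_of_ne (h.1.1 i) hi
  rw [lor_embed]
  linarith

/-- If `x = (q, t)`, then `q - t • w` is orthogonal to the vertices of the facet, which span the
space, so it vanishes. -/
theorem IsFacetWithPolar.exists_eq_smul {d : ℕ} {V : Type} {v : V → Euc (d + 1)} {S : Set V}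
    {w : Euc (d + 1)} (h : IsFacetWithPolar v S w) {x : Lor d}
    (hx : ∀ i ∈ S, lor x (embed (v i) 1) = 0) : ∃ c : ℝ, x = c • embed w 1 := by
  obtain ⟨q, t, rfl⟩ := exists_eq_embed x
  have h1 : Submodule.span ℝ (v '' S) ≤ LinearMap.ker (innerSL ℝ (q - t • w)).toLinearMap := by
    rw [Submodule.span_le]
    rintro _ ⟨i, hi, rfl⟩
    have h2 := hx i hi
    rw [← h.1.2] at hi
    rw [lor_embed] at h2
    change inner ℝ (q - t • w) (v i) = 0
    rw [inner_sub_left, real_inner_smul_left, show inner ℝ w (v i) = 1 from hi]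
    linarith
  rw [h.2] at h1
  have h2 : inner ℝ (q - t • w) (q - t • w) = (0 : ℝ) := h1 (Submodule.mem_top)
  rw [inner_self_eq_zero, sub_eq_zero] at h2
  exact ⟨t, by rw [smul_embed, h2, mul_one]⟩

theorem IsFacetWithPolar.exists_embed_eq_smul {d : ℕ} {V : Type} {v : V → Euc (d + 1)}
    {S : Set V} {w : Euc (d + 1)} (h : IsFacetWithPolar v S w)
    (hpos : ∀ i, 0 < lor (embed (v i) 1) (embed (v i) 1)) {x : Lor d} (hx0 : x ≠ 0)
    (hx : ∀ i ∈ S, lor x (unitVec (v i)) = 0) : ∃ c : ℝ, embed w 1 = c • x := by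
  obtain ⟨c, hc⟩ := h.exists_eq_smul (x := x) (fun i hi => by
    have := hx i hi
    rw [unitVec, lor_smul_right, mul_eq_zero] at this
    exact this.resolve_left (scale_unitVec_pos (hpos i)).ne')
  have hc0 : c ≠ 0 := by
    rintro rfl
    exact hx0 (by rw [hc, zero_smul])
  exact ⟨c⁻¹, by rw [hc, smul_smul, inv_mul_cancel₀ hc0, one_smul]⟩

namespace EdgeScribed

variable {K : Family} {d : ℕ} (Q : EdgeScribed (d + 1) K)

theorem exists_polar {S : Set (K.Vertex (d + 1))} (hS : S ∈ K.facets (d + 1)) :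
    ∃ w, IsFacetWithPolar Q.vertex S w := by
  rw [← Q.facets_eq] at hS
  exact hS

theorem mem_facets {S : Set (K.Vertex (d + 1))} {w : Euc (d + 1)}
    (h : IsFacetWithPolar Q.vertex S w) : S ∈ K.facets (d + 1) := by
  rw [← Q.facets_eq]
  exact ⟨w, h⟩

/-- Both end points have product `1` with the tangency point `p`. Writing `p` as a convex
combination of them gives `(A - 1) * (B - 1) = (1 - C) ^ 2` with `1 - C` positive, that is, tangency
of the two balls. -/
theorem edge_gram {i j : K.Vertex (d + 1)} (h : IsEdge Q.vertex i j) :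
    0 < lor (embed (Q.vertex i) 1) (embed (Q.vertex i) 1) ∧
      lor (unitVec (Q.vertex i)) (unitVec (Q.vertex j)) = -1 := by
  obtain ⟨p, ⟨a, b, ha, hb, hab, rfl⟩, hp, hpo⟩ := Q.edge_tangent i j h
  have hne : Q.vertex i - Q.vertex j ≠ 0 :=
    sub_ne_zero.2 fun e => h.1 (Q.convexIndependent.injective e)
  have h1 := real_inner_self_eq_norm_sq (a • Q.vertex i + b • Q.vertex j)
  have h2 := real_inner_self_nonneg.lt_of_ne' (inner_self_ne_zero (𝕜 := ℝ).2 hne)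
  rw [hp] at h1
  simp only [inner_add_left, inner_add_right, inner_sub_left, inner_sub_right,
    real_inner_smul_left, real_inner_smul_right,
    real_inner_comm (Q.vertex i) (Q.vertex j)] at h1 h2 hpo
  simp only [unitVec, lor_smul_left, lor_smul_right, lor_embed]
  set A : ℝ := inner ℝ (Q.vertex i) (Q.vertex i)
  set B : ℝ := inner ℝ (Q.vertex j) (Q.vertex j)
  set C : ℝ := inner ℝ (Q.vertex i) (Q.vertex j)
  obtain rfl : b = 1 - a := by linarith
  have e1 : a * A + (1 - a) * C = 1 := by linear_combination h1 - (1 - a) * hpo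
  have e2 : a * C + (1 - a) * B = 1 := by linear_combination h1 + a * hpo
  have f1 : A - 1 = (1 - a) / a * (1 - C) := by field_simp; linarith
  have f2 : B - 1 = a / (1 - a) * (1 - C) := by field_simp; linarith
  have hC : 0 < 1 - C := by
    have h3 : (1 - C) * ((1 - a) / a + a / (1 - a) + 2) = A - C - (C - B) := by
      linear_combination -f1 - f2
    have h4 : 0 < (1 - a) / a + a / (1 - a) + 2 := by positivity
    refine pos_of_mul_pos_left ?_ h4.le
    linarith
  have hA : 0 < A - 1 := by rw [f1]; positivity
  refine ⟨by linarith, ?_⟩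
  rw [show (1 : ℝ) * 1 = 1 by norm_num]
  have h5 : √(A - 1) * √(B - 1) = 1 - C := by
    rw [← Real.sqrt_mul hA.le, f1, f2, Real.sqrt_eq_iff_mul_self_eq (by positivity) hC.le]
    field_simp
  rw [← mul_assoc, ← mul_inv, mul_comm, mul_comm √(B - 1), h5]
  have : 1 - C ≠ 0 := hC.ne'
  field_simp
  ring

end EdgeScribed

/-! ### Tetrahedra -/

/-- The sign vectors in `tetSign` together with the constant vector form a `4 × 4` Hadamard matrix;
it diagonalizes this Gram matrix and inverts with the factor `1 / 4`. -/
theorem exists_tetrahedral_frame {U : Fin 4 → Lor 2} (h1 : ∀ i, lor (U i) (U i) = 1)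
    (h2 : ∀ i j, i ≠ j → lor (U i) (U j) = -1) :
    ∃ D τ, IsFrame D τ (1 / 2) (1 / 2) ∧ τ = (1 / 4 : ℝ) • ∑ i, U i ∧
      ∀ i, U i = frameVec D τ (fun k => tetSign i k) 1 := by
  have hg : ∀ a b : Fin 4 → ℝ, lor (∑ i, a i • U i) (∑ i, b i • U i) =
      2 * ∑ i, a i * b i - (∑ i, a i) * ∑ i, b i := by
    intro a b
    have h3 : ∀ i j, lor (U i) (U j) = if i = j then 1 else -1 := by
      intro i j
      split_ifs with h
      · rw [h, h1]
      · exact h2 i j h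
    simp only [Fin.sum_univ_four, lor_add_left, lor_add_right, lor_smul_left, lor_smul_right, h3]
    simp
    ring
  have hD : ∀ k : Fin 3, (1 / 4 : ℝ) • ∑ i, (tetSign i k : ℝ) • U i =
      ∑ i, (1 / 4 * tetSign i k : ℝ) • U i := by
    intro k
    simp only [Finset.smul_sum, smul_smul]
  have hτ : (1 / 4 : ℝ) • ∑ i, U i = ∑ i, (1 / 4 : ℝ) • U i := Finset.smul_sum
  refine ⟨fun k => (1 / 4 : ℝ) • ∑ i, (tetSign i k : ℝ) • U i, (1 / 4 : ℝ) • ∑ i, U i,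
    ⟨?_, ?_, ?_, by norm_num, by norm_num⟩, rfl, ?_⟩
  · intro k l
    rw [hD, hD, hg]
    simp only [Fin.sum_univ_four]
    fin_cases k <;> fin_cases l <;> simp [tetSign] <;> norm_num
  · intro k
    rw [hD, hτ, hg]
    simp only [Fin.sum_univ_four]
    fin_cases k <;> simp [tetSign]
  · rw [hτ, hg]
    simp only [Fin.sum_univ_four]
    norm_num
  · intro i
    simp only [frameVec, Fin.sum_univ_four, Fin.sum_univ_three]
    fin_cases i <;> simp [tetSign] <;> module

theorem exists_simplex_facets : ∀ i j : Fin 4, i ≠ j →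
    ∃ k l, ∀ m, (m ≠ k ∧ m ≠ l) ↔ (m = i ∨ m = j) := by
  decide

theorem nonempty_linearSection_simplex (Q : EdgeScribed 3 .simplex) :
    Nonempty (LinearSection Q) := by
  have hfacets : ∀ k : Fin 4, ∃ w, IsFacetWithPolar Q.vertex ({k}ᶜ : Set (Fin 4)) w :=
    fun k => Q.exists_polar ⟨k, rfl⟩
  have hedge : ∀ i j : Fin 4, i ≠ j → IsEdge Q.vertex i j := by
    intro i j hij
    obtain ⟨k, l, hkl⟩ := exists_simplex_facets i j hij
    obtain ⟨w, hw⟩ := hfacets k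
    obtain ⟨w', hw'⟩ := hfacets l
    exact hw.isEdge hw' hij hkl
  have hpos : ∀ i : Fin 4, 0 < lor (embed (Q.vertex i) 1) (embed (Q.vertex i) 1) := by
    intro i
    exact (Q.edge_gram (hedge i (i + 1) (by fin_cases i <;> decide))).1
  obtain ⟨D, τ, hfr, hτ, hU⟩ := exists_tetrahedral_frame (U := fun i => unitVec (Q.vertex i))
    (fun i => lor_unitVec_self (hpos i)) (fun i j hij => (Q.edge_gram (hedge i j hij)).2)
  refine ⟨tetrahedralSection hfr ?_ Q _ (fun i => scale_unitVec_pos (hpos i))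
    (fun i => (hU i).symm) ?_⟩
  · refine coord_pos_of_timelike ?_ (by rw [hfr.lor_time]; norm_num)
    rw [hτ, Fin.sum_univ_four]
    simp only [Prod.smul_snd, Prod.smul_fst, Prod.snd_add, Prod.fst_add, smul_eq_mul]
    have h0 := time_unitVec_pos (hpos 0)
    have h1 := time_unitVec_pos (hpos 1)
    have h2 := time_unitVec_pos (hpos 2)
    have h3 := time_unitVec_pos (hpos 3)
    linarith
  · intro S w hw
    obtain ⟨j, rfl⟩ := Q.mem_facets hw
    refine ⟨j, hw.exists_embed_eq_smul hpos ?_ ?_⟩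
    · intro h0
      have h1 := hfr.lor_frameVec (fun k => -tetSign j k) (fun k => -tetSign j k) 1 1
      rw [h0, map_zero, Fin.sum_univ_three] at h1
      revert h1
      change Fin 4 at j
      fin_cases j <;> simp [tetSign] <;> norm_num
    · intro i hi
      have hij : i ≠ j := hi
      have h1 : unitVec (Q.vertex i) = _ := hU i
      rw [h1, hfr.lor_frameVec, Fin.sum_univ_three]
      revert hij
      clear h1 hi hw
      change Fin 4 at i
      change Fin 4 at j
      fin_cases i <;> fin_cases j <;> simp [tetSign]

/-! ### Octahedra -/

/-- The differences of antipodal vectors are mutually orthogonal and orthogonal to all the sums; by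
`h3` they are not null. Only one dimension remains for the three sums, and since any two of them
have product `-4` they coincide. -/
theorem exists_octahedral_frame {U : Fin 3 × Bool → Lor 2} (h1 : ∀ x, lor (U x) (U x) = 1)
    (h2 : ∀ x y, x.1 ≠ y.1 → lor (U x) (U y) = -1)
    (h3 : ∀ i, lor (U (i, true)) (U (i, false)) ≠ 1) :
    ∃ D τ, IsFrame D τ 2 1 ∧ τ = (1 / 2 : ℝ) • (U (0, true) + U (0, false)) ∧
      ∀ x, U x = frameVec D τ (Pi.single x.1 (sgn x.2)) 1 := by
  set d : Fin 3 → Lor 2 := fun i => U (i, true) - U (i, false) with hd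
  set s : Fin 3 → Lor 2 := fun i => U (i, true) + U (i, false) with hs
  have hdd : ∀ i, lor (d i) (d i) = 2 - 2 * lor (U (i, true)) (U (i, false)) := by
    intro i
    simp only [hd, lor_sub_left, lor_sub_right, h1, lor_comm (U (i, false)) (U (i, true))]
    ring
  have hdd' : ∀ i j, i ≠ j → lor (d i) (d j) = 0 := by
    intro i j hij
    simp only [hd, lor_sub_left, lor_sub_right]
    rw [h2 _ _ hij, h2 _ _ hij, h2 _ _ hij, h2 _ _ hij]
    ring
  have hds : ∀ i j, lor (d i) (s j) = 0 := by
    intro i j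
    simp only [hd, hs, lor_sub_left, lor_add_right]
    by_cases hij : i = j
    · subst hij
      rw [h1, h1, lor_comm (U (i, false)) (U (i, true))]
      ring
    · rw [h2 _ _ hij, h2 _ _ hij, h2 _ _ hij, h2 _ _ hij]
      ring
  have hss : ∀ i j, i ≠ j → lor (s i) (s j) = -4 := by
    intro i j hij
    simp only [hs, lor_add_left, lor_add_right]
    rw [h2 _ _ hij, h2 _ _ hij, h2 _ _ hij, h2 _ _ hij]
    ring
  have hss' : ∀ i, lor (s i) (s i) = 2 + 2 * lor (U (i, true)) (U (i, false)) := by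
    intro i
    simp only [hs, lor_add_left, lor_add_right, h1, lor_comm (U (i, false)) (U (i, true))]
    ring
  have hseq : ∀ i j, s i = s j := by
    intro i j
    by_cases hij : i = j
    · rw [hij]
    obtain ⟨k, hki, hkj⟩ : ∃ k, k ≠ i ∧ k ≠ j := by
      revert i j; decide
    -- Five vectors in dimension four. Pairing a relation with the differences kills their
    -- coefficients, and pairing it with the third sum makes the other two opposite.
    have hdep : ¬ LinearIndependent ℝ ![d 0, d 1, d 2, s i, s j] := by
      intro hli
      have := hli.fintype_card_le_finrank
      rw [finrank_lor_two] at this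
      simp at this
    rw [Fintype.not_linearIndependent_iff] at hdep
    obtain ⟨g, hg, m, hm⟩ := hdep
    simp only [Fin.sum_univ_five] at hg
    simp at hg
    have hgd : ∀ l, lor (d l) (g 0 • d 0 + g 1 • d 1 + g 2 • d 2 + g 3 • s i + g 4 • s j) = 0 := by
      intro l; rw [hg, map_zero]
    have hne : ∀ l, lor (d l) (d l) ≠ 0 := by
      intro l
      rw [hdd]
      intro h
      exact h3 l (by linarith)
    have g0 : g 0 = 0 := by
      have := hgd 0
      simp only [lor_add_right, lor_smul_right, hds] at this
      rw [hdd' 0 1 (by decide), hdd' 0 2 (by decide)] at this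
      simpa [hne] using this
    have g1 : g 1 = 0 := by
      have := hgd 1
      simp only [lor_add_right, lor_smul_right, hds] at this
      rw [hdd' 1 0 (by decide), hdd' 1 2 (by decide)] at this
      simpa [hne] using this
    have g2 : g 2 = 0 := by
      have := hgd 2
      simp only [lor_add_right, lor_smul_right, hds] at this
      rw [hdd' 2 0 (by decide), hdd' 2 1 (by decide)] at this
      simpa [hne] using this
    rw [g0, g1, g2, zero_smul, zero_smul, zero_smul, zero_add, zero_add, zero_add] at hg
    have hgs : lor (s k) (g 3 • s i + g 4 • s j) = 0 := by rw [hg, map_zero]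
    rw [lor_add_right, lor_smul_right, lor_smul_right, hss _ _ hki, hss _ _ hkj] at hgs
    have g4 : g 4 = -g 3 := by linarith
    have g3 : g 3 ≠ 0 := by
      intro h
      apply hm
      rw [h, neg_zero] at g4
      fin_cases m <;> assumption
    rw [g4, neg_smul, ← sub_eq_add_neg, ← smul_sub, smul_eq_zero, or_iff_right g3,
      sub_eq_zero] at hg
    exact hg
  have hx : ∀ i, lor (U (i, true)) (U (i, false)) = -3 := by
    intro i
    have h4 : lor (s i) (s i) = -4 := by
      have := hss i (i + 1) (by fin_cases i <;> decide)
      rwa [hseq (i + 1) i] at this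
    rw [hss'] at h4
    linarith
  refine ⟨fun i => (1 / 2 : ℝ) • d i, (1 / 2 : ℝ) • s 0, ⟨?_, ?_, ?_, two_pos, one_pos⟩, rfl, ?_⟩
  · intro i j
    rw [lor_smul_left, lor_smul_right]
    split_ifs with hij
    · rw [hij, hdd, hx]; norm_num
    · rw [hdd' _ _ hij]; norm_num
  · intro i
    rw [lor_smul_left, lor_smul_right, hds]; norm_num
  · rw [lor_smul_left, lor_smul_right, hss', hx]; norm_num
  · rintro ⟨i, b⟩
    have h4 : ∑ k, (Pi.single i (sgn b : ℝ) : Fin 3 → ℝ) k • (1 / 2 : ℝ) • d k =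
        (sgn b : ℝ) • (1 / 2 : ℝ) • d i := by
      rw [Finset.sum_eq_single i]
      · simp
      · intro k _ hk; simp [hk]
      · simp
    rw [frameVec, h4, hseq 0 i]
    simp only [hs, hd]
    cases b <;> simp <;> module

theorem octahedron_facets (x y z : Fin 3 × Bool) (hxy : x.1 ≠ y.1) :
    (z.2 = (if z.1 = x.1 then x.2 else if z.1 = y.1 then y.2 else true) ∧
      z.2 = (if z.1 = x.1 then x.2 else if z.1 = y.1 then y.2 else false)) ↔ (z = x ∨ z = y) := by
  revert x y z
  decide

theorem nonempty_linearSection_crossPolytope (Q : EdgeScribed 3 .crossPolytope) :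
    Nonempty (LinearSection Q) := by
  have hfacets : ∀ s : Fin 3 → Bool,
      ∃ w, IsFacetWithPolar Q.vertex {x : Fin 3 × Bool | x.2 = s x.1} w :=
    fun s => Q.exists_polar ⟨s, rfl⟩
  have hedge : ∀ x y : Fin 3 × Bool, x.1 ≠ y.1 → IsEdge Q.vertex x y := by
    intro x y hxy
    obtain ⟨w, hw⟩ := hfacets fun k => if k = x.1 then x.2 else if k = y.1 then y.2 else true
    obtain ⟨w', hw'⟩ := hfacets fun k => if k = x.1 then x.2 else if k = y.1 then y.2 else false
    exact hw.isEdge hw' (fun e => hxy (congrArg Prod.fst e)) fun z => octahedron_facets x y z hxy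
  have hpos : ∀ x : Fin 3 × Bool, 0 < lor (embed (Q.vertex x) 1) (embed (Q.vertex x) 1) := by
    rintro ⟨i, b⟩
    exact (Q.edge_gram (hedge (i, b) (i + 1, b) (by fin_cases i <;> simp))).1
  have hgram : ∀ x y : Fin 3 × Bool, x.1 ≠ y.1 →
      lor (unitVec (Q.vertex x)) (unitVec (Q.vertex y)) = -1 :=
    fun x y hxy => (Q.edge_gram (hedge x y hxy)).2
  obtain ⟨D, τ, hfr, hτ, hU⟩ := exists_octahedral_frame
    (U := fun x : Fin 3 × Bool => unitVec (Q.vertex x))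
    (fun x => lor_unitVec_self (hpos x)) hgram (by
      intro i h
      obtain ⟨w, hw⟩ := hfacets fun _ => true
      have hmem : ((i, true) : Fin 3 × Bool) ∈ {x : Fin 3 × Bool | x.2 = true} := rfl
      have hnmem : ((i, false) : Fin 3 × Bool) ∉ {x : Fin 3 × Bool | x.2 = true} := by simp
      have e1 := lor_unitVec_right_eq_zero (hw.lor_eq_zero hmem)
      have e2 := lor_unitVec_right_neg (hpos _) (hw.lor_neg hnmem)
      -- If the product were `1`, the difference would be orthogonal to the whole facet of positive
      -- vertices, hence proportional to its polar vector. Then the polar vector would be orthogonal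
      -- to the negative vertex, which is off the facet.
      by_cases h0 : unitVec (Q.vertex (i, true)) - unitVec (Q.vertex (i, false)) = 0
      · rw [sub_eq_zero.1 h0] at e1
        exact e2.ne e1
      obtain ⟨c, hc⟩ := hw.exists_embed_eq_smul hpos h0 (by
        rintro ⟨j, b⟩ hb
        obtain rfl : b = true := hb
        rw [lor_sub_left]
        by_cases hij : i = j
        · subst hij
          rw [lor_unitVec_self (hpos _), lor_comm, h, sub_self]
        · rw [hgram _ _ hij, hgram _ _ hij, sub_self])
      rw [hc, lor_smul_left, lor_sub_left, lor_unitVec_self (hpos _), h, sub_self, mul_zero] at e2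
      exact lt_irrefl _ e2)
  refine ⟨octahedralSection hfr ?_ Q _ (fun i => scale_unitVec_pos (hpos i))
    (fun i => (hU i).symm) ?_⟩
  · refine coord_pos_of_timelike ?_ (by rw [hfr.lor_time]; norm_num)
    rw [hτ]
    simp only [Prod.smul_snd, Prod.smul_fst, Prod.snd_add, Prod.fst_add, smul_eq_mul]
    have h0 := time_unitVec_pos (hpos (0, true))
    have h1 := time_unitVec_pos (hpos (0, false))
    linarith
  · intro S w hw
    obtain ⟨s, rfl⟩ := Q.mem_facets hw
    refine ⟨s, hw.exists_embed_eq_smul hpos ?_ ?_⟩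
    · intro h0
      have h1 := hfr.lor_frameVec (fun k => sgn (s k)) (fun k => sgn (s k)) 2 2
      rw [h0, map_zero] at h1
      simp only [← sq, sgn_sq] at h1
      norm_num at h1
    · rintro ⟨i, b⟩ hb
      obtain rfl : b = s i := hb
      have h1 : unitVec (Q.vertex (i, s i)) = _ := hU (i, s i)
      have h2 := sgn_sq (s i)
      rw [h1, hfr.lor_frameVec]
      simp [Pi.single_apply]
      linarith

/-! ### Cubes -/

/-- In a quadrangle all of whose consecutive vertices are tangent, opposite vertices have negative
product, and a linear functional vanishing at three vertices vanishes at the fourth. -/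
theorem quadrangle {V₀ V₁ V₂ V₃ W A B C D : Lor 2} (hW : lor W ≠ 0)
    (w₀ : lor W V₀ = 0) (w₁ : lor W V₁ = 0) (w₂ : lor W V₂ = 0) (w₃ : lor W V₃ = 0)
    (h₀₀ : lor V₀ V₀ = 1) (h₀₁ : lor V₀ V₁ = -1) (h₀₃ : lor V₀ V₃ = -1)
    (a₀ : lor A V₀ = 0) (a₁ : lor A V₁ = 0) (a₂ : lor A V₂ < 0) (a₃ : lor A V₃ < 0)
    (b₁ : lor B V₁ = 0) (b₂ : lor B V₂ = 0) (b₃ : lor B V₃ < 0) (b₀ : lor B V₀ < 0)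
    (c₂ : lor C V₂ = 0) (c₃ : lor C V₃ = 0) (c₀ : lor C V₀ < 0) (c₁ : lor C V₁ < 0)
    (d₃ : lor D V₃ = 0) (d₀ : lor D V₀ = 0) (d₁ : lor D V₁ < 0) (d₂ : lor D V₂ < 0) :
    lor V₀ V₂ < 0 ∧ ∀ x, lor x V₀ = 0 → lor x V₁ = 0 → lor x V₃ = 0 → lor x V₂ = 0 := by
  -- The four vectors lie in the hyperplane orthogonal to `W`. Each of `A`, `B`, `C`, `D` vanishes
  -- on one side of the quadrangle and is negative on the opposite one, so the coefficients of a
  -- relation are nonzero and alternate in sign around it.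
  have hdep : ¬ LinearIndependent ℝ ![V₀, V₁, V₂, V₃] := by
    intro hli
    have htop := hli.span_eq_top_of_card_eq_finrank (by rw [finrank_lor_two]; rfl)
    have hle : Submodule.span ℝ (range ![V₀, V₁, V₂, V₃]) ≤ LinearMap.ker (lor W) := by
      rw [Submodule.span_le]
      rintro _ ⟨i, rfl⟩
      change lor W _ = 0
      fin_cases i <;> assumption
    rw [htop, top_le_iff, LinearMap.ker_eq_top] at hle
    exact hW hle
  rw [Fintype.not_linearIndependent_iff] at hdep
  obtain ⟨g, hg, m, hm⟩ := hdep
  simp only [Fin.sum_univ_four] at hg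
  simp at hg
  have hlor : ∀ x, g 0 * lor x V₀ + g 1 * lor x V₁ + g 2 * lor x V₂ + g 3 * lor x V₃ = 0 := by
    intro x
    have := congrArg (lor x) hg
    simpa [lor_add_right] using this
  have hA := hlor A
  have hB := hlor B
  have hC := hlor C
  have hD := hlor D
  rw [a₀, a₁] at hA
  rw [b₁, b₂] at hB
  rw [c₂, c₃] at hC
  rw [d₃, d₀] at hD
  have key : ∀ {p q s t : ℝ}, s < 0 → t < 0 → p * s + q * t = 0 → p ≠ 0 → p * q < 0 := by
    intro p q s t hs ht h hp
    have h1 : p * q * t = -(p ^ 2 * s) := by linear_combination p * h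
    have h2 : 0 < p * q * t := by
      rw [h1]
      have := mul_pos (pow_pos (abs_pos.2 hp) 2) (neg_pos.2 hs)
      rw [sq_abs] at this
      linarith
    nlinarith
  have key0 : ∀ {p q s t : ℝ}, s < 0 → t < 0 → p * s + q * t = 0 → p = 0 → q = 0 := by
    intro p q s t hs ht h hp
    rw [hp, zero_mul, zero_add, mul_eq_zero] at h
    exact h.resolve_right ht.ne
  have e01 : g 0 * lor C V₀ + g 1 * lor C V₁ = 0 := by linarith
  have e12 : g 1 * lor D V₁ + g 2 * lor D V₂ = 0 := by linarith
  have e23 : g 2 * lor A V₂ + g 3 * lor A V₃ = 0 := by linarith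
  have g0 : g 0 ≠ 0 := by
    intro h0
    have h1 := key0 c₀ c₁ e01 h0
    have h2 := key0 d₁ d₂ e12 h1
    have h3 := key0 a₂ a₃ e23 h2
    apply hm
    fin_cases m <;> assumption
  have g01 := key c₀ c₁ e01 g0
  have g1 : g 1 ≠ 0 := by rintro h; rw [h] at g01; linarith
  have g12 := key d₁ d₂ e12 g1
  have g2 : g 2 ≠ 0 := by rintro h; rw [h] at g12; linarith
  have g03 : g 0 * g 3 < 0 := key b₀ b₃ (by linarith) g0
  have g02 : 0 < g 0 * g 2 := by
    have h1 : 0 < (g 0 * g 1) * (g 1 * g 2) := mul_pos_of_neg_of_neg g01 g12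
    have h2 : (g 0 * g 1) * (g 1 * g 2) = g 1 ^ 2 * (g 0 * g 2) := by ring
    rw [h2] at h1
    exact pos_of_mul_pos_right h1 (sq_nonneg _)
  constructor
  · have h := hlor V₀
    rw [h₀₀, h₀₁, h₀₃] at h
    have h1 : (g 0 * g 2) * lor V₀ V₂ = -(g 0 ^ 2) + g 0 * g 1 + g 0 * g 3 := by
      linear_combination g 0 * h
    have h2 := sq_nonneg (g 0)
    by_contra! hc
    nlinarith [mul_nonneg g02.le hc]
  · intro x x0 x1 x3
    have h := hlor x
    rw [x0, x1, x3] at h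
    simpa [g2] using h

theorem lor_embed_one_ne_zero {d : ℕ} (w : Euc (d + 1)) : lor (embed w 1) ≠ 0 := by
  intro h
  have h1 : lor (embed w 1) (embed 0 1) = 0 := by rw [h]; rfl
  rw [lor_embed] at h1
  norm_num at h1

/-- Two polar vectors of facets sharing an edge. -/
theorem adjacent_polar {V₁ V₂ R R' : Lor 2} {w w' : Euc 3} (h₁₁ : lor V₁ V₁ = 1)
    (h₂₂ : lor V₂ V₂ = 1) (h₁₂ : lor V₁ V₂ = -1)
    (t₁ : 0 < V₁.2.1 + V₁.2.2) (t₂ : 0 < V₂.2.1 + V₂.2.2)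
    (w₁ : lor (embed w 1) V₁ = 0) (w₂ : lor (embed w 1) V₂ = 0) (wR : lor (embed w 1) R = 0)
    (w₁' : lor (embed w' 1) V₁ = 0) (w₂' : lor (embed w' 1) V₂ = 0)
    (wR' : lor (embed w' 1) R' = 0) (wnR : lor (embed w' 1) R < 0)
    (wnR' : lor (embed w 1) R' < 0) (hR₁ : lor V₁ R < 0) (hR₂ : lor V₂ R < 0)
    (hR₁' : lor V₁ R' < 0) (hR₂' : lor V₂ R' < 0)
    (hspan : ∀ x, lor x V₁ = 0 → lor x V₂ = 0 → lor x R = 0 → ∃ c : ℝ, x = c • embed w 1) :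
    0 < lor (embed w 1) (embed w 1) ∧ lor (unitVec w) (unitVec w') = -1 ∧
      ∃ c : ℝ, 0 < c ∧ unitVec w + unitVec w' = c • (V₁ + V₂) := by
  -- The null vector of the tangency point of the common edge. Both polar vectors are orthogonal to
  -- it, so their caps have this point on the boundary.
  set P : Lor 2 := V₁ + V₂ with hP
  have hPP : lor P P = 0 := by
    rw [hP]
    simp only [lor_add_left, lor_add_right, h₁₁, h₂₂, h₁₂, lor_comm V₂ V₁]
    norm_num
  have hWP : lor (embed w 1) P = 0 := by rw [hP, lor_add_right, w₁, w₂, add_zero]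
  have hWP' : lor (embed w' 1) P = 0 := by rw [hP, lor_add_right, w₁', w₂', add_zero]
  have hPR : lor P R < 0 := by rw [hP, lor_add_left]; linarith
  have hPR' : lor P R' < 0 := by rw [hP, lor_add_left]; linarith
  have hWW : 0 < lor (embed w 1) (embed w 1) := by
    obtain ⟨p, t, hpt⟩ := exists_eq_embed P
    have ht : 0 < t := by
      have h1 : P.2.1 + P.2.2 = 2 * t := by rw [hpt]; simp only [embed]; ring
      have h2 : P.2.1 + P.2.2 = (V₁.2.1 + V₁.2.2) + (V₂.2.1 + V₂.2.2) := by
        rw [hP]; simp only [Prod.snd_add, Prod.fst_add]; ring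
      linarith
    rw [hpt, lor_embed] at hPP hWP
    -- A vector orthogonal to a null vector is space-like or proportional to it; proportionality is
    -- excluded by `R`, which is orthogonal to the first vector but not to `P`.
    have h3 : ‖t • w - p‖ ^ 2 = t ^ 2 * (lor (embed w 1) (embed w 1)) := by
      rw [norm_sub_sq_real, lor_embed, norm_smul, mul_pow, Real.norm_eq_abs, sq_abs,
        real_inner_smul_left, ← real_inner_self_eq_norm_sq w, ← real_inner_self_eq_norm_sq p]
      linear_combination hPP - 2 * t * hWP
    by_contra! hc
    have h4 : ‖t • w - p‖ ^ 2 = 0 := by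
      refine le_antisymm ?_ (sq_nonneg _)
      rw [h3]
      exact mul_nonpos_of_nonneg_of_nonpos (sq_nonneg t) hc
    rw [sq_eq_zero_iff, norm_eq_zero, sub_eq_zero] at h4
    have h5 : P = t • embed w 1 := by rw [hpt, smul_embed, h4, mul_one]
    rw [h5, lor_smul_left, wR, mul_zero] at hPR
    exact lt_irrefl _ hPR
  refine ⟨hWW, ?_⟩
  have hPV₁ : lor P V₁ = 0 := by rw [hP, lor_add_left, lor_comm V₂, h₁₁, h₁₂]; norm_num
  have hPV₂ : lor P V₂ = 0 := by rw [hP, lor_add_left, h₂₂, h₁₂]; norm_num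
  -- Subtracting this multiple of `P` makes the second polar vector orthogonal to `R` as well as to
  -- the edge, so that `hspan` applies. The product with `R'` then gives a negative coefficient `α`,
  -- and the normalized vectors satisfy `unitVec w' = -unitVec w` plus a positive multiple of `P`.
  set c : ℝ := lor (embed w' 1) R / lor P R with hc
  have hcpos : 0 < c := div_pos_of_neg_of_neg wnR hPR
  obtain ⟨α, hα⟩ := hspan (embed w' 1 - c • P)
    (by rw [lor_sub_left, lor_smul_left, w₁', hPV₁]; ring)
    (by rw [lor_sub_left, lor_smul_left, w₂', hPV₂]; ring)
    (by rw [lor_sub_left, lor_smul_left, hc, div_mul_cancel₀ _ hPR.ne, sub_self])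
  have hW' : embed w' 1 = α • embed w 1 + c • P := by rw [← hα]; abel
  have hαneg : α < 0 := by
    rw [hW', lor_add_left, lor_smul_left, lor_smul_left] at wR'
    have := mul_pos_of_neg_of_neg (neg_neg_of_pos hcpos) hPR'
    by_contra! h
    have := mul_nonpos_of_nonneg_of_nonpos h wnR'.le
    linarith
  set L : ℝ := lor (embed w 1) (embed w 1) with hL
  have hL' : lor (embed w' 1) (embed w' 1) = α ^ 2 * L := by
    rw [hW']
    simp only [lor_add_left, lor_add_right, lor_smul_left, lor_smul_right, hPP, hWP,
      lor_comm P (embed w 1)]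
    rw [← hL]
    ring
  have hs : √(α ^ 2 * L) = -α * √L := by
    rw [Real.sqrt_mul (sq_nonneg _), Real.sqrt_sq_eq_abs, abs_of_neg hαneg]
  have hsL : 0 < √L := Real.sqrt_pos.2 hWW
  have hU' : unitVec w' = -unitVec w + (c / (-α * √L)) • P := by
    rw [unitVec, unitVec, hL', ← hL, hs, hW', smul_add, smul_smul, smul_smul, ← neg_smul]
    congr 2
    · have := hαneg.ne
      field_simp
    · rw [mul_comm, div_eq_mul_inv]
  refine ⟨?_, c / (-α * √L), div_pos hcpos (mul_pos (neg_pos.2 hαneg) hsL), ?_⟩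
  · rw [hU', lor_add_right, map_neg, lor_unitVec_self hWW, lor_smul_right, unitVec, lor_smul_left,
      hWP]
    ring
  · rw [hU']; abel

/-- The vertex of the cube with prescribed `i`-th and `j`-th coordinates and all others equal to
`e`. -/
def cubeVertex (i j : Fin 3) (b c e : Bool) : Fin 3 → Bool :=
  fun m => if m = i then b else if m = j then c else e

theorem cubeVertex_left (i j : Fin 3) (b c e : Bool) : cubeVertex i j b c e i = b := by
  simp [cubeVertex]

theorem cubeVertex_right {i j : Fin 3} (h : i ≠ j) (b c e : Bool) :
    cubeVertex i j b c e j = c := by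
  simp [cubeVertex, h.symm]

theorem cubeVertex_other {i j k : Fin 3} (hi : k ≠ i) (hj : k ≠ j) (b c e : Bool) :
    cubeVertex i j b c e k = e := by
  simp [cubeVertex, hi, hj]

theorem exists_third (i j : Fin 3) (h : i ≠ j) :
    ∃ k, k ≠ i ∧ k ≠ j ∧ ∀ m, m = i ∨ m = j ∨ m = k := by
  revert i j; decide

theorem cube_edge {x y z : Fin 3 → Bool} {i j : Fin 3} (hij : i ≠ j) (hxy : x ≠ y)
    (hi : x i = y i) (hj : x j = y j) : (z i = x i ∧ z j = x j) ↔ (z = x ∨ z = y) := by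
  obtain ⟨k, -, -, hk⟩ := exists_third i j hij
  have hext : ∀ u v : Fin 3 → Bool, u i = v i → u j = v j → u k = v k → u = v := by
    intro u v h1 h2 h3
    funext m
    rcases hk m with rfl | rfl | rfl <;> assumption
  constructor
  · rintro ⟨h1, h2⟩
    have hxk : x k ≠ y k := fun h => hxy (hext _ _ hi hj h)
    by_cases h3 : z k = x k
    · exact Or.inl (hext _ _ h1 h2 h3)
    · refine Or.inr (hext _ _ (h1.trans hi) (h2.trans hj) ?_)
      revert hxk h3
      cases x k <;> cases y k <;> cases z k <;> simp
  · rintro (rfl | rfl)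
    · exact ⟨rfl, rfl⟩
    · exact ⟨hi.symm, hj.symm⟩

/-- The facets of an edge-scribed cube have the unit vectors of an octahedron. -/
theorem exists_cubical_frame (Q : EdgeScribed 3 .cube) :
    (∀ x, 0 < lor (embed (Q.vertex x) 1) (embed (Q.vertex x) 1)) ∧
    ∃ D τ, IsFrame D τ 1 2 ∧ 0 < τ.2.1 ∧
      ∀ x : Fin 3 → Bool, unitVec (Q.vertex x) = frameVec D τ (fun k => sgn (x k)) 1 := by
  have hfacets : ∀ x : Fin 3 × Bool,
      ∃ w, IsFacetWithPolar Q.vertex {y : Fin 3 → Bool | y x.1 = x.2} w :=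
    fun x => Q.exists_polar ⟨x.1, x.2, rfl⟩
  choose w hw using hfacets
  have hedge : ∀ (x y : Fin 3 → Bool) (i j : Fin 3), i ≠ j → x ≠ y → x i = y i → x j = y j →
      IsEdge Q.vertex x y := fun x y i j hij hxy hi hj =>
    (hw (i, x i)).isEdge (hw (j, x j)) hxy fun z => cube_edge hij hxy hi hj
  have hpos : ∀ x : Fin 3 → Bool, 0 < lor (embed (Q.vertex x) 1) (embed (Q.vertex x) 1) := by
    intro x
    refine (Q.edge_gram (hedge x (Function.update x 2 (!x 2)) 0 1 (by decide) ?_ ?_ ?_)).1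
    · intro h
      have := congrFun h 2
      simp at this
    · simp
    · simp
  refine ⟨hpos, ?_⟩
  set V : (Fin 3 → Bool) → Lor 2 := fun x => unitVec (Q.vertex x) with hV
  have hVV : ∀ x, lor (V x) (V x) = 1 := fun x => lor_unitVec_self (hpos x)
  have hVt : ∀ x, 0 < (V x).2.1 + (V x).2.2 := fun x => time_unitVec_pos (hpos x)
  have hVe : ∀ (x y : Fin 3 → Bool) (i j : Fin 3), i ≠ j → x ≠ y → x i = y i → x j = y j →
      lor (V x) (V y) = -1 := fun x y i j hij hxy hi hj =>
    (Q.edge_gram (hedge x y i j hij hxy hi hj)).2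
  have hon : ∀ (i : Fin 3) (b : Bool) (x : Fin 3 → Bool), x i = b →
      lor (embed (w (i, b)) 1) (V x) = 0 := fun i b x hx =>
    lor_unitVec_right_eq_zero ((hw (i, b)).lor_eq_zero (i := x) hx)
  have hoff : ∀ (i : Fin 3) (b : Bool) (x : Fin 3 → Bool), x i = !b →
      lor (embed (w (i, b)) 1) (V x) < 0 := fun i b x hx =>
    lor_unitVec_right_neg (hpos x) ((hw (i, b)).lor_neg (i := x) (by
      intro (h : x i = b)
      rw [hx] at h
      simp at h))
  -- The face `x i = b` as a quadrangle; the four auxiliary functionals are the polar vectors of the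
  -- faces adjacent to it.
  have hsquare : ∀ (i j : Fin 3), i ≠ j → ∀ b c e : Bool,
      lor (V (cubeVertex i j b c e)) (V (cubeVertex i j b (!c) (!e))) < 0 ∧
      ∀ x, lor x (V (cubeVertex i j b c e)) = 0 → lor x (V (cubeVertex i j b c (!e))) = 0 →
        lor x (V (cubeVertex i j b (!c) e)) = 0 →
          lor x (V (cubeVertex i j b (!c) (!e))) = 0 := by
    intro i j hij b c e
    obtain ⟨k, hki, hkj, -⟩ := exists_third i j hij
    have hne1 : ∀ c' : Bool, cubeVertex i j b c' e ≠ cubeVertex i j b c' (!e) := fun c' h => by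
      have := congrFun h k
      rw [cubeVertex_other hki hkj, cubeVertex_other hki hkj] at this
      simp at this
    have hne2 : ∀ e' : Bool, cubeVertex i j b c e' ≠ cubeVertex i j b (!c) e' := fun e' h => by
      have := congrFun h j
      rw [cubeVertex_right hij, cubeVertex_right hij] at this
      simp at this
    refine quadrangle (lor_embed_one_ne_zero (w (i, b)))
      (hon _ _ _ (cubeVertex_left _ _ _ _ _)) (hon _ _ _ (cubeVertex_left _ _ _ _ _))
      (hon _ _ _ (cubeVertex_left _ _ _ _ _)) (hon _ _ _ (cubeVertex_left _ _ _ _ _))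
      (hVV _)
      (hVe _ _ i j hij (hne1 c) (by simp only [cubeVertex_left])
        (by simp only [cubeVertex_right hij]))
      (hVe _ _ i k hki.symm (hne2 e) (by simp only [cubeVertex_left])
        (by simp only [cubeVertex_other hki hkj]))
      (A := embed (w (j, c)) 1) (B := embed (w (k, !e)) 1) (C := embed (w (j, !c)) 1)
      (D := embed (w (k, e)) 1) ?_ ?_ ?_ ?_ ?_ ?_ ?_ ?_ ?_ ?_ ?_ ?_ ?_ ?_ ?_ ?_
    all_goals first
      | exact hon _ _ _ (cubeVertex_right hij _ _ _)
      | exact hon _ _ _ (cubeVertex_other hki hkj _ _ _)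
      | exact hoff _ _ _ (cubeVertex_right hij _ _ _)
      | exact hoff _ _ _ (cubeVertex_other hki hkj _ _ _)
      | exact hoff _ _ _ ((cubeVertex_right hij _ _ _).trans (Bool.not_not _).symm)
      | exact hoff _ _ _ ((cubeVertex_other hki hkj _ _ _).trans (Bool.not_not _).symm)
  have hswap : ∀ (i j : Fin 3), i ≠ j → ∀ b c e : Bool,
      cubeVertex i j b c e = cubeVertex j i c b e := by
    intro i j hij b c e
    funext m
    simp only [cubeVertex]
    split_ifs with h1 h2 h2
    · exact absurd (h1.symm.trans h2) hij
    all_goals rfl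
  have hadj : ∀ (i j : Fin 3), i ≠ j → ∀ b c : Bool,
      0 < lor (embed (w (i, b)) 1) (embed (w (i, b)) 1) ∧
      lor (unitVec (w (i, b))) (unitVec (w (j, c))) = -1 ∧
      ∃ a : ℝ, 0 < a ∧ unitVec (w (i, b)) + unitVec (w (j, c)) =
        a • (V (cubeVertex i j b c true) + V (cubeVertex i j b c false)) := by
    intro i j hij b c
    obtain ⟨k, hki, hkj, hk⟩ := exists_third i j hij
    have hopp : ∀ (i j : Fin 3), i ≠ j → ∀ b c, lor (V (cubeVertex i j b c false))
        (V (cubeVertex i j b (!c) true)) < 0 := fun i j hij b c => (hsquare i j hij b c false).1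
    have hside : ∀ (i j : Fin 3), i ≠ j → ∀ b c, lor (V (cubeVertex i j b c true))
        (V (cubeVertex i j b (!c) true)) < 0 := by
      intro i j hij b c
      obtain ⟨k, hki, hkj, -⟩ := exists_third i j hij
      rw [hVe _ _ i k hki.symm ?_ (by simp only [cubeVertex_left])
        (by simp only [cubeVertex_other hki hkj])]
      · norm_num
      · intro h
        have := congrFun h j
        rw [cubeVertex_right hij, cubeVertex_right hij] at this
        simp at this
    refine adjacent_polar (R := V (cubeVertex i j b (!c) true))
      (R' := V (cubeVertex i j (!b) c true)) (hVV _) (hVV _) ?_ (hVt _) (hVt _)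
      (hon _ _ _ (cubeVertex_left _ _ _ _ _)) (hon _ _ _ (cubeVertex_left _ _ _ _ _))
      (hon _ _ _ (cubeVertex_left _ _ _ _ _)) (hon _ _ _ (cubeVertex_right hij _ _ _))
      (hon _ _ _ (cubeVertex_right hij _ _ _)) (hon _ _ _ (cubeVertex_right hij _ _ _))
      (hoff _ _ _ (cubeVertex_right hij _ _ _)) (hoff _ _ _ (cubeVertex_left _ _ _ _ _))
      (hside i j hij b c) (hopp i j hij b c) ?_ ?_ ?_
    · refine hVe _ _ i j hij ?_ (by simp only [cubeVertex_left])
        (by simp only [cubeVertex_right hij])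
      intro h
      have := congrFun h k
      rw [cubeVertex_other hki hkj, cubeVertex_other hki hkj] at this
      simp at this
    · rw [hswap i j hij, hswap i j hij]
      exact hside j i hij.symm c b
    · rw [hswap i j hij, hswap i j hij]
      exact hopp j i hij.symm c b
    · intro x h1 h2 h3
      have h4 := (hsquare i j hij b c true).2 x h1 h2 h3
      refine (hw (i, b)).exists_eq_smul fun y hy => ?_
      have hy' : y i = b := hy
      have h5 : lor x (V y) = 0 := by
        have h6 : y = cubeVertex i j b (y j) (y k) := by
          funext m
          rcases hk m with rfl | rfl | rfl
          · rw [cubeVertex_left, hy']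
          · rw [cubeVertex_right hij]
          · rw [cubeVertex_other hki hkj]
        rw [h6]
        rcases Bool.eq_or_eq_not (y j) c with e1 | e1 <;> rw [e1] <;> cases y k <;> assumption
      simp only [hV, unitVec, lor_smul_right, mul_eq_zero] at h5
      exact h5.resolve_left (scale_unitVec_pos (hpos y)).ne'
  have hwpos : ∀ x : Fin 3 × Bool, 0 < lor (embed (w x) 1) (embed (w x) 1) := by
    rintro ⟨i, b⟩
    exact (hadj i (i + 1) (by fin_cases i <;> decide) b b).1
  obtain ⟨D, τ, hfr, hτ, hU⟩ := exists_octahedral_frame (U := fun x => unitVec (w x))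
    (fun x => lor_unitVec_self (hwpos x)) (fun x y hxy => (hadj x.1 y.1 hxy x.2 y.2).2.1) (by
      intro i h
      have hij : i ≠ i + 1 := by fin_cases i <;> decide
      -- If opposite faces had product `1`, the difference of their vectors would be orthogonal to
      -- the sum of two adjacent ones. That sum is a positive multiple of the tangency vector of an
      -- edge, on whose end points the difference is positive.
      obtain ⟨-, h1, a, ha, h2⟩ := hadj i (i + 1) hij true true
      obtain ⟨-, h3, -⟩ := hadj i (i + 1) hij false true
      have h4 : ∀ e, 0 < lor (unitVec (w (i, true)) - unitVec (w (i, false)))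
          (V (cubeVertex i (i + 1) true true e)) := by
        intro e
        have e1 := hon i true _ (cubeVertex_left i (i + 1) true true e)
        have e2 := hoff i false _ (cubeVertex_left i (i + 1) true true e)
        rw [lor_sub_left]
        simp only [unitVec, lor_smul_left]
        rw [e1, mul_zero, zero_sub, neg_pos]
        exact mul_neg_of_pos_of_neg (scale_unitVec_pos (hwpos _)) e2
      have h5 : lor (unitVec (w (i, true)) - unitVec (w (i, false)))
          (unitVec (w (i, true)) + unitVec (w (i + 1, true))) = 0 := by
        rw [lor_add_right, lor_sub_left, lor_sub_left, lor_unitVec_self (hwpos _),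
          lor_comm (unitVec (w (i, false))) (unitVec (w (i, true))), h, h1, h3]
        norm_num
      rw [h2, lor_smul_right, lor_add_right] at h5
      have := mul_pos ha (add_pos (h4 true) (h4 false))
      linarith)
  have hτpos : 0 < τ.2.1 := by
    refine coord_pos_of_timelike ?_ (by rw [hfr.lor_time]; norm_num)
    rw [hτ]
    simp only [Prod.smul_snd, Prod.smul_fst, Prod.snd_add, Prod.fst_add, smul_eq_mul]
    have h0 := time_unitVec_pos (hwpos (0, true))
    have h1 := time_unitVec_pos (hwpos (0, false))
    linarith
  have h22 := Real.mul_self_sqrt (show (0 : ℝ) ≤ 2 by norm_num)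
  have h2pos : 0 < √2 := by positivity
  -- In the octahedral frame of the faces, orthogonality to three faces gives the vertex coordinates
  -- `t * sgn (x i) / 2` and `t`; being a unit vector forces `t = √2`. The rescaling turns these
  -- coordinates into signs and `1`.
  refine ⟨fun k => (√2 / 2) • D k, √2 • τ, ⟨?_, ?_, ?_, one_pos, two_pos⟩, ?_, ?_⟩
  · intro i j
    rw [lor_smul_left, lor_smul_right, hfr.lor_space]
    split_ifs
    · linear_combination h22 / 2
    · ring
  · intro i
    rw [lor_smul_left, lor_smul_right, hfr.lor_space_time]
    ring
  · rw [lor_smul_left, lor_smul_right, hfr.lor_time]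
    linear_combination -h22
  · simpa using hτpos
  · intro x
    obtain ⟨c, t, hct⟩ := hfr.exists_eq_frameVec (V x)
    have hUx : ∀ i b, lor (unitVec (w (i, b))) (V x) = 2 * (sgn b * c i) - t := by
      intro i b
      have h1 : unitVec (w (i, b)) = _ := hU (i, b)
      rw [h1, hct, hfr.lor_frameVec]
      simp [Pi.single_apply]
    have hc : ∀ i, c i = t * sgn (x i) / 2 := by
      intro i
      have h1 := hUx i (x i)
      have h2 : lor (unitVec (w (i, x i))) (V x) = 0 := by
        rw [unitVec, lor_smul_left, hon i (x i) x rfl, mul_zero]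
      have h3 := sgn_sq (x i)
      rw [h2] at h1
      linear_combination -(sgn (x i) / 2 : ℝ) * h1 - c i * h3
    have ht : 0 < t := by
      have h1 := hUx 0 (!x 0)
      have h2 : lor (unitVec (w (0, !x 0))) (V x) < 0 := by
        rw [unitVec, lor_smul_left]
        exact mul_neg_of_pos_of_neg (scale_unitVec_pos (hwpos _))
          (hoff 0 (!x 0) x (Bool.not_not _).symm)
      have h3 := sgn_sq (x 0)
      rw [h1, hc, sgn_not] at h2
      push_cast at h2
      nlinarith
    have ht2 : t ^ 2 = 2 := by
      have h1 := hVV x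
      rw [hct, hfr.lor_frameVec, Fin.sum_univ_three, hc, hc, hc] at h1
      have e0 := sgn_sq (x 0)
      have e1 := sgn_sq (x 1)
      have e2 := sgn_sq (x 2)
      linear_combination 2 * h1 - t ^ 2 * (e0 + e1 + e2)
    have ht' : t = √2 := by
      rw [← Real.sqrt_sq ht.le, ht2]
    change V x = _
    rw [hct]
    simp only [frameVec, hc, ht', Fin.sum_univ_three]
    module

theorem nonempty_linearSection_cube (Q : EdgeScribed 3 .cube) : Nonempty (LinearSection Q) := by
  obtain ⟨hpos, D, τ, hfr, hτ, hU⟩ := exists_cubical_frame Q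
  refine ⟨cubicalSection hfr hτ Q _ (fun i => scale_unitVec_pos (hpos i))
    (fun i => (hU i).symm) ?_⟩
  intro S w hw
  obtain ⟨i, b, rfl⟩ := Q.mem_facets hw
  refine ⟨i, b, hw.exists_embed_eq_smul hpos ?_ ?_⟩
  · intro h0
    have h1 := hfr.lor_frameVec (Pi.single i (2 * sgn b)) (Pi.single i (2 * sgn b)) 1 1
    have h2 := sgn_sq b
    rw [h0, map_zero] at h1
    simp [Pi.single_apply] at h1
    nlinarith
  · intro x hx
    obtain rfl : x i = b := hx
    have h2 := sgn_sq (x i)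
    rw [hU, hfr.lor_frameVec]
    simp [Pi.single_apply]
    linarith

theorem nonempty_linearSection (K : Family) (Q : EdgeScribed 3 K) :
    Nonempty (LinearSection Q) := by
  cases K with
  | simplex => exact nonempty_linearSection_simplex Q
  | crossPolytope => exact nonempty_linearSection_crossPolytope Q
  | cube => exact nonempty_linearSection_cube Q

end ApollonianSections

end

/-- For every tetrahedral, octahedral or cubical Apollonian circle packing there is an orthoplicial
Apollonian sphere packing that contains an arithmetically equivalent Apollonian section and that is
integral if and only if the circle packing is. -/
theorem theorem1 (K : ApollonianSections.Family)
    (B : ApollonianSections.PolytopalPacking 2 K) :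
    ∃ O : ApollonianSections.PolytopalPacking 3 ApollonianSections.Family.crossPolytope,
      (∃ (Γ : Subgroup (Equiv.Perm (ApollonianSections.Hat 3)))
          (X : Set (Set (ApollonianSections.Hat 3))),
        ApollonianSections.IsSection O Γ X ∧
        ApollonianSections.ArithmeticallyEquivalent Γ X B.apollonianGroup B.balls) ∧
      (B.IsIntegral ↔ O.IsIntegral) := by
  obtain ⟨L⟩ := ApollonianSections.nonempty_linearSection K B.polytope
  exact L.conclusion
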